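/- \textbf{Lemma (inf-sup stability).} Let $1\le d\le 3$, let $k\ge 0$ be an integer, and let $\mu>0$, $\sigma>0$, $M\ge 0$. There is a constant $\beta_A>0$, depending only on $d,k,\mu,\sigma,M$ (in particular not on the mesh size $h$), such that the following holds. Let $\Omega\subset\mathbb{R}^d$ be a bounded polygonal (polyhedral) domain with boundary $\Gamma$, and let $\mathcal{T}$ be a finite conforming triangulation of $\Omega$ into closed non-overlapping simplices $K$ with diameters $h_K\le 1$ that are shape regular, $h_K\le\sigma\rho_K$, where $\rho_K$ is the diameter of the largest ball contained in $K$. Let $\mathbf{a}:\overline{\Omega}\to\mathbb{R}^d$ be Lipschitz continuous on $\overline\Omega$ and divergence-free, with $\|\mathbf{a}\|_{L^\infty(\Omega)}\le 1$ and $|\mathbf{a}|_{W^1_\infty(\Omega)}=\operatorname{ess\,sup}_\Omega|\nabla\mathbf{a}|\le M$. Let $\mathbf n$ be the outward unit normal to $\partial K$ (to $\Gamma$ on $\Gamma$), put $a_n=|\mathbf{a}\cdot\mathbf{n}|$, let $\partial K_+$ and $\partial K_-$ be the parts of $\partial K$ where $\mathbf a\cdot\mathbf n\ge 0$ and $\mathbf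 a\cdot\mathbf n<0$ respectively, and let $\Gamma_+$ be the part of $\Gamma$ where $\mathbf a\cdot\mathbf n\ge0$. Let $\mathcal F$ be the set of facets of the mesh, $\Gamma^0$ the union of all facets, $0\le l\le 1$, and let \[ W_h=\{w\in L^2(\Omega): w|_K\in P_k(K)\ \forall K\in\mathcal T\},\qquad \bar W_h=\{\bar w\in H^l(\Gamma^0): \bar w|_F\in P_k(F)\ \forall F\in\mathcal F\}, \] $W_h^\star=W_h\times\bar W_h$, where $P_k$ denotes polynomials of total degree at most $k$. For $\boldsymbol w=(w,\bar w)$ and $\boldsymbol v=(v,\bar v)$ in $W_h^\star$ let \[ \begin{aligned} B_A(\boldsymbol w,\boldsymbol v)={}&\int_\Omega\mu wv\,dx-\sum_K\int_K w\,\mathbf a\cdot\nabla v\,dx-\sum_K\int_{\partial K_+}\mathbf a\cdot\mathbf n\,w(\bar v-v)\,ds\\ &-\sum_K\int_{\partial K_-}\mathbf a\cdot\mathbf n\,\bar w(\bar v-v)\,ds+\int_{\Gamma_+}\mathbf a\cdot\mathbf n\,\bar w\bar v\,ds , \end{aligned} \] \[ |||\boldsymbol v|||_A^2=\mu\|v\|_{0,\Omega}^2+\sum_K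 h_K\|\mathbf a\cdot\nabla v\|_{0,K}^2+\sum_K\|a_n^{1/2}(\bar v-v)\|_{0,\partial K}^2+\|a_n^{1/2}\bar v\|_{0,\Gamma}^2 , \] where on $\partial K$ the values of $w,v$ are the traces taken from inside $K$. Then for all $\boldsymbol v_h\in W_h^\star$ \[ \sup_{\boldsymbol w_h\in W_h^\star,\ |||\boldsymbol w_h|||_A\ne 0}\frac{B_A(\boldsymbol v_h,\boldsymbol w_h)}{|||\boldsymbol w_h|||_A}\ \ge\ \beta_A\,|||\boldsymbol v_h|||_A , \] and the supremum is finite. -/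

import Mathlib

open MeasureTheory
open scoped NNReal ENNReal

namespace InterfaceStab

noncomputable section

/-- The Euclidean space `ℝ^d`. -/
abbrev E (d : ℕ) : Type := EuclideanSpace ℝ (Fin d)

/-- A nondegenerate `d`-simplex of `ℝ^d`, given by its `d + 1` affinely independent vertices.
The closed cell is `K.closedInterior`. -/
abbrev Cell (d : ℕ) : Type := Affine.Simplex ℝ (E d) d

/-- The `(d-1)`-dimensional surface measure `ds`, i.e. the `(d-1)`-dimensional Hausdorff measure
normalised so that it is Lebesgue measure on hyperplanes (for `d = 1` the counting measure). -/
abbrev surf (d : ℕ) : Measure (E d) := Measure.euclideanHausdorffMeasure (d - 1)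

/-- The diameter `h_K` of a cell. -/
def cellSize {d : ℕ} (K : Cell d) : ℝ := Metric.diam K.closedInterior

/-- The (closed) facet of `K` opposite to the vertex number `i`. -/
def facet {d : ℕ} [NeZero d] (K : Cell d) (i : Fin (d + 1)) : Set (E d) :=
  (K.faceOpposite i).closedInterior

/-- The outward unit normal of `K` on the facet opposite to the vertex number `i`: the unit vector
that points from this vertex to its orthogonal projection on the hyperplane of the facet. -/
def normal {d : ℕ} [NeZero d] (K : Cell d) (i : Fin (d + 1)) : E d :=
  (K.height i)⁻¹ • (K.altitudeFoot i -ᵥ K.points i)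

/-- `T` is a conforming triangulation of the polygonal (polyhedral) set `Ω`: finitely many
non-overlapping closed simplices, any two of which meet in the convex hull of their common
vertices (a common face, or nothing), and `Ω` is the interior of their union. -/
structure IsTriangulation {d : ℕ} (Ω : Set (E d)) (T : Finset (Cell d)) : Prop where
  interior_eq : Ω = interior (⋃ K ∈ T, K.closedInterior)
  disjoint : ∀ K ∈ T, ∀ K' ∈ T, K ≠ K' → Disjoint K.interior K'.interior
  conforming : ∀ K ∈ T, ∀ K' ∈ T, K ≠ K' →
    K.closedInterior ∩ K'.closedInterior =
      convexHull ℝ (Set.range K.points ∩ Set.range K'.points)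

/-- Shape regularity with parameter `σ`: `h_K ≤ σ ρ_K`, where `ρ_K` is the diameter of the
largest ball contained in `K`. -/
def IsShapeRegular {d : ℕ} (σ : ℝ) (K : Cell d) : Prop :=
  ∃ (x : E d) (r : ℝ), 0 < r ∧ Metric.closedBall x r ⊆ K.closedInterior ∧
    cellSize K ≤ σ * (2 * r)

/-- `Γ⁰`, the union of all facets of the mesh. -/
def skeleton {d : ℕ} [NeZero d] (T : Finset (Cell d)) : Set (E d) :=
  ⋃ K ∈ T, ⋃ i : Fin (d + 1), facet K i

/-- The divergence of a vector field (it exists almost everywhere if the field is Lipschitz, and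
is then also the weak divergence). -/
def divergence {d : ℕ} (a : E d → E d) (x : E d) : ℝ :=
  ∑ i : Fin d, (fderiv ℝ a x (EuclideanSpace.single i 1)) i

/-- The assumptions on the advective velocity: Lipschitz continuous on the closure of `Ω`,
divergence-free, and bounded by one in `L^∞(Ω)`. -/
structure IsAdvection {d : ℕ} (Ω : Set (E d)) (a : E d → E d) : Prop where
  lipschitz : ∃ L : ℝ≥0, LipschitzOnWith L a (closure Ω)
  div_free : ∀ᵐ x ∂(volume.restrict Ω), divergence a x = 0
  bounded : eLpNorm a ∞ (volume.restrict Ω) ≤ 1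

/-- The seminorm `|a|_{W^1_∞(Ω)}`, the essential supremum over `Ω` of the (operator norm of the)
gradient of `a`. -/
def seminormW1inf {d : ℕ} (Ω : Set (E d)) (a : E d → E d) : ℝ≥0∞ :=
  eLpNorm (fun x => fderiv ℝ a x) ∞ (volume.restrict Ω)

/-- `p` is (the function of) a real polynomial in `d` variables of total degree at most `k`. -/
def IsPoly {d : ℕ} (k : ℕ) (p : E d → ℝ) : Prop :=
  ∃ P : MvPolynomial (Fin d) ℝ, P.totalDegree ≤ k ∧
    ∀ x : E d, p x = MvPolynomial.eval (fun j => x j) P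

/-- The broken polynomial space `W_h`. A function that is polynomial on each cell and may jump
between cells is represented by its restrictions `w K` to the closed cells `K`, the values of `w K`
on the boundary of `K` being the trace taken from inside `K`. -/
def cellSpace {d : ℕ} (k : ℕ) (T : Finset (Cell d)) : Set (Cell d → E d → ℝ) :=
  {w | ∀ K ∈ T, ∃ p : E d → ℝ, IsPoly k p ∧ ∀ x ∈ K.closedInterior, w K x = p x}

/-- Membership in `H^l(S)`, `0 ≤ l ≤ 1`, for a `(d-1)`-dimensional set `S` with its surface
measure: `L²(S)` for `l = 0`; finiteness of the Sobolev-Slobodeckij seminorm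
`∬ |u x - u y|² / |x - y|^(d - 1 + 2 l)` for `0 < l < 1`; and for `l = 1` the pointwise (Hajlasz)
characterisation of `H^1` through `|u x - u y| ≤ |x - y| (g x + g y)` with `g` in `L²(S)`. -/
def MemH {d : ℕ} (l : ℝ) (S : Set (E d)) (u : E d → ℝ) : Prop :=
  MemLp u 2 ((surf d).restrict S) ∧
  (0 < l → l < 1 →
    MemLp (fun p : E d × E d => (u p.1 - u p.2) / dist p.1 p.2 ^ (((d : ℝ) - 1) / 2 + l)) 2
      (((surf d).restrict S).prod ((surf d).restrict S))) ∧
  (l = 1 → ∃ g : E d → ℝ, MemLp g 2 ((surf d).restrict S) ∧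
    ∀ᵐ p ∂(((surf d).restrict S).prod ((surf d).restrict S)),
      |u p.1 - u p.2| ≤ dist p.1 p.2 * (g p.1 + g p.2))

/-- The interface space: functions in `H^l(Γ⁰)` whose restriction to every facet is a polynomial
of degree at most `k` (there is no Dirichlet boundary in the hyperbolic case). -/
def interfaceSpace {d : ℕ} [NeZero d] (k : ℕ) (l : ℝ) (T : Finset (Cell d)) :
    Set (E d → ℝ) :=
  {u | MemH l (skeleton T) u ∧
    ∀ K ∈ T, ∀ i : Fin (d + 1), ∃ p : E d → ℝ, IsPoly k p ∧
      u =ᵐ[(surf d).restrict (facet K i)] p}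

/-- Pairs `(w, w̄)` of a cellwise function and an interface function. -/
abbrev Pair (d : ℕ) : Type := (Cell d → E d → ℝ) × (E d → ℝ)

/-- `W*_h`, the product of the two finite element spaces. -/
def starSpace {d : ℕ} [NeZero d] (k : ℕ) (l : ℝ) (T : Finset (Cell d)) : Set (Pair d) :=
  {w | w.1 ∈ cellSpace k T ∧ w.2 ∈ interfaceSpace k l T}

/-- The normal component `a · n` on the facet number `i` of `K`. -/
def aDotN {d : ℕ} [NeZero d] (a : E d → E d) (K : Cell d) (i : Fin (d + 1)) (x : E d) : ℝ :=
  inner ℝ (a x) (normal K i)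

/-- The part of the facet number `i` of `K` that lies in the outflow boundary `∂K₊`. -/
def outflow {d : ℕ} [NeZero d] (a : E d → E d) (K : Cell d) (i : Fin (d + 1)) : Set (E d) :=
  {x | x ∈ facet K i ∧ 0 ≤ aDotN a K i x}

/-- The part of the facet number `i` of `K` that lies in the inflow boundary `∂K₋`. -/
def inflow {d : ℕ} [NeZero d] (a : E d → E d) (K : Cell d) (i : Fin (d + 1)) : Set (E d) :=
  {x | x ∈ facet K i ∧ aDotN a K i x < 0}

/-- The advective bilinear form `B_A(w, v)`. Integrals over `∂K` are sums over the facets of `K`;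
integrals over `Γ = ∂Ω` are sums over the parts of facets that lie in `∂Ω`. -/
def BA {d : ℕ} [NeZero d] (μ : ℝ) (a : E d → E d) (Ω : Set (E d)) (T : Finset (Cell d))
    (w v : Pair d) : ℝ :=
  (∑ K ∈ T, ∫ x in K.closedInterior, μ * w.1 K x * v.1 K x)
  - (∑ K ∈ T, ∫ x in K.closedInterior, w.1 K x * inner ℝ (a x) (gradient (v.1 K) x))
  - (∑ K ∈ T, ∑ i : Fin (d + 1), ∫ x in outflow a K i,
      aDotN a K i x * w.1 K x * (v.2 x - v.1 K x) ∂(surf d))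
  - (∑ K ∈ T, ∑ i : Fin (d + 1), ∫ x in inflow a K i,
      aDotN a K i x * w.2 x * (v.2 x - v.1 K x) ∂(surf d))
  + ∑ K ∈ T, ∑ i : Fin (d + 1), ∫ x in outflow a K i ∩ frontier Ω,
      aDotN a K i x * w.2 x * v.2 x ∂(surf d)

/-- The stability norm `|||v|||_A`. -/
def normA {d : ℕ} [NeZero d] (μ : ℝ) (a : E d → E d) (Ω : Set (E d)) (T : Finset (Cell d))
    (v : Pair d) : ℝ :=
  Real.sqrt (
    μ * (∑ K ∈ T, ∫ x in K.closedInterior, (v.1 K x) ^ 2)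
    + (∑ K ∈ T, cellSize K *
        ∫ x in K.closedInterior, (inner ℝ (a x) (gradient (v.1 K) x)) ^ 2)
    + (∑ K ∈ T, ∑ i : Fin (d + 1), ∫ x in facet K i,
        |aDotN a K i x| * (v.2 x - v.1 K x) ^ 2 ∂(surf d))
    + ∑ K ∈ T, ∑ i : Fin (d + 1), ∫ x in facet K i ∩ frontier Ω,
        |aDotN a K i x| * (v.2 x) ^ 2 ∂(surf d))

/-- The set of quotients `B_A(v, w) / |||w|||_A`, `w ∈ W*_h`, `|||w|||_A ≠ 0`, over which the
supremum in the inf-sup condition is taken. -/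
def quotients {d : ℕ} [NeZero d] (k : ℕ) (l μ : ℝ) (a : E d → E d) (Ω : Set (E d))
    (T : Finset (Cell d)) (v : Pair d) : Set ℝ :=
  {r | ∃ w ∈ starSpace k l T, normA μ a Ω T w ≠ 0 ∧ r = BA μ a Ω T v w / normA μ a Ω T w}

end

end InterfaceStab

/-!
The inf-sup condition is proved by exhibiting, for every `v = (p, u)` in the discrete space, a test
function `w` with `B(v, w) ≥ c |||v|||²` and `|||w||| ≤ D |||v|||`, the constants depending only on
`d`, `k`, `μ`, `σ` and `M` (`exists_test_function`).

Testing with `v` itself gives the reaction, jump and boundary terms of the norm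
(`sum_localForm_self`): by the divergence theorem and `div a = 0`, the cell and facet integrals
combine to squares with weight `|a · n|`, up to the integrals of `a · n u²` over the facets, which
cancel in the interior of `Ω`. What is missing is the streamline derivative. It is recovered by the
test function `(z, 0)` with `z = h_K (a(x₀) · ∇p)` on `K`, where `a` is frozen at a vertex `x₀` of
`K` to make `z` a polynomial of degree at most `k` (`exists_streamline_test`). After integration by
parts, `B(v, (z, 0))` is `h_K ∫ (a · ∇p)²` up to terms that are controlled by the reaction and the
jump part of the norm, by Young's inequality, the inverse and discrete trace inequalities
(`exists_inverse_trace_const`), and the bound `|a(x) - a(x₀)| ≤ M h_K`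
(`IsAdvection.lipschitzOnWith_cell`). The function `w = v + δ (z, 0)` with `δ` small has the two
required properties.

The tools behind these steps are the following.
* The divergence theorem on a simplex for Lipschitz functions (`integral_fderiv_cell`). It suffices
  to consider the direction of an edge. By Fubini, the fundamental theorem of calculus is integrated
  over the lines parallel to that edge, which enter the simplex through one facet and leave it
  through another one.
* The inverse and trace inequalities. They follow from the equivalence of norms on a
  finite-dimensional space of polynomials over a ball, scaled to the inscribed ball of the simplex,
  together with the bound of the surface measure of a facet by that of a sweep of it
  (`surf_le_of_subset_ball`).
* The cancellation of fluxes (`IsTriangulation.sum_flux_eq`). The sum of the outward normals of all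
  cells vanishes almost everywhere on the skeleton inside `Ω`, since adding up the divergence
  theorems for a test function supported in `Ω` shows that it vanishes in the weak sense. This
  makes it unnecessary to pair the two sides of each facet.
-/

namespace InterfaceStab

/-! ### Barycentric coordinates and the geometry of a simplex -/

section SimplexGeometry

variable {d : ℕ}

/-- The vertices of a cell as an affine basis of `ℝ^d`. -/
noncomputable def vertexBasis (K : Cell d) : AffineBasis (Fin (d + 1)) ℝ (E d) :=
  ⟨K.points, K.independent, Affine.Simplex.span_eq_top K (by simp)⟩

/-- The barycentric coordinate of the vertex number `i`, as an affine function on all of `ℝ^d`. -/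
noncomputable def bary (K : Cell d) (i : Fin (d + 1)) : E d →ᵃ[ℝ] ℝ := (vertexBasis K).coord i

lemma bary_point_self (K : Cell d) (i : Fin (d + 1)) : bary K i (K.points i) = 1 :=
  (vertexBasis K).coord_apply_eq i

lemma bary_point_of_ne (K : Cell d) {i j : Fin (d + 1)} (h : i ≠ j) :
    bary K i (K.points j) = 0 :=
  (vertexBasis K).coord_apply_ne h

lemma sum_bary (K : Cell d) (x : E d) : ∑ i, bary K i x = 1 :=
  (vertexBasis K).sum_coord_apply_eq_one x

lemma affineCombination_bary (K : Cell d) (x : E d) :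
    Finset.univ.affineCombination ℝ K.points (fun i => bary K i x) = x :=
  (vertexBasis K).affineCombination_coord_eq_self x

lemma continuous_bary (K : Cell d) (i : Fin (d + 1)) : Continuous (bary K i) :=
  (bary K i).continuous_of_finiteDimensional

lemma mem_closedInterior_iff_bary (K : Cell d) (x : E d) :
    x ∈ K.closedInterior ↔ ∀ i, 0 ≤ bary K i x := by
  have h := Affine.Simplex.affineCombination_mem_closedInterior_iff (s := K) (sum_bary K x)
  rw [affineCombination_bary] at h
  rw [h]
  refine ⟨fun h i => (h i).1, fun h i => ⟨h i, ?_⟩⟩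
  rw [← sum_bary K x]
  exact Finset.single_le_sum (f := fun j => bary K j x) (fun j _ => h j) (Finset.mem_univ i)

lemma mem_facet_iff_bary [NeZero d] (K : Cell d) (i : Fin (d + 1)) (x : E d) :
    x ∈ facet K i ↔ x ∈ K.closedInterior ∧ bary K i x = 0 := by
  have h := K.affineCombination_mem_closedInterior_face_iff_nonneg
    (fs := {i}ᶜ) (m := d - 1)
    (by simp [Finset.card_compl, Nat.sub_add_cancel (NeZero.one_le (n := d))]) (sum_bary K x)
  rw [affineCombination_bary] at h
  rw [facet, Affine.Simplex.faceOpposite, h, mem_closedInterior_iff_bary]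
  simp only [Finset.mem_compl, Finset.mem_singleton, not_not, forall_eq]
  refine ⟨fun ⟨h1, h2⟩ => ⟨fun j => ?_, h2⟩, fun ⟨h1, h2⟩ => ⟨fun j _ => h1 j, h2⟩⟩
  by_cases hj : j = i
  · rw [hj, h2]
  · exact h1 j hj

lemma facet_subset [NeZero d] (K : Cell d) (i : Fin (d + 1)) : facet K i ⊆ K.closedInterior :=
  fun x hx => ((mem_facet_iff_bary K i x).1 hx).1

lemma convex_closedInterior (K : Cell d) : Convex ℝ K.closedInterior := by
  rw [← K.convexHull_eq_closedInterior]
  exact convex_convexHull _ _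

lemma interior_closedInterior (K : Cell d) :
    interior K.closedInterior = {x | ∀ i, 0 < bary K i x} := by
  rw [← K.convexHull_eq_closedInterior]
  exact (vertexBasis K).interior_convexHull

lemma interior_eq_interior_closedInterior [NeZero d] (K : Cell d) :
    K.interior = interior K.closedInterior := by
  ext x
  have h1 : x ∈ K.interior ↔ x ∈ K.closedInterior ∧ ¬ ∃ i, x ∈ facet K i := by
    have h := K.closedInterior_eq_interior_union
    have h' := fun i => K.disjoint_interior_closedInterior_faceOpposite i
    constructor
    · intro hx
      exact ⟨K.interior_subset_closedInterior hx,
        fun ⟨i, hi⟩ => Set.disjoint_left.1 (h' i) hx hi⟩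
    · rintro ⟨hx, hn⟩
      rw [h] at hx
      exact hx.resolve_right fun hx => hn (by simpa [facet] using hx)
  rw [h1, interior_closedInterior, Set.mem_ofPred]
  simp only [mem_facet_iff_bary, mem_closedInterior_iff_bary]
  constructor
  · rintro ⟨h, hn⟩ i
    exact lt_of_le_of_ne (h i) fun h0 => hn ⟨i, h, h0.symm⟩
  · intro h
    exact ⟨fun i => (h i).le, fun ⟨i, _, h0⟩ => (h i).ne' h0⟩

lemma interior_closedInterior_nonempty (K : Cell d) : (interior K.closedInterior).Nonempty := by
  rw [← K.convexHull_eq_closedInterior]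
  exact ⟨_, (vertexBasis K).centroid_mem_interior_convexHull⟩

lemma closure_interior_closedInterior (K : Cell d) :
    closure (interior K.closedInterior) = K.closedInterior := by
  rw [(convex_closedInterior K).closure_interior_eq_closure_of_nonempty_interior
    (interior_closedInterior_nonempty K), K.isClosed_closedInterior.closure_eq]

lemma isClosed_facet [NeZero d] (K : Cell d) (i : Fin (d + 1)) : IsClosed (facet K i) :=
  (K.faceOpposite i).isClosed_closedInterior

lemma isCompact_facet [NeZero d] (K : Cell d) (i : Fin (d + 1)) : IsCompact (facet K i) :=
  (K.faceOpposite i).isCompact_closedInterior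

lemma volume_frontier_closedInterior (K : Cell d) :
    volume (frontier K.closedInterior) = 0 :=
  (convex_closedInterior K).addHaar_frontier volume

/-- Almost every point of a cell lies in its topological interior. -/
lemma ae_mem_interior (K : Cell d) :
    ∀ᵐ x ∂(volume.restrict K.closedInterior), x ∈ interior K.closedInterior := by
  rw [ae_restrict_iff' K.isClosed_closedInterior.measurableSet]
  have h : ∀ᵐ x ∂(volume : Measure (E d)), x ∉ frontier K.closedInterior :=
    measure_eq_zero_iff_ae_notMem.1 (volume_frontier_closedInterior K)
  filter_upwards [h] with x hx hxK
  rw [K.isClosed_closedInterior.frontier_eq] at hx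
  by_contra hn
  exact hx ⟨hxK, hn⟩

lemma norm_normal [NeZero d] (K : Cell d) (i : Fin (d + 1)) : ‖normal K i‖ = 1 := by
  have h := K.height_pos i
  rw [normal, norm_smul, norm_inv, Real.norm_of_nonneg h.le, Affine.Simplex.height, dist_comm,
    dist_eq_norm_vsub (E d)]
  rw [Affine.Simplex.height, dist_comm, dist_eq_norm_vsub (E d)] at h
  exact inv_mul_cancel₀ h.ne'

/-- Barycentric coordinates are affine with gradient `- n_i / (height i)`. -/
lemma inner_normal_sub [NeZero d] (K : Cell d) (i : Fin (d + 1)) (x y : E d) :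
    inner ℝ (normal K i) (x - y) = - K.height i * (bary K i x - bary K i y) := by
  suffices h : ∀ x, inner ℝ (normal K i) (x - K.altitudeFoot i) = - K.height i * bary K i x by
    rw [← sub_sub_sub_cancel_right x y (K.altitudeFoot i), inner_sub_right, h, h]
    ring
  intro x
  have h0 := K.height_pos i
  have hp : ∀ j, inner ℝ (normal K i) (K.points j - K.altitudeFoot i) =
      - K.height i * bary K i (K.points j) := by
    intro j
    rcases eq_or_ne i j with rfl | hij
    · rw [bary_point_self, normal, inner_smul_left, vsub_eq_sub,
        ← neg_sub (K.points i) (K.altitudeFoot i), inner_neg_left, real_inner_self_eq_norm_sq,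
        ← dist_eq_norm, ← Affine.Simplex.height]
      simp only [map_inv₀, conj_trivial]
      field_simp
    · have h := K.inner_vsub_altitudeFoot_vsub_altitudeFoot_eq_zero hij
      rw [bary_point_of_ne K hij, normal, inner_smul_left, vsub_eq_sub,
        ← neg_sub (K.points i) (K.altitudeFoot i), inner_neg_left, real_inner_comm]
      simp only [vsub_eq_sub] at h
      rw [h]
      simp
  conv_lhs => rw [← affineCombination_bary K x]
  rw [Finset.affineCombination_eq_weightedVSubOfPoint_vadd_of_sum_eq_one _ _ _ (sum_bary K x)
    (K.altitudeFoot i), vadd_eq_add, add_sub_cancel_right, Finset.weightedVSubOfPoint_apply,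
    inner_sum]
  simp only [inner_smul_right, vsub_eq_sub, hp]
  rw [Finset.sum_eq_single i]
  · rw [bary_point_self]; ring
  · intro j _ hj
    rw [bary_point_of_ne K hj.symm]; ring
  · simp

end SimplexGeometry

/-! ### Sweeping Lebesgue measure by translates of a hyperplane -/

section Sweep

variable {d : ℕ}

/-- The hyperplane through `p` with normal `n`. -/
def hyperplane (n p : E d) : Set (E d) := {x | inner ℝ n (x - p) = 0}

lemma isClosed_hyperplane (n p : E d) : IsClosed (hyperplane n p) :=
  isClosed_eq (by fun_prop) continuous_const

lemma finrank_orthogonal_unit [NeZero d] {n : E d} (hn : ‖n‖ = 1) :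
    Module.finrank ℝ (ℝ ∙ n)ᗮ = d - 1 := by
  have h0 : n ≠ 0 := by
    rintro rfl
    simp at hn
  have h := (ℝ ∙ n).finrank_add_finrank_orthogonal
  rw [finrank_span_singleton h0, finrank_euclideanSpace_fin] at h
  omega

/-- The surface measure of a hyperplane is the image of the Lebesgue measure of its direction. -/
lemma surf_restrict_hyperplane [NeZero d] {n : E d} (hn : ‖n‖ = 1) (p : E d) :
    (surf d).restrict (hyperplane n p) =
      Measure.map (fun w : (ℝ ∙ n)ᗮ => p + (w : E d)) volume := by
  have hiso : Isometry (fun w : (ℝ ∙ n)ᗮ => p + (w : E d)) :=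
    (IsometryEquiv.addLeft p).isometry.comp isometry_subtype_coe
  have hr : Set.range (fun w : (ℝ ∙ n)ᗮ => p + (w : E d)) = hyperplane n p := by
    ext x
    simp only [Set.mem_range, hyperplane, Set.mem_ofPred]
    constructor
    · rintro ⟨w, rfl⟩
      rw [add_sub_cancel_left]
      exact Submodule.mem_orthogonal_singleton_iff_inner_right.1 w.2
    · intro hx
      exact ⟨⟨x - p, Submodule.mem_orthogonal_singleton_iff_inner_right.2 hx⟩, by simp⟩
  rw [← InnerProductSpace.euclideanHausdorffMeasure_eq_volume, finrank_orthogonal_unit hn,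
    hiso.map_euclideanHausdorffMeasure, hr]

instance sFinite_surf_hyperplane [NeZero d] (n p : E d) [Fact (‖n‖ = 1)] :
    SFinite ((surf d).restrict (hyperplane n p)) := by
  rw [surf_restrict_hyperplane Fact.out]
  infer_instance

/-- Orthogonal coordinates with respect to a unit vector `n` preserve Lebesgue measure. -/
lemma measurePreserving_orthogonal_add_smul {n : E d} (hn : ‖n‖ = 1) :
    MeasurePreserving (fun q : (ℝ ∙ n)ᗮ × ℝ => (q.1 : E d) + q.2 • n) := by
  let f : WithLp 2 ((ℝ ∙ n)ᗮ × ℝ) →ₗ[ℝ] E d :=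
    { toFun := fun q => (q.fst : E d) + q.snd • n
      map_add' := fun x y => by simp [add_smul]; abel
      map_smul' := fun c x => by simp [mul_smul] }
  have hf : ∀ q, ‖f q‖ = ‖q‖ := by
    intro q
    have ho : inner ℝ (q.fst : E d) (q.snd • n) = 0 := by
      rw [inner_smul_right, Submodule.mem_orthogonal_singleton_iff_inner_left.1 q.fst.2, mul_zero]
    have h1 := norm_add_sq_eq_norm_sq_add_norm_sq_of_inner_eq_zero _ _ ho
    have h2 := WithLp.prod_norm_sq_eq_of_L2 q
    have h3 : ‖f q‖ ^ 2 = ‖q‖ ^ 2 := by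
      rw [h2, sq, show f q = (q.fst : E d) + q.snd • n from rfl, h1, norm_smul, hn, mul_one]
      simp [sq]
    exact (sq_eq_sq₀ (norm_nonneg _) (norm_nonneg _)).1 h3
  have hsurj : Function.Surjective f := by
    intro x
    refine ⟨WithLp.toLp 2 (⟨x - inner ℝ n x • n, ?_⟩, inner ℝ n x), ?_⟩
    · rw [Submodule.mem_orthogonal_singleton_iff_inner_right, inner_sub_right, inner_smul_right,
        real_inner_self_eq_norm_sq, hn]
      ring
    · simp [f]
  let g : WithLp 2 ((ℝ ∙ n)ᗮ × ℝ) ≃ₗᵢ[ℝ] E d := LinearIsometryEquiv.ofSurjective ⟨f, hf⟩ hsurj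
  exact g.measurePreserving.comp (WithLp.volume_preserving_toLp _ _)

/-- Cavalieri's principle for oblique directions: translating a hyperplane with unit normal `n`
in the direction `e` sweeps out Lebesgue measure with density `|⟪n, e⟫|`. -/
lemma map_add_smul_surf_hyperplane [NeZero d] (n e p : E d) [hn : Fact (‖n‖ = 1)]
    (he : inner ℝ n e ≠ 0) :
    Measure.map (fun q : E d × ℝ => q.1 + q.2 • e)
      (((surf d).restrict (hyperplane n p)).prod (volume : Measure ℝ)) =
      ENNReal.ofReal |(inner ℝ n e)⁻¹| • volume := by
  set c := inner ℝ n e with hc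
  have hn1 := hn.out
  let e' : (ℝ ∙ n)ᗮ := ⟨e - c • n, by
    rw [Submodule.mem_orthogonal_singleton_iff_inner_right, inner_sub_right, inner_smul_right,
      real_inner_self_eq_norm_sq, hn1, ← hc]
    ring⟩
  have h1 : ((surf d).restrict (hyperplane n p)).prod (volume : Measure ℝ) =
      Measure.map (Prod.map (fun w : (ℝ ∙ n)ᗮ => p + (w : E d)) id) (volume.prod volume) := by
    rw [surf_restrict_hyperplane hn1, ← Measure.map_prod_map _ _ (by fun_prop) measurable_id,
      Measure.map_id]
  -- the shear that straightens the direction `e` into `n`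
  have h2 : MeasurePreserving (fun q : (ℝ ∙ n)ᗮ × ℝ => (q.1 + q.2 • e', q.2)) := by
    have h := MeasurePreserving.skew_product (μa := (volume : Measure ℝ))
      (μb := (volume : Measure ℝ)) (μc := (volume : Measure (ℝ ∙ n)ᗮ))
      (μd := (volume : Measure (ℝ ∙ n)ᗮ)) (f := id) (MeasurePreserving.id _)
      (g := fun t w => w + t • e') (by fun_prop)
      (Filter.Eventually.of_forall fun t => map_add_right_eq_self volume (t • e'))
    exact (Measure.measurePreserving_swap.comp h).comp Measure.measurePreserving_swap
  have h3 : Measure.map (fun q : (ℝ ∙ n)ᗮ × ℝ => (q.1, c * q.2)) volume =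
      ENNReal.ofReal |c⁻¹| • volume := by
    have h := Measure.map_prod_map (volume : Measure (ℝ ∙ n)ᗮ) (volume : Measure ℝ)
      measurable_id (measurable_const_mul c)
    rw [Measure.map_id, Real.map_volume_mul_left he, Measure.prod_smul_right] at h
    exact h.symm
  have h4 : Measure.map (fun x : E d => p + x) volume = volume := map_add_left_eq_self volume p
  have h5 : (fun q : E d × ℝ => q.1 + q.2 • e) ∘
      (Prod.map (fun w : (ℝ ∙ n)ᗮ => p + (w : E d)) id) =
      (fun x : E d => p + x) ∘ (fun q : (ℝ ∙ n)ᗮ × ℝ => (q.1 : E d) + q.2 • n) ∘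
        (fun q : (ℝ ∙ n)ᗮ × ℝ => (q.1, c * q.2)) ∘
        (fun q : (ℝ ∙ n)ᗮ × ℝ => (q.1 + q.2 • e', q.2)) := by
    ext1 q
    simp only [Function.comp, Prod.map, id, e', Submodule.coe_add, Submodule.coe_smul, smul_sub,
      smul_smul, mul_comm c]
    abel
  rw [h1, Measure.map_map (by fun_prop) (by fun_prop), h5,
    ← Measure.map_map (by fun_prop) (by fun_prop), ← Measure.map_map (by fun_prop) (by fun_prop),
    ← Measure.map_map (by fun_prop) (by fun_prop), ← Measure.volume_eq_prod, h2.map_eq, h3,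
    Measure.map_smul, (measurePreserving_orthogonal_add_smul hn1).map_eq, Measure.map_smul, h4]

lemma lintegral_sweep [NeZero d] (n e p : E d) [Fact (‖n‖ = 1)] (he : inner ℝ n e ≠ 0)
    {f : E d → ℝ≥0∞} (hf : Measurable f) :
    ∫⁻ x, f x = ENNReal.ofReal |inner ℝ n e| *
      ∫⁻ y in hyperplane n p, (∫⁻ t : ℝ, f (y + t • e)) ∂(surf d) := by
  have h := map_add_smul_surf_hyperplane n e p he
  have h2 : ∫⁻ q, f (q.1 + q.2 • e) ∂(((surf d).restrict (hyperplane n p)).prod (volume : Measure ℝ)) =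
      ENNReal.ofReal |(inner ℝ n e)⁻¹| * ∫⁻ x, f x := by
    rw [← lintegral_map (f := f) (g := fun q : E d × ℝ => q.1 + q.2 • e) hf (by fun_prop), h,
      lintegral_smul_measure, smul_eq_mul]
  rw [lintegral_prod _ (by fun_prop)] at h2
  rw [h2, ← mul_assoc, ← ENNReal.ofReal_mul (abs_nonneg _), ← abs_mul, mul_inv_cancel₀ he]
  simp

lemma integral_sweep [NeZero d] (n e p : E d) [Fact (‖n‖ = 1)] (he : inner ℝ n e ≠ 0)
    {f : E d → ℝ} (hf : Integrable f) :
    ∫ x, f x = |inner ℝ n e| * ∫ y in hyperplane n p, (∫ t : ℝ, f (y + t • e)) ∂(surf d) := by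
  have h := map_add_smul_surf_hyperplane n e p he
  have hi : Integrable f (Measure.map (fun q : E d × ℝ => q.1 + q.2 • e)
      (((surf d).restrict (hyperplane n p)).prod volume)) := by
    rw [h]
    exact hf.smul_measure ENNReal.ofReal_ne_top
  have h2 : ∫ q, f (q.1 + q.2 • e) ∂(((surf d).restrict (hyperplane n p)).prod (volume : Measure ℝ)) =
      |(inner ℝ n e)⁻¹| * ∫ x, f x := by
    rw [← integral_map (f := f) (φ := fun q : E d × ℝ => q.1 + q.2 • e) (by fun_prop) hi.1, h,
      integral_smul_measure, ENNReal.toReal_ofReal (abs_nonneg _), smul_eq_mul]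
  rw [integral_prod (fun q : E d × ℝ => f (q.1 + q.2 • e)) (hi.comp_measurable (by fun_prop))] at h2
  rw [h2, ← mul_assoc, ← abs_mul, mul_inv_cancel₀ he]
  simp

end Sweep

/-! ### The divergence theorem on a simplex -/

section DivergenceTheorem

variable {d : ℕ}

instance fact_norm_normal [NeZero d] (K : Cell d) (i : Fin (d + 1)) :
    Fact (‖normal K i‖ = 1) := ⟨norm_normal K i⟩

lemma bary_add_smul_edge (K : Cell d) (m i j : Fin (d + 1)) (x : E d) (t : ℝ) :
    bary K m (x + t • (K.points j - K.points i)) =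
      bary K m x + t * (bary K m (K.points j) - bary K m (K.points i)) := by
  have h1 : (bary K m).linear (K.points j - K.points i) =
      bary K m (K.points j) - bary K m (K.points i) :=
    (bary K m).linearMap_vsub _ _
  have h2 := (bary K m).map_vadd x (t • (K.points j - K.points i))
  rw [vadd_eq_add, add_comm] at h2
  rw [h2, map_smul, h1, smul_eq_mul, vadd_eq_add, add_comm]

lemma bary_add_smul_edge_target (K : Cell d) {i j : Fin (d + 1)} (h : i ≠ j) (x : E d) (t : ℝ) :
    bary K j (x + t • (K.points j - K.points i)) = bary K j x + t := by
  rw [bary_add_smul_edge, bary_point_self, bary_point_of_ne K h.symm]; ring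

lemma bary_add_smul_edge_source (K : Cell d) {i j : Fin (d + 1)} (h : i ≠ j) (x : E d) (t : ℝ) :
    bary K i (x + t • (K.points j - K.points i)) = bary K i x - t := by
  rw [bary_add_smul_edge, bary_point_self, bary_point_of_ne K h]; ring

lemma bary_add_smul_edge_of_ne (K : Cell d) {i j m : Fin (d + 1)} (hi : m ≠ i) (hj : m ≠ j)
    (x : E d) (t : ℝ) :
    bary K m (x + t • (K.points j - K.points i)) = bary K m x := by
  rw [bary_add_smul_edge, bary_point_of_ne K hi, bary_point_of_ne K hj]; ring

lemma inner_normal_edge [NeZero d] (K : Cell d) (m i j : Fin (d + 1)) :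
    inner ℝ (normal K m) (K.points j - K.points i) =
      - K.height m * (bary K m (K.points j) - bary K m (K.points i)) :=
  inner_normal_sub K m _ _

lemma mem_hyperplane_normal_iff [NeZero d] (K : Cell d) {i j : Fin (d + 1)} (h : i ≠ j)
    (x : E d) : x ∈ hyperplane (normal K j) (K.points i) ↔ bary K j x = 0 := by
  have hh := K.height_pos j
  rw [hyperplane, Set.mem_ofPred, inner_normal_sub, bary_point_of_ne K h.symm]
  simp [hh.ne']

lemma facet_subset_hyperplane [NeZero d] (K : Cell d) {i j : Fin (d + 1)} (h : i ≠ j) :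
    facet K j ⊆ hyperplane (normal K j) (K.points i) := fun x hx =>
  (mem_hyperplane_normal_iff K h x).2 ((mem_facet_iff_bary K j x).1 hx).2

/-- Sliding along the edge from vertex `i` to vertex `j` maps the facet opposite to `j` onto the
facet opposite to `i`. -/
lemma slide_mem_facet_iff [NeZero d] (K : Cell d) {i j : Fin (d + 1)} (h : i ≠ j) {y : E d}
    (hy : bary K j y = 0) :
    y + bary K i y • (K.points j - K.points i) ∈ facet K i ↔ y ∈ facet K j := by
  rw [mem_facet_iff_bary, mem_facet_iff_bary, mem_closedInterior_iff_bary,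
    mem_closedInterior_iff_bary, bary_add_smul_edge_source K h]
  simp only [sub_self, and_true, hy]
  constructor
  · intro H m
    by_cases hmj : m = j
    · rw [hmj, hy]
    by_cases hmi : m = i
    · have := H j
      rwa [bary_add_smul_edge_target K h, hy, zero_add, ← hmi] at this
    · have := H m
      rwa [bary_add_smul_edge_of_ne K hmi hmj] at this
  · intro H m
    by_cases hmj : m = j
    · rw [hmj, bary_add_smul_edge_target K h, hy, zero_add]
      exact H i
    by_cases hmi : m = i
    · rw [hmi, bary_add_smul_edge_source K h, sub_self]
    · rw [bary_add_smul_edge_of_ne K hmi hmj]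
      exact H m

/-- Sliding along an edge between the two facets it joins transforms the surface measures by the
ratio of the heights of the simplex. -/
lemma lintegral_facet_slide [NeZero d] (K : Cell d) {i j : Fin (d + 1)} (h : i ≠ j)
    {g : E d → ℝ≥0∞} (hg : Measurable g) :
    ENNReal.ofReal (K.height j) * ∫⁻ y in facet K j,
        g (y + bary K i y • (K.points j - K.points i)) ∂(surf d) =
      ENNReal.ofReal (K.height i) * ∫⁻ y in facet K i, g y ∂(surf d) := by
  set e := K.points j - K.points i with he
  have hmi := (continuous_bary K i).measurable
  have hmj := (continuous_bary K j).measurable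
  -- both sides are the integral of `g`, extended constantly along the edge direction, over a slab
  let G : E d → ℝ≥0∞ := fun x =>
    (facet K i).indicator g (x + bary K i x • e) *
      (Set.Icc (0 : ℝ) 1).indicator (fun _ => 1) (bary K j x)
  have hGm : Measurable G :=
    ((hg.indicator (isClosed_facet K i).measurableSet).comp (by fun_prop)).mul
      ((measurable_const.indicator measurableSet_Icc).comp hmj)
  have hej : inner ℝ (normal K j) e = - K.height j := by
    rw [he, inner_normal_edge, bary_point_self, bary_point_of_ne K h.symm]; ring
  have hei : inner ℝ (normal K i) e = K.height i := by
    rw [he, inner_normal_edge, bary_point_self, bary_point_of_ne K h]; ring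
  have hj0 := K.height_pos j
  have hi0 := K.height_pos i
  have h1 := lintegral_sweep (normal K j) e (K.points i) (by rw [hej]; exact neg_ne_zero.2 hj0.ne')
    hGm
  have h2 := lintegral_sweep (normal K i) e (K.points j) (by rw [hei]; exact hi0.ne') hGm
  rw [hej, abs_neg, abs_of_pos hj0] at h1
  rw [hei, abs_of_pos hi0] at h2
  have hπ : ∀ y : E d, ∀ t : ℝ,
      (y + t • e) + bary K i (y + t • e) • e = y + bary K i y • e := by
    intro y t
    rw [he, bary_add_smul_edge_source K h, sub_smul]
    abel
  have hone : ∀ c : ℝ, ∫⁻ t : ℝ, (Set.Icc (0 : ℝ) 1).indicator (fun _ => (1 : ℝ≥0∞)) (c + t) = 1 := by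
    intro c
    rw [lintegral_add_left_eq_self (fun t : ℝ => (Set.Icc (0 : ℝ) 1).indicator
      (fun _ => (1 : ℝ≥0∞)) t) c, lintegral_indicator measurableSet_Icc]
    simp
  have hbj : ∀ y : E d, ∀ t : ℝ, bary K j (y + t • e) = bary K j y + t :=
    fun y t => bary_add_smul_edge_target K h y t
  have hinner : ∀ y : E d, ∫⁻ t : ℝ, G (y + t • e) =
      (facet K i).indicator g (y + bary K i y • e) := by
    intro y
    simp only [G, hπ, hbj]
    refine (lintegral_const_mul _ (f := fun t => (Set.Icc (0 : ℝ) 1).indicator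
      (fun _ => (1 : ℝ≥0∞)) (bary K j y + t))
      ((measurable_const.indicator measurableSet_Icc).comp (measurable_const_add _))).trans ?_
    rw [hone, mul_one]
  simp only [hinner] at h1 h2
  have hset : ∀ (m m' : Fin (d + 1)) (_ : m' ≠ m) (φ : E d → ℝ≥0∞),
      ∫⁻ y in hyperplane (normal K m) (K.points m'), (facet K m).indicator φ y ∂(surf d) =
      ∫⁻ y in facet K m, φ y ∂(surf d) := by
    intro m m' hm φ
    rw [lintegral_indicator (isClosed_facet K m).measurableSet,
      Measure.restrict_restrict (isClosed_facet K m).measurableSet,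
      Set.inter_eq_left.2 (facet_subset_hyperplane K hm)]
  have h3 : ∫⁻ y in hyperplane (normal K j) (K.points i),
      (facet K i).indicator g (y + bary K i y • e) ∂(surf d) =
      ∫⁻ y in facet K j, g (y + bary K i y • e) ∂(surf d) := by
    rw [← hset j i h]
    refine setLIntegral_congr_fun (isClosed_hyperplane _ _).measurableSet fun y hy => ?_
    have := slide_mem_facet_iff K h ((mem_hyperplane_normal_iff K h y).1 hy)
    by_cases hy' : y ∈ facet K j
    · rw [Set.indicator_of_mem hy', Set.indicator_of_mem (this.2 hy')]
    · rw [Set.indicator_of_notMem hy', Set.indicator_of_notMem (mt this.1 hy')]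
  have h4 : ∫⁻ y in hyperplane (normal K i) (K.points j),
      (facet K i).indicator g (y + bary K i y • e) ∂(surf d) =
      ∫⁻ y in facet K i, g y ∂(surf d) := by
    rw [← hset i j h.symm]
    refine setLIntegral_congr_fun (isClosed_hyperplane _ _).measurableSet fun y hy => ?_
    rw [(mem_hyperplane_normal_iff K h.symm y).1 hy, zero_smul, add_zero]
  rw [h3] at h1
  rw [h4] at h2
  rw [← h1, ← h2]

lemma map_slide_surf_facet [NeZero d] (K : Cell d) {i j : Fin (d + 1)} (h : i ≠ j) :
    Measure.map (fun y => y + bary K i y • (K.points j - K.points i))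
      (ENNReal.ofReal (K.height j) • (surf d).restrict (facet K j)) =
      ENNReal.ofReal (K.height i) • (surf d).restrict (facet K i) := by
  have hm : Measurable (fun y => y + bary K i y • (K.points j - K.points i)) := by
    have := (continuous_bary K i).measurable
    fun_prop
  refine Measure.ext_of_lintegral _ fun g hg => ?_
  rw [lintegral_map hg hm, lintegral_smul_measure, lintegral_smul_measure, smul_eq_mul,
    smul_eq_mul]
  exact lintegral_facet_slide K h hg

lemma integral_facet_slide [NeZero d] (K : Cell d) {i j : Fin (d + 1)} (h : i ≠ j)
    {g : E d → ℝ} (hg : Continuous g) :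
    K.height j * ∫ y in facet K j,
        g (y + bary K i y • (K.points j - K.points i)) ∂(surf d) =
      K.height i * ∫ y in facet K i, g y ∂(surf d) := by
  have hm : Measurable (fun y => y + bary K i y • (K.points j - K.points i)) := by
    have := (continuous_bary K i).measurable
    fun_prop
  have h1 := integral_map (μ := ENNReal.ofReal (K.height j) • (surf d).restrict (facet K j))
    hm.aemeasurable (f := g) hg.aestronglyMeasurable
  rw [map_slide_surf_facet K h, integral_smul_measure, integral_smul_measure,
    ENNReal.toReal_ofReal (K.height_pos j).le, ENNReal.toReal_ofReal (K.height_pos i).le] at h1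
  exact h1.symm

/-- The part of a hyperplane in a ball of radius `R` has surface measure at most `C R^(d-1)`:
translating it by `[0, R]` in the normal direction stays in the ball of radius `2 R`. -/
lemma surf_le_of_subset_ball [NeZero d] {n p x₀ : E d} [hn : Fact (‖n‖ = 1)] {R : ℝ}
    {F : Set (E d)} (hF : F ⊆ hyperplane n p) (hFm : MeasurableSet F)
    (hFR : F ⊆ Metric.closedBall x₀ R) :
    ENNReal.ofReal R * surf d F ≤ volume (Metric.closedBall x₀ (2 * R)) := by
  have hnn : inner ℝ n n = (1 : ℝ) := by rw [real_inner_self_eq_norm_sq, hn.out]; norm_num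
  have h := lintegral_sweep n n p (by rw [hnn]; exact one_ne_zero)
    (f := (Metric.closedBall x₀ (2 * R)).indicator 1)
    (measurable_one.indicator Metric.isClosed_closedBall.measurableSet)
  rw [lintegral_indicator_one Metric.isClosed_closedBall.measurableSet, hnn] at h
  rw [h]
  simp only [abs_one, ENNReal.ofReal_one, one_mul]
  have hle : ∀ y, F.indicator (fun _ => ENNReal.ofReal R) y ≤
      ∫⁻ t : ℝ, (Metric.closedBall x₀ (2 * R)).indicator (1 : E d → ℝ≥0∞) (y + t • n) := by
    intro y
    by_cases hy : y ∈ F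
    · rw [Set.indicator_of_mem hy]
      calc ENNReal.ofReal R = ∫⁻ t : ℝ, (Set.Icc 0 R).indicator 1 t := by
            rw [lintegral_indicator_one measurableSet_Icc, Real.volume_Icc, sub_zero]
        _ ≤ _ := by
            refine lintegral_mono fun t => ?_
            by_cases ht : t ∈ Set.Icc 0 R
            · have hmem : y + t • n ∈ Metric.closedBall x₀ (2 * R) := by
                have h1 := Metric.mem_closedBall.1 (hFR hy)
                have h2 : dist (y + t • n) y ≤ R := by
                  rw [dist_eq_norm, add_sub_cancel_left, norm_smul, hn.out, mul_one,
                    Real.norm_of_nonneg ht.1]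
                  exact ht.2
                have := dist_triangle (y + t • n) y x₀
                rw [Metric.mem_closedBall]
                linarith
              rw [Set.indicator_of_mem ht, Set.indicator_of_mem hmem]
              exact le_rfl
            · rw [Set.indicator_of_notMem ht]
              exact zero_le
    · rw [Set.indicator_of_notMem hy]
      exact zero_le
  calc ENNReal.ofReal R * surf d F
      = ∫⁻ y in hyperplane n p, F.indicator (fun _ => ENNReal.ofReal R) y ∂(surf d) := by
        rw [lintegral_indicator_const hFm, Measure.restrict_apply hFm, Set.inter_eq_left.2 hF]
    _ ≤ _ := lintegral_mono hle

lemma surf_facet_lt_top [NeZero d] (K : Cell d) (i : Fin (d + 1)) : surf d (facet K i) < ⊤ := by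
  obtain ⟨R, hR⟩ := (isCompact_facet K i).isBounded.subset_closedBall 0
  obtain ⟨j, hj⟩ := exists_ne i
  have h1 : (0 : ℝ) < max R 1 := lt_max_of_lt_right one_pos
  have h := surf_le_of_subset_ball (x₀ := 0) (R := max R 1) (facet_subset_hyperplane K hj)
    (isClosed_facet K i).measurableSet
    (hR.trans (Metric.closedBall_subset_closedBall (le_max_left _ _)))
  refine ENNReal.lt_top_of_mul_ne_top_right (h.trans_lt ?_).ne ?_
  · exact (isCompact_closedBall _ _).measure_lt_top
  · simp

instance isFiniteMeasure_surf_facet [NeZero d] (K : Cell d) (i : Fin (d + 1)) :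
    IsFiniteMeasure ((surf d).restrict (facet K i)) :=
  isFiniteMeasure_restrict.2 (surf_facet_lt_top K i).ne

/-- The fundamental theorem of calculus along a segment, for a Lipschitz function, which is
absolutely continuous there. -/
lemma integral_lineDeriv_segment {f : E d → ℝ} {C : ℝ≥0} (hf : LipschitzWith C f) (y e : E d)
    (s : ℝ) : ∫ t in (0 : ℝ)..s, lineDeriv ℝ f (y + t • e) e = f (y + s • e) - f y := by
  have hl : LipschitzWith (C * ‖e‖₊) (fun t : ℝ => f (y + t • e)) := by
    refine hf.comp (LipschitzWith.of_dist_le_mul fun t u => ?_)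
    rw [dist_eq_norm, add_sub_add_left_eq_sub, ← sub_smul, norm_smul, mul_comm, dist_eq_norm]
    rfl
  have h := (hl.lipschitzOnWith (s := Set.uIcc 0 s)).absolutelyContinuousOnInterval.integral_deriv_eq_sub
  rw [zero_smul, add_zero] at h
  rw [← h]
  refine intervalIntegral.integral_congr fun t _ => ?_
  simp only [lineDeriv]
  have h2 := deriv_comp_const_add (fun u => f (y + u • e)) t 0
  rw [add_zero] at h2
  rw [← h2]
  simp only [add_smul, add_assoc]

lemma integrableOn_lineDeriv {f : E d → ℝ} {C : ℝ≥0} (hf : LipschitzWith C f) (K : Cell d)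
    (e : E d) : IntegrableOn (fun x => lineDeriv ℝ f x e) K.closedInterior :=
  IntegrableOn.of_bound K.isCompact_closedInterior.measure_lt_top
    (aestronglyMeasurable_lineDeriv hf.continuous _) (C * ‖e‖)
    (Filter.Eventually.of_forall fun _ => norm_lineDeriv_le_of_lipschitz ℝ hf)

lemma add_smul_edge_mem_iff [NeZero d] (K : Cell d) {i j : Fin (d + 1)} (h : i ≠ j) {y : E d}
    (hy : bary K j y = 0) (t : ℝ) :
    y + t • (K.points j - K.points i) ∈ K.closedInterior ↔
      y ∈ facet K j ∧ t ∈ Set.Icc 0 (bary K i y) := by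
  rw [mem_facet_iff_bary, mem_closedInterior_iff_bary, mem_closedInterior_iff_bary, Set.mem_Icc]
  constructor
  · intro H
    have h1 := H i
    have h2 := H j
    rw [bary_add_smul_edge_source K h] at h1
    rw [bary_add_smul_edge_target K h, hy] at h2
    refine ⟨⟨fun m => ?_, hy⟩, by linarith, by linarith⟩
    by_cases hmj : m = j
    · rw [hmj, hy]
    by_cases hmi : m = i
    · rw [hmi]; linarith
    · have := H m
      rwa [bary_add_smul_edge_of_ne K hmi hmj] at this
  · rintro ⟨⟨H, _⟩, h1, h2⟩ m
    by_cases hmj : m = j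
    · rw [hmj, bary_add_smul_edge_target K h, hy]; linarith
    by_cases hmi : m = i
    · rw [hmi, bary_add_smul_edge_source K h]; linarith
    · rw [bary_add_smul_edge_of_ne K hmi hmj]
      exact H m

/-- The divergence theorem on a simplex in the direction of an edge. The lines parallel to the
edge enter the simplex through one facet and leave it through another one; the remaining facets
are parallel to the edge. -/
lemma integral_lineDeriv_edge [NeZero d] (K : Cell d) {i j : Fin (d + 1)} (h : i ≠ j)
    {f : E d → ℝ} {C : ℝ≥0} (hf : LipschitzWith C f) :
    ∫ x in K.closedInterior, lineDeriv ℝ f x (K.points j - K.points i) =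
      K.height i * (∫ y in facet K i, f y ∂(surf d)) -
        K.height j * ∫ y in facet K j, f y ∂(surf d) := by
  have hslide := integral_facet_slide K h hf.continuous
  set e := K.points j - K.points i with he
  have hKm := K.isClosed_closedInterior.measurableSet
  have hFm := (isClosed_facet K j).measurableSet
  have hej : inner ℝ (normal K j) e = - K.height j := by
    rw [he, inner_normal_edge, bary_point_self, bary_point_of_ne K h.symm]; ring
  have hj0 := K.height_pos j
  have h1 := integral_sweep (normal K j) e (K.points i) (by rw [hej]; exact neg_ne_zero.2 hj0.ne')
    ((integrable_indicator_iff hKm).2 (integrableOn_lineDeriv hf K e))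
  rw [hej, abs_neg, abs_of_pos hj0, integral_indicator hKm] at h1
  have h2 : ∫ y in hyperplane (normal K j) (K.points i), (∫ t : ℝ,
      K.closedInterior.indicator (fun x => lineDeriv ℝ f x e) (y + t • e)) ∂(surf d) =
      ∫ y in facet K j, (f (y + bary K i y • e) - f y) ∂(surf d) := by
    rw [← Set.inter_eq_right.2 (facet_subset_hyperplane K h), ← setIntegral_indicator hFm]
    refine setIntegral_congr_fun (isClosed_hyperplane _ _).measurableSet fun y hy => ?_
    have hy0 := (mem_hyperplane_normal_iff K h y).1 hy
    by_cases hyF : y ∈ facet K j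
    · have hb : 0 ≤ bary K i y :=
        (mem_closedInterior_iff_bary K y).1 (facet_subset K j hyF) i
      rw [Set.indicator_of_mem hyF, ← integral_lineDeriv_segment hf,
        intervalIntegral.integral_of_le hb, ← integral_Icc_eq_integral_Ioc,
        ← integral_indicator measurableSet_Icc]
      congr 1
      ext t
      by_cases ht : t ∈ Set.Icc 0 (bary K i y)
      · rw [Set.indicator_of_mem ht,
          Set.indicator_of_mem ((add_smul_edge_mem_iff K h hy0 t).2 ⟨hyF, ht⟩)]
      · rw [Set.indicator_of_notMem ht,
          Set.indicator_of_notMem fun hm => ht ((add_smul_edge_mem_iff K h hy0 t).1 hm).2]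
    · rw [Set.indicator_of_notMem hyF]
      have : ∀ t : ℝ, K.closedInterior.indicator (fun x => lineDeriv ℝ f x e) (y + t • e) = 0 :=
        fun t => Set.indicator_of_notMem
          (fun hm => hyF ((add_smul_edge_mem_iff K h hy0 t).1 hm).1) _
      simp only [this, integral_zero]
  have hbc := continuous_bary K i
  have hint : ∀ g : E d → ℝ, Continuous g → Integrable g ((surf d).restrict (facet K j)) :=
    fun g hg => hg.continuousOn.integrableOn_of_subset_isCompact (isCompact_facet K j) hFm
      Set.Subset.rfl (surf_facet_lt_top K j).ne
  have hfc := hf.continuous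
  rw [h1, h2, integral_sub (hint _ (by fun_prop)) (hint _ (by fun_prop)), mul_sub, hslide]

/-- The divergence theorem on a simplex, for Lipschitz functions. -/
theorem integral_fderiv_cell [NeZero d] (K : Cell d) {f : E d → ℝ} {C : ℝ≥0}
    (hf : LipschitzWith C f) (e : E d) :
    ∫ x in K.closedInterior, fderiv ℝ f x e =
      ∑ i, inner ℝ (normal K i) e * ∫ y in facet K i, f y ∂(surf d) := by
  have hint : IntegrableOn (fderiv ℝ f) K.closedInterior :=
    IntegrableOn.of_bound K.isCompact_closedInterior.measure_lt_top
      (measurable_fderiv ℝ f).aestronglyMeasurable C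
      (Filter.Eventually.of_forall fun _ => norm_fderiv_le_of_lipschitz ℝ hf)
  let L₁ : E d →ₗ[ℝ] ℝ := (∫ x in K.closedInterior, fderiv ℝ f x : E d →L[ℝ] ℝ)
  let L₂ : E d →ₗ[ℝ] ℝ :=
    ∑ i, (∫ y in facet K i, f y ∂(surf d)) • (innerSL ℝ (normal K i) : E d →L[ℝ] ℝ).toLinearMap
  have h₁ : ∀ v, L₁ v = ∫ x in K.closedInterior, fderiv ℝ f x v := fun v =>
    ContinuousLinearMap.integral_apply hint v
  have h₂ : ∀ v, L₂ v = ∑ i, inner ℝ (normal K i) v * ∫ y in facet K i, f y ∂(surf d) := by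
    intro v
    simp [L₂, LinearMap.sum_apply, mul_comm]
  rw [← h₁, ← h₂]
  -- by linearity it suffices to consider the edges emanating from the vertex number `0`
  have hspan : Submodule.span ℝ (Set.range fun j => K.points j -ᵥ K.points 0) = ⊤ := by
    rw [← vectorSpan_range_eq_span_range_vsub_right, ← direction_affineSpan,
      Affine.Simplex.span_eq_top K (by simp), AffineSubspace.direction_top]
  refine congrArg (fun L : E d →ₗ[ℝ] ℝ => L e) (LinearMap.ext_on hspan ?_)
  rintro _ ⟨j, rfl⟩
  rcases eq_or_ne 0 j with rfl | hj
  · simp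
  have hae : ∀ᵐ x ∂(volume.restrict K.closedInterior),
      fderiv ℝ f x (K.points j - K.points 0) = lineDeriv ℝ f x (K.points j - K.points 0) := by
    refine ae_restrict_of_ae ?_
    filter_upwards [hf.ae_differentiableAt] with x hx
    exact hx.lineDeriv_eq_fderiv.symm
  simp only [h₁, h₂, vsub_eq_sub]
  rw [integral_congr_ae hae, integral_lineDeriv_edge K hj hf,
    ← Finset.sum_subset (Finset.subset_univ {0, j}), Finset.sum_pair hj]
  · rw [inner_normal_edge, inner_normal_edge, bary_point_self, bary_point_self,
      bary_point_of_ne K hj, bary_point_of_ne K hj.symm]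
    ring
  · intro m _ hm
    simp only [Finset.mem_insert, Finset.mem_singleton, not_or] at hm
    rw [inner_normal_edge, bary_point_of_ne K hm.1, bary_point_of_ne K hm.2]
    ring

end DivergenceTheorem

/-! ### Polynomials, the inverse inequality and the discrete trace inequality -/

section Polynomials

variable {d : ℕ}

/-- Evaluation of polynomials on `ℝ^d`, as a linear map into functions. -/
noncomputable def polyEval (d : ℕ) : MvPolynomial (Fin d) ℝ →ₗ[ℝ] (E d → ℝ) where
  toFun P x := MvPolynomial.eval (fun j => x j) P
  map_add' P Q := by ext x; simp
  map_smul' c P := by ext x; simp [MvPolynomial.smul_eval]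

/-- The space of polynomial functions of total degree at most `k` on `ℝ^d`. -/
noncomputable def polySpace (d k : ℕ) : Submodule ℝ (E d → ℝ) :=
  (MvPolynomial.restrictTotalDegree (Fin d) ℝ k).map (polyEval d)

lemma mem_polySpace {k : ℕ} {p : E d → ℝ} : p ∈ polySpace d k ↔ IsPoly k p := by
  simp only [polySpace, Submodule.mem_map, MvPolynomial.mem_restrictTotalDegree, IsPoly]
  refine exists_congr fun P => and_congr_right fun _ => ?_
  constructor
  · rintro rfl x
    rfl
  · intro h
    ext x
    exact (h x).symm

instance finiteDimensional_polySpace (d k : ℕ) : FiniteDimensional ℝ (polySpace d k) := by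
  unfold polySpace
  infer_instance

lemma contDiff_polyEval (P : MvPolynomial (Fin d) ℝ) : ContDiff ℝ ⊤ (polyEval d P) := by
  induction P using MvPolynomial.induction_on with
  | C a => simpa [polyEval] using contDiff_const
  | add P Q hP hQ => rw [map_add]; exact hP.add hQ
  | mul_X P j hP =>
    have h : polyEval d (P * MvPolynomial.X j) = fun x => polyEval d P x * x j := by
      ext x; simp [polyEval]
    rw [h]
    fun_prop

lemma IsPoly.contDiff {k : ℕ} {p : E d → ℝ} (hp : IsPoly k p) : ContDiff ℝ ⊤ p := by
  obtain ⟨P, -, hP⟩ := hp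
  have : p = polyEval d P := funext hP
  rw [this]
  exact contDiff_polyEval P

lemma IsPoly.continuous {k : ℕ} {p : E d → ℝ} (hp : IsPoly k p) : Continuous p :=
  hp.contDiff.continuous

lemma IsPoly.differentiable {k : ℕ} {p : E d → ℝ} (hp : IsPoly k p) : Differentiable ℝ p :=
  hp.contDiff.differentiable (by simp)

lemma IsPoly.continuous_fderiv {k : ℕ} {p : E d → ℝ} (hp : IsPoly k p) :
    Continuous (fderiv ℝ p) :=
  hp.contDiff.continuous_fderiv (by simp)

lemma IsPoly.add {k : ℕ} {p q : E d → ℝ} (hp : IsPoly k p) (hq : IsPoly k q) :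
    IsPoly k (fun x => p x + q x) :=
  mem_polySpace.1 ((polySpace d k).add_mem (mem_polySpace.2 hp) (mem_polySpace.2 hq))

lemma IsPoly.const_mul {k : ℕ} {p : E d → ℝ} (c : ℝ) (hp : IsPoly k p) :
    IsPoly k (fun x => c * p x) :=
  mem_polySpace.1 ((polySpace d k).smul_mem c (mem_polySpace.2 hp))

lemma IsPoly.comp_homothety {k : ℕ} {p : E d → ℝ} (hp : IsPoly k p) (x₀ : E d) (r : ℝ) :
    IsPoly k (fun x => p (x₀ + r • x)) := by
  obtain ⟨P, hPk, hP⟩ := hp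
  let g : Fin d → MvPolynomial (Fin d) ℝ := fun j =>
    MvPolynomial.C (x₀ j) + MvPolynomial.C r * MvPolynomial.X j
  have hg : ∀ j, (g j).totalDegree ≤ 1 := by
    intro j
    refine (MvPolynomial.totalDegree_add _ _).trans (max_le (by simp) ?_)
    refine (MvPolynomial.totalDegree_mul _ _).trans ?_
    simp
  refine ⟨MvPolynomial.aeval g P, ?_, fun x => ?_⟩
  · rw [MvPolynomial.aeval_def, MvPolynomial.eval₂_eq']
    refine MvPolynomial.totalDegree_finsetSum_le fun s hs => ?_
    refine (MvPolynomial.totalDegree_mul _ _).trans ?_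
    have h1 : (algebraMap ℝ (MvPolynomial (Fin d) ℝ) (P.coeff s)).totalDegree = 0 :=
      MvPolynomial.totalDegree_C _
    rw [h1, zero_add]
    refine (MvPolynomial.totalDegree_finsetProd _ _).trans ?_
    refine (Finset.sum_le_sum fun j _ => (MvPolynomial.totalDegree_pow (g j) (s j)).trans
      (Nat.mul_le_mul_left _ (hg j))).trans ?_
    simp only [mul_one]
    have h2 := MvPolynomial.le_totalDegree hs
    rw [Finsupp.sum_fintype _ _ (fun _ => rfl)] at h2
    exact h2.trans hPk
  · simp only
    rw [hP, ← MvPolynomial.coe_aeval_eq_eval, RingHom.coe_coe, ← MvPolynomial.coe_aeval_eq_eval,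
      RingHom.coe_coe, MvPolynomial.comp_aeval_apply]
    refine congrArg (fun f : Fin d → ℝ => MvPolynomial.aeval f P) (funext fun j => ?_)
    simp [g]

/-- A directional derivative is the pointwise limit of difference quotients, and the
finite-dimensional space of polynomials of degree at most `k` is closed under pointwise limits. -/
lemma IsPoly.fderiv_apply {k : ℕ} {p : E d → ℝ} (hp : IsPoly k p) (e : E d) :
    IsPoly k (fun x => fderiv ℝ p x e) := by
  have hcl : IsClosed (polySpace d k : Set (E d → ℝ)) :=
    Submodule.closed_of_finiteDimensional _
  refine mem_polySpace.1 (hcl.mem_of_tendsto (b := nhdsWithin (0 : ℝ) (Set.Ioi 0))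
    (f := fun t x => t⁻¹ • (p (x + t • e) - p x)) ?_ (Filter.Eventually.of_forall fun t => ?_))
  · rw [tendsto_pi_nhds]
    intro x
    exact ((hp.differentiable x).hasFDerivAt.hasLineDerivAt e).tendsto_slope_zero_right
  · refine (polySpace d k).smul_mem _ ((polySpace d k).sub_mem ?_ (mem_polySpace.2 hp))
    have := hp.comp_homothety (t • e) 1
    rw [mem_polySpace]
    simpa [add_comm] using this

/-- A polynomial that vanishes on a ball vanishes on a product of infinite sets, hence is zero. -/
lemma IsPoly.eq_zero_of_ball {k : ℕ} {p : E d → ℝ} (hp : IsPoly k p)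
    (h : ∀ x ∈ Metric.ball (0 : E d) 1, p x = 0) : p = 0 := by
  obtain ⟨P, -, hP⟩ := hp
  have hnhds : (WithLp.toLp 2 : (Fin d → ℝ) → E d) ⁻¹' Metric.ball 0 1 ∈ nhds 0 :=
    (PiLp.continuous_toLp 2 _).continuousAt.preimage_mem_nhds
      (Metric.ball_mem_nhds _ one_pos)
  obtain ⟨ε, hε, hsub⟩ := Metric.nhds_basis_closedBall.mem_iff.1 hnhds
  have hP0 : P = 0 := by
    refine MvPolynomial.funext_set (fun _ => Set.Icc (-ε) ε)
      (fun _ => Set.Icc_infinite (by linarith)) fun x hx => ?_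
    have hx' : x ∈ Metric.closedBall (0 : Fin d → ℝ) ε := by
      rw [mem_closedBall_zero_iff, pi_norm_le_iff_of_nonneg hε.le]
      exact fun j => abs_le.2 (hx j trivial)
    have := h _ (hsub hx')
    rw [hP] at this
    simpa using this
  ext x
  rw [hP, hP0]
  simp

/-- All norms on the finite-dimensional space of polynomials are equivalent: the values and the
gradient of a polynomial in a large ball are controlled by its `L²` norm in the unit ball. -/
lemma exists_sq_le_integral_unitBall (d k : ℕ) (R : ℝ) :
    ∃ C : ℝ, 0 < C ∧ ∀ p : E d → ℝ, IsPoly k p → ∀ y ∈ Metric.closedBall (0 : E d) R,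
      p y ^ 2 + ‖fderiv ℝ p y‖ ^ 2 ≤ C * ∫ x in Metric.closedBall (0 : E d) 1, p x ^ 2 := by
  let b := Module.finBasis ℝ (polySpace d k)
  set n := Module.finrank ℝ (polySpace d k)
  have hb : ∀ i, IsPoly k (b i : E d → ℝ) := fun i => mem_polySpace.1 (b i).2
  have hbc : ∀ i, Continuous (b i : E d → ℝ) := fun i => (hb i).continuous
  have hbd : ∀ i, Continuous (fderiv ℝ (b i : E d → ℝ)) := fun i => (hb i).continuous_fderiv
  -- In terms of the coefficients `c` in a basis, the quadratic form `Q c` has a positive minimum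
  -- on the unit sphere, where the left-hand side `G c y` is bounded; both are homogeneous.
  let F : (Fin n → ℝ) → E d → ℝ := fun c y => ∑ i, c i * (b i : E d → ℝ) y
  let Q : (Fin n → ℝ) → ℝ := fun c => ∫ x in Metric.closedBall (0 : E d) 1, F c x ^ 2
  let G : (Fin n → ℝ) → E d → ℝ := fun c y =>
    F c y ^ 2 + ‖∑ i, c i • fderiv ℝ (b i : E d → ℝ) y‖ ^ 2
  have hFsum : ∀ c, F c = ((∑ i, c i • b i : polySpace d k) : E d → ℝ) := by
    intro c
    ext y
    simp [F, Finset.sum_apply]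
  have hF : ∀ c, IsPoly k (F c) := by
    intro c
    rw [← mem_polySpace, hFsum]
    exact Subtype.mem _
  have hFd : ∀ c y, fderiv ℝ (F c) y = ∑ i, c i • fderiv ℝ (b i : E d → ℝ) y := by
    intro c y
    have h : HasFDerivAt (F c) (∑ i, c i • fderiv ℝ (b i : E d → ℝ) y) y :=
      HasFDerivAt.fun_sum fun i _ => ((hb i).differentiable y).hasFDerivAt.const_mul (c i)
    exact h.fderiv
  have hQc : Continuous Q := by
    refine continuous_parametric_integral_of_continuous ?_ (isCompact_closedBall _ _)
    simp only [F, Function.uncurry_def]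
    fun_prop
  have hGc : Continuous (Function.uncurry G) := by
    simp only [G, F, Function.uncurry_def]
    fun_prop
  have hQpos : ∀ c ∈ Metric.sphere (0 : Fin n → ℝ) 1, 0 < Q c := by
    intro c hc
    refine lt_of_le_of_ne (integral_nonneg fun _ => sq_nonneg _) fun h0 => ?_
    have hFc := (hF c).continuous
    have hint : IntegrableOn (fun x => F c x ^ 2) (Metric.closedBall (0 : E d) 1) :=
      (hFc.pow 2).continuousOn.integrableOn_compact (isCompact_closedBall _ _)
    have hae := (setIntegral_eq_zero_iff_of_nonneg_ae
      (Filter.Eventually.of_forall fun _ => sq_nonneg _) hint).1 h0.symm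
    have hae' := ae_restrict_of_ae_restrict_of_subset
      (Metric.ball_subset_closedBall (x := (0 : E d)) (ε := 1)) hae
    have heq := Measure.eqOn_open_of_ae_eq hae' Metric.isOpen_ball
      (hFc.pow 2).continuousOn continuousOn_const
    have hz := (hF c).eq_zero_of_ball fun x hx => pow_eq_zero_iff two_ne_zero |>.1 (heq hx)
    have hz' : ∑ i, c i • b i = 0 := by
      apply Subtype.ext
      rw [← hFsum, hz]
      rfl
    have hc0 : c = 0 := funext fun i =>
      linearIndependent_iff'.1 b.linearIndependent Finset.univ c hz' i (Finset.mem_univ i)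
    rw [hc0] at hc
    simp at hc
  obtain ⟨m, hm, hmQ⟩ := (isCompact_sphere (0 : Fin n → ℝ) 1).exists_forall_le' hQc.continuousOn
    hQpos
  obtain ⟨D, hD⟩ := ((isCompact_sphere (0 : Fin n → ℝ) 1).prod
    (isCompact_closedBall (0 : E d) R)).bddAbove_image hGc.continuousOn
  have hFs : ∀ (t : ℝ) c y, F (t • c) y = t * F c y := by
    intro t c y
    simp [F, Finset.mul_sum, mul_assoc]
  have hQs : ∀ (t : ℝ) c, Q (t • c) = t ^ 2 * Q c := by
    intro t c
    simp only [Q, hFs, mul_pow, integral_const_mul]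
  have hGs : ∀ (t : ℝ) c y, G (t • c) y = t ^ 2 * G c y := by
    intro t c y
    have : ∑ i, (t • c) i • fderiv ℝ (b i : E d → ℝ) y =
        t • ∑ i, c i • fderiv ℝ (b i : E d → ℝ) y := by
      simp [Finset.smul_sum, mul_smul]
    simp only [G, hFs, this, norm_smul, mul_pow, Real.norm_eq_abs, sq_abs]
    ring
  refine ⟨max D 1 / m, div_pos (lt_max_of_lt_right one_pos) hm, fun p hp y hy => ?_⟩
  have hpF : p = F (b.repr ⟨p, mem_polySpace.2 hp⟩) := by
    rw [hFsum, b.sum_repr]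
  set c : Fin n → ℝ := ⇑(b.repr ⟨p, mem_polySpace.2 hp⟩)
  rw [hpF, hFd]
  change G c y ≤ max D 1 / m * Q c
  rcases eq_or_ne c 0 with h0 | h0
  · have h1 : c = (0 : ℝ) • c := by rw [h0, smul_zero]
    rw [h1, hGs, hQs]
    simp
  have hnc := norm_pos_iff.2 h0
  have hu : ‖c‖⁻¹ • c ∈ Metric.sphere (0 : Fin n → ℝ) 1 := by
    rw [mem_sphere_zero_iff_norm, norm_smul, norm_inv, norm_norm, inv_mul_cancel₀ hnc.ne']
  have hcu : c = ‖c‖ • (‖c‖⁻¹ • c) := by rw [smul_smul, mul_inv_cancel₀ hnc.ne', one_smul]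
  rw [hcu, hGs, hQs]
  have h1 : G (‖c‖⁻¹ • c) y ≤ max D 1 :=
    (hD ⟨(‖c‖⁻¹ • c, y), ⟨hu, hy⟩, rfl⟩).trans (le_max_left _ _)
  have h2 := hmQ _ hu
  have h3 : max D 1 ≤ max D 1 / m * Q (‖c‖⁻¹ • c) := by
    rw [div_mul_eq_mul_div, le_div_iff₀ hm]
    exact mul_le_mul_of_nonneg_left h2 (zero_le_one.trans (le_max_right _ _))
  calc ‖c‖ ^ 2 * G (‖c‖⁻¹ • c) y ≤ ‖c‖ ^ 2 * (max D 1 / m * Q (‖c‖⁻¹ • c)) :=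
        mul_le_mul_of_nonneg_left (h1.trans h3) (sq_nonneg _)
    _ = _ := by ring

lemma setIntegral_closedBall_comp_homothety (g : E d → ℝ) (x₀ : E d) {r : ℝ} (hr : 0 < r) :
    r ^ d * ∫ x in Metric.closedBall (0 : E d) 1, g (x₀ + r • x) =
      ∫ x in Metric.closedBall x₀ r, g x := by
  have h1 := Measure.setIntegral_comp_smul_of_pos (volume : Measure (E d))
    (fun x => g (x₀ + x)) (Metric.closedBall (0 : E d) 1) hr
  rw [smul_closedBall _ _ zero_le_one, smul_zero, Real.norm_of_nonneg hr.le, mul_one,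
    finrank_euclideanSpace_fin, smul_eq_mul] at h1
  have h2 : ∫ x in Metric.closedBall (0 : E d) r, g (x₀ + x) =
      ∫ x in Metric.closedBall x₀ r, g x := by
    have := (measurePreserving_add_left (volume : Measure (E d)) x₀).setIntegral_preimage_emb
      (MeasurableEquiv.addLeft x₀).measurableEmbedding g (Metric.closedBall x₀ r)
    rw [← this]
    simp
  rw [h1, h2, ← mul_assoc, mul_inv_cancel₀ (pow_pos hr d).ne', one_mul]

/-- Pointwise inverse estimate on a set between two concentric balls of comparable radii. -/
lemma exists_sq_le_integral_ball (d k : ℕ) (R : ℝ) :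
    ∃ C : ℝ, 0 < C ∧ ∀ (p : E d → ℝ) (x₀ : E d) (r : ℝ), IsPoly k p → 0 < r →
      ∀ y ∈ Metric.closedBall x₀ (R * r),
        r ^ d * (p y ^ 2 + r ^ 2 * ‖fderiv ℝ p y‖ ^ 2) ≤
          C * ∫ x in Metric.closedBall x₀ r, p x ^ 2 := by
  obtain ⟨C, hC, h⟩ := exists_sq_le_integral_unitBall d k R
  refine ⟨C, hC, fun p x₀ r hp hr y hy => ?_⟩
  have hz : r⁻¹ • (y - x₀) ∈ Metric.closedBall (0 : E d) R := by
    rw [Metric.mem_closedBall, dist_eq_norm] at hy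
    rw [mem_closedBall_zero_iff, norm_smul, norm_inv, Real.norm_of_nonneg hr.le,
      inv_mul_le_iff₀ hr, mul_comm]
    exact hy
  have hback : x₀ + r • r⁻¹ • (y - x₀) = y := by
    rw [smul_smul, mul_inv_cancel₀ hr.ne', one_smul, add_sub_cancel]
  have h1 := h _ (hp.comp_homothety x₀ r) _ hz
  have hd : fderiv ℝ (fun x => p (x₀ + r • x)) (r⁻¹ • (y - x₀)) = r • fderiv ℝ p y := by
    have hf : HasFDerivAt (fun x : E d => x₀ + r • x) (r • ContinuousLinearMap.id ℝ (E d))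
        (r⁻¹ • (y - x₀)) := ((hasFDerivAt_id _).const_smul r).const_add x₀
    have hg := (hp.differentiable (x₀ + r • r⁻¹ • (y - x₀))).hasFDerivAt.comp (g := p)
      (f := fun x : E d => x₀ + r • x) (r⁻¹ • (y - x₀)) hf
    rw [hback] at hg
    refine hg.fderiv.trans ?_
    ext v
    simp
  simp only [hback, hd, norm_smul, mul_pow, Real.norm_eq_abs, sq_abs] at h1
  rw [← setIntegral_closedBall_comp_homothety (fun x => p x ^ 2) x₀ hr]
  calc r ^ d * (p y ^ 2 + r ^ 2 * ‖fderiv ℝ p y‖ ^ 2) ≤ r ^ d * _ :=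
        mul_le_mul_of_nonneg_left h1 (pow_pos hr d).le
    _ = _ := by ring

lemma cellSize_pos [NeZero d] (K : Cell d) : 0 < cellSize K := by
  have h01 : K.points 0 ≠ K.points 1 := K.independent.injective.ne (by simp)
  refine (dist_pos.2 h01).trans_le ?_
  exact Metric.dist_le_diam_of_mem K.isCompact_closedInterior.isBounded
    (K.point_mem_closedInterior 0) (K.point_mem_closedInterior 1)

lemma dist_le_cellSize (K : Cell d) {x y : E d} (hx : x ∈ K.closedInterior)
    (hy : y ∈ K.closedInterior) : dist x y ≤ cellSize K :=
  Metric.dist_le_diam_of_mem K.isCompact_closedInterior.isBounded hx hy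

/-- The inverse inequality and the discrete trace inequality on shape-regular simplices. Both
compare the simplex with its inscribed ball: polynomials are bounded pointwise on the simplex by
their `L²` norm on that ball, and the volume of the simplex and `h_K` times the area of its facets
are at most a multiple of `h_K ^ d`. -/
lemma exists_inverse_trace_const (d k : ℕ) [NeZero d] (σ : ℝ) :
    ∃ C : ℝ, 0 < C ∧ ∀ K : Cell d, IsShapeRegular σ K → ∀ p : E d → ℝ, IsPoly k p →
      cellSize K ^ 2 * (∫ x in K.closedInterior, ‖fderiv ℝ p x‖ ^ 2) ≤
        C * (∫ x in K.closedInterior, p x ^ 2) ∧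
      ∀ i, cellSize K * (∫ x in facet K i, p x ^ 2 ∂(surf d)) ≤
        C * ∫ x in K.closedInterior, p x ^ 2 := by
  obtain ⟨C, hC, hCp⟩ := exists_sq_le_integral_ball d k (2 * |σ|)
  -- The volume of the unit ball gives, by scaling, those of the balls containing the simplex or a
  -- sweep of its facet.
  set ω := volume.real (Metric.closedBall (0 : E d) 1)
  have hω0 : 0 ≤ ω := measureReal_nonneg
  set s := 2 * |σ| with hs
  have hs0 : 0 ≤ s := by positivity
  refine ⟨C * ω * s ^ (d + 2) + C * ω * (2 * s) ^ d + 1, by positivity, ?_⟩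
  rintro K ⟨x₀, r, hr, hball, hle⟩ p hp
  have hh := cellSize_pos K
  set h := cellSize K
  set I := ∫ x in K.closedInterior, p x ^ 2
  have hI0 : 0 ≤ I := integral_nonneg fun _ => sq_nonneg _
  have hhr : h ≤ s * r := by
    rw [hs]
    nlinarith [le_abs_self σ]
  have hx₀ : x₀ ∈ K.closedInterior := hball (Metric.mem_closedBall_self hr.le)
  have hKh : K.closedInterior ⊆ Metric.closedBall x₀ h := fun x hx => dist_le_cellSize K hx hx₀
  have hpc := hp.continuous
  have hpd := hp.continuous_fderiv
  have hint : IntegrableOn (fun x => p x ^ 2) K.closedInterior :=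
    (hpc.pow 2).continuousOn.integrableOn_compact K.isCompact_closedInterior
  have hpt : ∀ x ∈ K.closedInterior,
      r ^ d * (p x ^ 2 + r ^ 2 * ‖fderiv ℝ p x‖ ^ 2) ≤ C * I := by
    intro x hx
    refine (hCp p x₀ r hp hr x (Metric.closedBall_subset_closedBall hhr (hKh hx))).trans ?_
    exact mul_le_mul_of_nonneg_left (setIntegral_mono_set hint
      (Filter.Eventually.of_forall fun _ => sq_nonneg _) hball.eventuallyLE) hC.le
  have hrd := pow_pos hr d
  have hvolball : ∀ ρ, 0 ≤ ρ → volume.real (Metric.closedBall x₀ ρ) = ρ ^ d * ω := by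
    intro ρ hρ
    rw [measureReal_def, Measure.addHaar_closedBall' _ _ hρ, ENNReal.toReal_mul,
      ENNReal.toReal_ofReal (by positivity), finrank_euclideanSpace_fin]
    rfl
  refine ⟨?_, fun i => ?_⟩
  · have h1 : ∀ x ∈ K.closedInterior, ‖fderiv ℝ p x‖ ^ 2 ≤ C * I / (r ^ d * r ^ 2) := by
      intro x hx
      rw [le_div_iff₀ (by positivity)]
      nlinarith [hpt x hx, mul_nonneg hrd.le (sq_nonneg (p x))]
    have hvol : volume.real K.closedInterior ≤ h ^ d * ω := by
      rw [← hvolball h hh.le]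
      exact measureReal_mono hKh (isCompact_closedBall _ _).measure_lt_top.ne
    have h2 : ∫ x in K.closedInterior, ‖fderiv ℝ p x‖ ^ 2 ≤
        C * I / (r ^ d * r ^ 2) * (h ^ d * ω) := by
      refine (setIntegral_mono_on ?_ (integrableOn_const (C := C * I / (r ^ d * r ^ 2))
        K.isCompact_closedInterior.measure_lt_top.ne)
        K.isClosed_closedInterior.measurableSet h1).trans ?_
      · exact (hpd.norm.pow 2).continuousOn.integrableOn_compact K.isCompact_closedInterior
      · rw [setIntegral_const, smul_eq_mul, mul_comm]
        gcongr
    have h3 : h ^ (d + 2) ≤ (s * r) ^ (d + 2) := pow_le_pow_left₀ hh.le hhr _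
    calc h ^ 2 * (∫ x in K.closedInterior, ‖fderiv ℝ p x‖ ^ 2)
        ≤ h ^ 2 * (C * I / (r ^ d * r ^ 2) * (h ^ d * ω)) := by gcongr
      _ = C * ω * I / (r ^ d * r ^ 2) * h ^ (d + 2) := by ring
      _ ≤ C * ω * I / (r ^ d * r ^ 2) * (s * r) ^ (d + 2) := by gcongr
      _ = C * ω * s ^ (d + 2) * I := by
          field_simp
          ring
      _ ≤ _ := by
          have : 0 ≤ C * ω * (2 * s) ^ d := by positivity
          nlinarith
  · have h1 : ∀ x ∈ facet K i, p x ^ 2 ≤ C * I / r ^ d := by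
      intro x hx
      rw [le_div_iff₀ hrd]
      nlinarith [hpt x (facet_subset K i hx),
        mul_nonneg hrd.le (mul_nonneg (sq_nonneg r) (sq_nonneg ‖fderiv ℝ p x‖))]
    obtain ⟨j, hj⟩ := exists_ne i
    have hsurf : h * (surf d).real (facet K i) ≤ (2 * h) ^ d * ω := by
      have := surf_le_of_subset_ball (x₀ := x₀) (R := h) (facet_subset_hyperplane K hj)
        (isClosed_facet K i).measurableSet ((facet_subset K i).trans hKh)
      have h' := ENNReal.toReal_mono (isCompact_closedBall _ _).measure_lt_top.ne this
      rw [ENNReal.toReal_mul, ENNReal.toReal_ofReal hh.le] at h'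
      rw [← hvolball (2 * h) (by positivity)]
      exact h'
    have h2 : ∫ x in facet K i, p x ^ 2 ∂(surf d) ≤ C * I / r ^ d * (surf d).real (facet K i) := by
      refine (setIntegral_mono_on ?_ (integrableOn_const (C := C * I / r ^ d)
        (surf_facet_lt_top K i).ne) (isClosed_facet K i).measurableSet h1).trans ?_
      · exact (hpc.pow 2).continuousOn.integrableOn_of_subset_isCompact (isCompact_facet K i)
          (isClosed_facet K i).measurableSet Set.Subset.rfl (surf_facet_lt_top K i).ne
      · rw [setIntegral_const, smul_eq_mul, mul_comm]
    calc h * (∫ x in facet K i, p x ^ 2 ∂(surf d))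
        ≤ h * (C * I / r ^ d * (surf d).real (facet K i)) := by gcongr
      _ = C * I / r ^ d * (h * (surf d).real (facet K i)) := by ring
      _ ≤ C * I / r ^ d * ((2 * h) ^ d * ω) := by gcongr
      _ ≤ C * I / r ^ d * ((2 * (s * r)) ^ d * ω) := by gcongr
      _ = C * ω * (2 * s) ^ d * I := by
          field_simp
          ring
      _ ≤ _ := by
          have : 0 ≤ C * ω * s ^ (d + 2) := by positivity
          nlinarith

end Polynomials

/-! ### Triangulations and the cancellation of fluxes through interior facets -/

section Mesh

variable {d : ℕ} {Ω : Set (E d)} {T : Finset (Cell d)}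

lemma IsTriangulation.isOpen (hT : IsTriangulation Ω T) : IsOpen Ω := by
  rw [hT.interior_eq]
  exact isOpen_interior

lemma IsTriangulation.interior_subset (hT : IsTriangulation Ω T) {K : Cell d} (hK : K ∈ T) :
    interior K.closedInterior ⊆ Ω := by
  rw [hT.interior_eq]
  exact interior_mono (Set.subset_biUnion_of_mem (u := fun K : Cell d => K.closedInterior) hK)

lemma IsTriangulation.closedInterior_subset (hT : IsTriangulation Ω T) {K : Cell d}
    (hK : K ∈ T) : K.closedInterior ⊆ closure Ω := by
  rw [← closure_interior_closedInterior K]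
  exact closure_mono (hT.interior_subset hK)

lemma IsTriangulation.subset_iUnion (hT : IsTriangulation Ω T) :
    Ω ⊆ ⋃ K ∈ T, K.closedInterior := by
  rw [hT.interior_eq]
  exact _root_.interior_subset

lemma IsTriangulation.ae_mem_of_mem_cell (hT : IsTriangulation Ω T) {K : Cell d} (hK : K ∈ T)
    {p : E d → Prop} (h : ∀ᵐ x ∂(volume.restrict Ω), p x) :
    ∀ᵐ x ∂(volume.restrict K.closedInterior), p x := by
  have h1 := ae_restrict_of_ae_restrict_of_subset (hT.interior_subset hK) h
  rw [ae_restrict_iff' isOpen_interior.measurableSet] at h1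
  filter_upwards [ae_restrict_of_ae h1, ae_mem_interior K] with x hx hx'
  exact hx hx'

/-- A function vanishing outside `Ω` is integrated cell by cell. -/
lemma IsTriangulation.sum_integral_cell [NeZero d] (hT : IsTriangulation Ω T) {g : E d → ℝ}
    (hg : Integrable g) (h0 : ∀ x, x ∉ Ω → g x = 0) :
    ∑ K ∈ T, ∫ x in K.closedInterior, g x = ∫ x, g x := by
  have h1 : ∀ K ∈ T, ∫ x in K.closedInterior, g x = ∫ x in interior K.closedInterior, g x := by
    intro K _
    have : (interior K.closedInterior : Set (E d)) =ᵐ[volume] K.closedInterior :=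
      interior_ae_eq_of_null_frontier (volume_frontier_closedInterior K)
    exact (setIntegral_congr_set this).symm
  rw [Finset.sum_congr rfl h1, ← integral_biUnion_finset T
    (fun K _ => isOpen_interior.measurableSet) _ (fun K _ => hg.integrableOn)]
  · refine setIntegral_eq_integral_of_ae_compl_eq_zero ?_
    have hfr : ∀ᵐ x ∂(volume : Measure (E d)), ∀ K ∈ T, x ∉ frontier K.closedInterior := by
      rw [Filter.eventually_all_finset]
      exact fun K _ => measure_eq_zero_iff_ae_notMem.1 (volume_frontier_closedInterior K)
    filter_upwards [hfr] with x hx hxn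
    refine h0 x fun hxΩ => hxn ?_
    obtain ⟨K, hK, hxK⟩ := Set.mem_iUnion₂.1 (hT.subset_iUnion hxΩ)
    refine Set.mem_iUnion₂.2 ⟨K, hK, ?_⟩
    have h2 := hx K hK
    rw [K.isClosed_closedInterior.frontier_eq] at h2
    by_contra hn
    exact h2 ⟨hxK, hn⟩
  · intro K hK K' hK' hne
    have := hT.disjoint K hK K' hK' hne
    rwa [interior_eq_interior_closedInterior, interior_eq_interior_closedInterior] at this

lemma facet_subset_skeleton [NeZero d] {K : Cell d} (hK : K ∈ T) (i : Fin (d + 1)) :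
    facet K i ⊆ skeleton T := fun _ hx =>
  Set.mem_iUnion₂.2 ⟨K, hK, Set.mem_iUnion.2 ⟨i, hx⟩⟩

lemma surf_skeleton_lt_top [NeZero d] (T : Finset (Cell d)) : surf d (skeleton T) < ⊤ := by
  refine (measure_biUnion_finset_le T _).trans_lt (ENNReal.sum_lt_top.2 fun K _ => ?_)
  exact (measure_iUnion_fintype_le _ _).trans_lt
    (ENNReal.sum_lt_top.2 fun i _ => surf_facet_lt_top K i)

instance isFiniteMeasure_surf_skeleton [NeZero d] (T : Finset (Cell d)) :
    IsFiniteMeasure ((surf d).restrict (skeleton T)) :=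
  isFiniteMeasure_restrict.2 (surf_skeleton_lt_top T).ne

/-- The sum of the outward unit normals at `x` over all facets of the mesh that contain `x`. -/
noncomputable def normalSum [NeZero d] (T : Finset (Cell d)) (x : E d) : E d :=
  ∑ K ∈ T, ∑ i : Fin (d + 1), (facet K i).indicator (fun _ => normal K i) x

lemma integral_lineDeriv_eq_zero {g : E d → ℝ} {C : ℝ≥0} (hg : LipschitzWith C g)
    (hs : HasCompactSupport g) (e : E d) : ∫ x, lineDeriv ℝ g x e = 0 := by
  have h := (LipschitzWith.const' (1 : ℝ) (α := E d) (K := 0)).integral_lineDeriv_mul_eq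
    (μ := volume) hg hs (-e)
  simpa [lineDeriv] using h.symm

lemma integral_facet_indicator [NeZero d] {F : Type*} [NormedAddCommGroup F] [NormedSpace ℝ F]
    {K : Cell d} (hK : K ∈ T) (i : Fin (d + 1)) (φ : E d → F) :
    ∫ x in skeleton T, (facet K i).indicator φ x ∂(surf d) = ∫ x in facet K i, φ x ∂(surf d) := by
  rw [integral_indicator (isClosed_facet K i).measurableSet,
    Measure.restrict_restrict (isClosed_facet K i).measurableSet,
    Set.inter_eq_left.2 (facet_subset_skeleton hK i)]

/-- The outward normals of the cells cancel almost everywhere on the part of the skeleton inside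
`Ω`. Indeed, for a test function with support in `Ω` the divergence theorems on the cells add up
to the integral over `Ω` of a derivative, which is zero. -/
theorem IsTriangulation.ae_normalSum_eq_zero [NeZero d] (hT : IsTriangulation Ω T) :
    ∀ᵐ x ∂((surf d).restrict (skeleton T)), x ∈ Ω → normalSum T x = 0 := by
  have hind : ∀ (K : Cell d) (i : Fin (d + 1)),
      Integrable ((facet K i).indicator (fun _ => normal K i))
        ((surf d).restrict (skeleton T)) := fun K i =>
    (integrable_const (normal K i)).indicator (isClosed_facet K i).measurableSet
  refine hT.isOpen.ae_eq_zero_of_integral_contDiff_smul_eq_zero ?_ fun g hg hgs hgΩ => ?_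
  · refine Integrable.locallyIntegrable ?_ |>.locallyIntegrableOn _
    exact integrable_finsetSum _ fun K _ => integrable_finsetSum _ fun i _ => hind K i
  · obtain ⟨C, hC⟩ := ContDiff.lipschitzWith_of_hasCompactSupport hgs hg (by simp)
    have hgc := hg.continuous
    have hgint : ∀ (K : Cell d) (i : Fin (d + 1)),
        Integrable (fun x => (facet K i).indicator (fun x => g x • normal K i) x)
          ((surf d).restrict (skeleton T)) := by
      intro K i
      rw [integrable_indicator_iff (isClosed_facet K i).measurableSet]
      obtain ⟨B, hB⟩ := hgs.exists_bound_of_continuous hgc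
      refine Integrable.integrableOn (Integrable.of_bound
        (hgc.smul continuous_const).aestronglyMeasurable B (Filter.Eventually.of_forall fun x => ?_))
      rw [norm_smul, norm_normal, mul_one]
      exact hB x
    have h1 : ∀ x, g x • normalSum T x =
        ∑ K ∈ T, ∑ i, (facet K i).indicator (fun x => g x • normal K i) x := by
      intro x
      rw [normalSum, Finset.smul_sum]
      refine Finset.sum_congr rfl fun K _ => ?_
      rw [Finset.smul_sum]
      refine Finset.sum_congr rfl fun i _ => ?_
      by_cases hx : x ∈ facet K i
      · simp only [Set.indicator_of_mem hx]
      · simp only [Set.indicator_of_notMem hx, smul_zero]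
    simp only [h1]
    rw [integral_finsetSum _ fun K _ => integrable_finsetSum _ fun i _ => hgint K i]
    have h2 : ∀ K ∈ T, ∫ x in skeleton T,
        ∑ i, (facet K i).indicator (fun x => g x • normal K i) x ∂(surf d) =
        ∑ i, (∫ x in facet K i, g x ∂(surf d)) • normal K i := by
      intro K hK
      rw [integral_finsetSum _ fun i _ => hgint K i]
      refine Finset.sum_congr rfl fun i _ => ?_
      rw [integral_facet_indicator hK, integral_smul_const]
    rw [Finset.sum_congr rfl h2]
    refine ext_inner_right ℝ fun e => ?_
    rw [inner_zero_left, sum_inner]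
    have hfd : ∀ x, fderiv ℝ g x e = lineDeriv ℝ g x e := fun x =>
      ((hg.differentiable (by simp)) x).lineDeriv_eq_fderiv.symm
    have h3 : ∀ K ∈ T, inner ℝ (∑ i, (∫ x in facet K i, g x ∂(surf d)) • normal K i) e =
        ∫ x in K.closedInterior, fderiv ℝ g x e := by
      intro K _
      rw [integral_fderiv_cell K hC, sum_inner]
      refine Finset.sum_congr rfl fun i _ => ?_
      rw [inner_smul_left, conj_trivial, mul_comm]
    rw [Finset.sum_congr rfl h3, hT.sum_integral_cell]
    · simp only [hfd]
      exact integral_lineDeriv_eq_zero hC hgs e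
    · have hfc : HasCompactSupport (fun x => fderiv ℝ g x e) := hgs.fderiv_apply ℝ e
      exact ((hg.continuous_fderiv (by simp)).clm_apply
        continuous_const).integrable_of_hasCompactSupport hfc
    · intro x hx
      have : x ∉ tsupport (fderiv ℝ g) := fun h => hx (hgΩ (tsupport_fderiv_subset ℝ h))
      rw [image_eq_zero_of_notMem_tsupport this]
      rfl

/-- Fluxes through interior facets cancel: only the parts of the facets on the boundary of `Ω`
contribute to the sum over all cells. -/
theorem IsTriangulation.sum_flux_eq [NeZero d] (hT : IsTriangulation Ω T) (φ : E d → E d)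
    (hφ : ∀ K ∈ T, ∀ i, IntegrableOn (fun x => inner ℝ (φ x) (normal K i)) (facet K i) (surf d)) :
    ∑ K ∈ T, ∑ i, ∫ x in facet K i, inner ℝ (φ x) (normal K i) ∂(surf d) =
      ∑ K ∈ T, ∑ i, ∫ x in facet K i ∩ frontier Ω, inner ℝ (φ x) (normal K i) ∂(surf d) := by
  have hfm : MeasurableSet (frontier Ω) := isClosed_frontier.measurableSet
  suffices h : ∑ K ∈ T, ∑ i, ∫ x in facet K i \ frontier Ω,
      inner ℝ (φ x) (normal K i) ∂(surf d) = 0 by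
    rw [← sub_eq_zero, ← Finset.sum_sub_distrib, ← h]
    refine Finset.sum_congr rfl fun K hK => ?_
    rw [← Finset.sum_sub_distrib]
    refine Finset.sum_congr rfl fun i _ => ?_
    rw [← integral_inter_add_sdiff hfm (hφ K hK i)]
    ring
  have hm : ∀ K : Cell d, ∀ i, MeasurableSet (facet K i \ frontier Ω) := fun K i =>
    (isClosed_facet K i).measurableSet.diff hfm
  have h1 : ∀ K ∈ T, ∀ i, ∫ x in facet K i \ frontier Ω, inner ℝ (φ x) (normal K i) ∂(surf d) =
      ∫ x in skeleton T, (facet K i \ frontier Ω).indicator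
        (fun x => inner ℝ (φ x) (normal K i)) x ∂(surf d) := by
    intro K hK i
    rw [integral_indicator (hm K i), Measure.restrict_restrict (hm K i),
      Set.inter_eq_left.2 (Set.sdiff_subset.trans (facet_subset_skeleton hK i))]
  have hint : ∀ K ∈ T, ∀ i, Integrable ((facet K i \ frontier Ω).indicator
        (fun x => inner ℝ (φ x) (normal K i))) ((surf d).restrict (skeleton T)) := by
    intro K hK i
    rw [integrable_indicator_iff (hm K i), IntegrableOn, Measure.restrict_restrict (hm K i),
      Set.inter_eq_left.2 (Set.sdiff_subset.trans (facet_subset_skeleton hK i))]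
    exact (hφ K hK i).mono_set Set.sdiff_subset
  rw [Finset.sum_congr rfl fun K hK => Finset.sum_congr rfl fun i _ => h1 K hK i]
  rw [Finset.sum_congr rfl fun K hK => (integral_finsetSum _ fun i _ => hint K hK i).symm,
    ← integral_finsetSum _ fun K hK => integrable_finsetSum _ fun i _ => hint K hK i]
  refine integral_eq_zero_of_ae ?_
  filter_upwards [hT.ae_normalSum_eq_zero] with x hx
  by_cases hxf : x ∈ frontier Ω
  · refine Finset.sum_eq_zero fun K _ => Finset.sum_eq_zero fun i _ => ?_
    exact Set.indicator_of_notMem (fun h => h.2 hxf) _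
  have h2 : ∑ K ∈ T, ∑ i, (facet K i \ frontier Ω).indicator
      (fun x => inner ℝ (φ x) (normal K i)) x = inner ℝ (φ x) (normalSum T x) := by
    rw [normalSum, inner_sum]
    refine Finset.sum_congr rfl fun K _ => ?_
    rw [inner_sum]
    refine Finset.sum_congr rfl fun i _ => ?_
    by_cases hxF : x ∈ facet K i
    · rw [Set.indicator_of_mem hxF, Set.indicator_of_mem (show x ∈ facet K i \ frontier Ω from ⟨hxF, hxf⟩)]
    · rw [Set.indicator_of_notMem hxF, Set.indicator_of_notMem (fun h => hxF h.1), inner_zero_right]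
  change ∑ K ∈ T, ∑ i, _ = (0 : ℝ)
  rw [h2]
  by_cases hxs : x ∈ skeleton T
  · obtain ⟨K, hK, hxK⟩ := Set.mem_iUnion₂.1 hxs
    obtain ⟨i, hxi⟩ := Set.mem_iUnion.1 hxK
    have hcl := hT.closedInterior_subset hK (facet_subset K i hxi)
    have hxΩ : x ∈ Ω := by
      by_contra hn
      exact hxf (by rw [hT.isOpen.frontier_eq]; exact ⟨hcl, hn⟩)
    rw [hx hxΩ, inner_zero_right]
  · have : normalSum T x = 0 := Finset.sum_eq_zero fun K hK => Finset.sum_eq_zero fun i _ =>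
      Set.indicator_of_notMem (fun h => hxs (facet_subset_skeleton hK i h)) _
    rw [this, inner_zero_right]

end Mesh

/-! ### The advective field on a cell -/

section Advection

variable {d : ℕ} {Ω : Set (E d)} {T : Finset (Cell d)} {a : E d → E d}

/-- Rademacher's theorem on an open set. -/
lemma ae_differentiableAt_of_lipschitzOnWith {F : Type*} [NormedAddCommGroup F]
    [NormedSpace ℝ F] [FiniteDimensional ℝ F] {U : Set (E d)} (hU : IsOpen U) {f : E d → F}
    {L : ℝ≥0} (hf : LipschitzOnWith L f U) :
    ∀ᵐ x ∂(volume.restrict U), DifferentiableAt ℝ f x := by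
  rw [ae_restrict_iff' hU.measurableSet]
  filter_upwards [hf.ae_differentiableWithinAt_of_mem (μ := volume)] with x hx hxU
  exact (hx hxU).differentiableAt (hU.mem_nhds hxU)

/-- A Lipschitz function on an open convex set whose derivative is bounded by `M` almost
everywhere is Lipschitz with constant `M`. The bound is integrated along almost every translate
of a segment, and extends to the segment itself by continuity. -/
lemma lipschitzOnWith_of_ae_fderiv_le {U : Set (E d)} (hU : IsOpen U) (hUc : Convex ℝ U)
    {f : E d → E d} {L M : ℝ≥0} (hf : LipschitzOnWith L f U)
    (hM : ∀ᵐ x ∂(volume.restrict U), ‖fderiv ℝ f x‖ ≤ M) : LipschitzOnWith M f U := by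
  have hgood : ∀ᵐ x ∂(volume : Measure (E d)),
      x ∈ U → DifferentiableAt ℝ f x ∧ ‖fderiv ℝ f x‖ ≤ M := by
    rw [← ae_restrict_iff' hU.measurableSet]
    exact (ae_differentiableAt_of_lipschitzOnWith hU hf).and hM
  set N := toMeasurable volume {x | ¬ (x ∈ U → DifferentiableAt ℝ f x ∧ ‖fderiv ℝ f x‖ ≤ M)}
  have hN0 : volume N = 0 := by
    rw [measure_toMeasurable]
    exact ae_iff.1 hgood
  have hNm : MeasurableSet N := measurableSet_toMeasurable _ _
  have hN : ∀ x, x ∉ N → x ∈ U → DifferentiableAt ℝ f x ∧ ‖fderiv ℝ f x‖ ≤ M := by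
    intro x hx
    by_contra hn
    exact hx (subset_toMeasurable _ _ hn)
  refine LipschitzOnWith.of_dist_le_mul fun y hy x hx => ?_
  rw [dist_eq_norm, dist_eq_norm]
  set e := y - x with he
  have hmeas : MeasurableSet {q : E d × ℝ | x + q.1 + q.2 • e ∉ N} := by
    have hm : Measurable fun q : E d × ℝ => x + q.1 + q.2 • e := by fun_prop
    exact hm hNm.compl
  have hz : ∀ᵐ z ∂(volume : Measure (E d)), ∀ᵐ t ∂(volume : Measure ℝ), x + z + t • e ∉ N := by
    rw [Measure.ae_ae_comm hmeas]
    refine Filter.Eventually.of_forall fun t => ?_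
    have h := measurePreserving_add_right (volume : Measure (E d)) (x + t • e)
    have h2 := h.quasiMeasurePreserving.ae (measure_eq_zero_iff_ae_notMem.1 hN0)
    filter_upwards [h2] with z hz
    rwa [show x + z + t • e = z + (x + t • e) by abel]
  -- the estimate for almost every translate of the segment from `x` to `y`
  have key : ∀ z, x + z ∈ U → y + z ∈ U → (∀ᵐ t ∂(volume : Measure ℝ), x + z + t • e ∉ N) →
      ‖f (y + z) - f (x + z)‖ ≤ M * ‖e‖ := by
    intro z hxz hyz ht
    set w := f (y + z) - f (x + z) with hw
    have hseg : ∀ t ∈ Set.Icc (0 : ℝ) 1, x + z + t • e ∈ U := by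
      intro t ht
      have h := hUc.add_smul_sub_mem hxz hyz ht
      rwa [add_sub_add_right_eq_sub] at h
    have hlip : LipschitzOnWith (‖w‖₊ * (L * ‖e‖₊)) (fun t : ℝ => inner ℝ w (f (x + z + t • e)))
        (Set.uIcc 0 1) := by
      rw [Set.uIcc_of_le zero_le_one]
      refine LipschitzOnWith.of_dist_le_mul fun t ht s hs => ?_
      have h1 := hf.dist_le_mul _ (hseg t ht) _ (hseg s hs)
      rw [dist_eq_norm, dist_eq_norm, add_sub_add_left_eq_sub, ← sub_smul, norm_smul] at h1
      rw [dist_eq_norm, ← inner_sub_right]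
      refine (norm_inner_le_norm _ _).trans ?_
      calc ‖w‖ * ‖f (x + z + t • e) - f (x + z + s • e)‖
          ≤ ‖w‖ * (L * (‖t - s‖ * ‖e‖)) := by gcongr
        _ = _ := by
          rw [dist_eq_norm]
          push_cast
          ring
    have hftc := hlip.absolutelyContinuousOnInterval.integral_deriv_eq_sub
    have hb : ‖∫ t in (0 : ℝ)..1, deriv (fun t : ℝ => inner ℝ w (f (x + z + t • e))) t‖ ≤
        ‖w‖ * (M * ‖e‖) * |(1 : ℝ) - 0| := by
      refine intervalIntegral.norm_integral_le_of_norm_le_const_ae ?_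
      filter_upwards [ht] with t ht htI
      rw [Set.uIoc_of_le zero_le_one] at htI
      obtain ⟨hd, hle⟩ := hN _ ht (hseg t (Set.Ioc_subset_Icc_self htI))
      have h1 : HasDerivAt (fun t : ℝ => x + z + t • e) e t := by
        simpa using ((hasDerivAt_id t).smul_const e).const_add (x + z)
      have h2 := (hasDerivAt_const t w).inner ℝ (hd.hasFDerivAt.comp_hasDerivAt t h1)
      have h3 : deriv (fun t : ℝ => inner ℝ w (f (x + z + t • e))) t =
          inner ℝ w (fderiv ℝ f (x + z + t • e) e) := by
        refine h2.deriv.trans ?_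
        simp
      rw [h3]
      refine (norm_inner_le_norm _ _).trans ?_
      gcongr
      exact (ContinuousLinearMap.le_opNorm _ _).trans
        (mul_le_mul_of_nonneg_right hle (norm_nonneg _))
    rw [hftc, ← inner_sub_right, one_smul, zero_smul, add_zero, he,
      show x + z + (y - x) = y + z by abel, ← hw, real_inner_self_eq_norm_sq, sub_zero, abs_one,
      mul_one, Real.norm_of_nonneg (sq_nonneg _), sq, ← he] at hb
    rcases (norm_nonneg w).eq_or_lt with h0 | h0
    · rw [← h0]; positivity
    · exact le_of_mul_le_mul_left hb h0
  by_contra hcon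
  rw [not_le] at hcon
  have hcx : ContinuousAt (fun z => f (x + z)) 0 := by
    refine ContinuousAt.comp (g := f) ?_ (by fun_prop)
    rw [add_zero]
    exact hf.continuousOn.continuousAt (hU.mem_nhds hx)
  have hcy : ContinuousAt (fun z => f (y + z)) 0 := by
    refine ContinuousAt.comp (g := f) ?_ (by fun_prop)
    rw [add_zero]
    exact hf.continuousOn.continuousAt (hU.mem_nhds hy)
  have hev : ∀ᶠ z in nhds (0 : E d), M * ‖e‖ < ‖f (y + z) - f (x + z)‖ := by
    refine (hcy.sub hcx).norm.eventually (lt_mem_nhds ?_)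
    simpa using hcon
  have hevx : ∀ᶠ z in nhds (0 : E d), x + z ∈ U :=
    (continuous_const_add x).continuousAt.eventually (hU.mem_nhds (by simpa using hx))
  have hevy : ∀ᶠ z in nhds (0 : E d), y + z ∈ U :=
    (continuous_const_add y).continuousAt.eventually (hU.mem_nhds (by simpa using hy))
  obtain ⟨z, hz4, hz1, hz2, hz3⟩ :=
    (Measure.dense_of_ae hz).inter_nhds_nonempty (hev.and (hevx.and hevy))
  exact absurd (key z hz2 hz3 hz4) (not_le.2 hz1)

/-- By continuity, the essential bound on `Ω` holds at every point of the closure. -/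
lemma IsAdvection.norm_le_one (ha : IsAdvection Ω a) (hΩ : IsOpen Ω) :
    ∀ x ∈ closure Ω, ‖a x‖ ≤ 1 := by
  obtain ⟨L, hL⟩ := ha.lipschitz
  have hc := hL.continuousOn
  have hae : ∀ᵐ x ∂(volume.restrict Ω), ‖a x‖ ≤ 1 := by
    have h := ha.bounded
    rw [eLpNorm_exponent_top] at h
    filter_upwards [ae_le_eLpNormEssSup (f := a) (μ := volume.restrict Ω)] with x hx
    have h1 := hx.trans h
    rwa [← ofReal_norm, ENNReal.ofReal_le_one] at h1
  have h1 : Set.MapsTo a Ω (Metric.closedBall 0 1) := by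
    intro x hx
    by_contra hn
    have hopen : IsOpen (Ω ∩ a ⁻¹' (Metric.closedBall 0 1)ᶜ) :=
      (hc.mono subset_closure).isOpen_inter_preimage hΩ Metric.isClosed_closedBall.isOpen_compl
    have hpos := hopen.measure_pos volume ⟨x, hx, hn⟩
    rw [ae_restrict_iff' hΩ.measurableSet] at hae
    refine hpos.ne' (measure_mono_null ?_ (ae_iff.1 hae))
    rintro y ⟨hy, hy'⟩ hcon
    exact hy' (mem_closedBall_zero_iff.2 (hcon hy))
  have h2 := h1.closure_of_continuousOn hc
  intro x hx
  have := h2 hx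
  rwa [Metric.isClosed_closedBall.closure_eq, mem_closedBall_zero_iff] at this

/-- The seminorm of `W^1_∞(Ω)` bounds the Lipschitz constant on a cell, since cells are convex; the
Lipschitz constant on `Ω` itself may be larger. -/
lemma IsAdvection.lipschitzOnWith_cell (ha : IsAdvection Ω a) (hT : IsTriangulation Ω T)
    {M : ℝ≥0} (hM : seminormW1inf Ω a ≤ M) {K : Cell d} (hK : K ∈ T) :
    LipschitzOnWith M a K.closedInterior := by
  obtain ⟨L, hL⟩ := ha.lipschitz
  have hsub := hT.interior_subset hK
  have hae : ∀ᵐ x ∂(volume.restrict Ω), ‖fderiv ℝ a x‖ ≤ M := by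
    rw [seminormW1inf, eLpNorm_exponent_top] at hM
    filter_upwards [ae_le_eLpNormEssSup (f := fderiv ℝ a) (μ := volume.restrict Ω)] with x hx
    have h1 := hx.trans hM
    rwa [← ofReal_norm, ENNReal.ofReal_le_iff_le_toReal ENNReal.coe_ne_top] at h1
  have h1 := lipschitzOnWith_of_ae_fderiv_le isOpen_interior (convex_closedInterior K).interior
    (hL.mono (hsub.trans subset_closure)) (ae_restrict_of_ae_restrict_of_subset hsub hae)
  rw [← closure_interior_closedInterior K]
  refine LipschitzOnWith.closure ?_ h1
  rw [closure_interior_closedInterior K]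
  exact hL.continuousOn.mono (hT.closedInterior_subset hK)

lemma IsAdvection.continuousOn_cell (ha : IsAdvection Ω a) (hT : IsTriangulation Ω T)
    {K : Cell d} (hK : K ∈ T) : ContinuousOn a K.closedInterior := by
  obtain ⟨L, hL⟩ := ha.lipschitz
  exact hL.continuousOn.mono (hT.closedInterior_subset hK)

/-- Integration by parts on a cell for a divergence-free Lipschitz field. -/
theorem IsAdvection.integral_fderiv_apply_cell [NeZero d] (ha : IsAdvection Ω a)
    (hT : IsTriangulation Ω T) {K : Cell d} (hK : K ∈ T) {q : E d → ℝ} (hq : ContDiff ℝ 1 q) :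
    ∫ x in K.closedInterior, fderiv ℝ q x (a x) =
      ∑ i, ∫ x in facet K i, aDotN a K i x * q x ∂(surf d) := by
  obtain ⟨L, hL⟩ := ha.lipschitz
  have hKsub := hT.closedInterior_subset hK
  have hLK := hL.mono hKsub
  have hac := hLK.continuousOn
  have hqd := hq.differentiable one_ne_zero
  have hcoord : ∀ j : Fin d, LipschitzOnWith L (fun x => a x j) K.closedInterior := by
    intro j
    refine LipschitzOnWith.of_dist_le_mul fun x hx y hy => ?_
    refine le_trans ?_ (hLK.dist_le_mul x hx y hy)
    rw [dist_eq_norm, dist_eq_norm]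
    exact PiLp.norm_apply_le (a x - a y) j
  -- The components of `q a` are Lipschitz on the cell only; the divergence theorem is applied to
  -- their Lipschitz extensions to the whole space.
  have hext : ∀ j : Fin d, ∃ C : ℝ≥0, ∃ f : E d → ℝ, LipschitzWith C f ∧
      Set.EqOn (fun x => q x * a x j) f K.closedInterior := by
    intro j
    obtain ⟨Cq, hCq⟩ := (hq.contDiffOn (s := K.closedInterior)).exists_lipschitzOnWith one_ne_zero
      (convex_closedInterior K) K.isCompact_closedInterior
    have hlip : ∃ C : ℝ≥0, LipschitzOnWith C (fun x => q x * a x j) K.closedInterior := by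
      obtain ⟨B, hB⟩ := K.isCompact_closedInterior.exists_bound_of_continuousOn
        hq.continuous.continuousOn
      obtain ⟨A, hA⟩ := K.isCompact_closedInterior.exists_bound_of_continuousOn
        (hcoord j).continuousOn
      refine ⟨Real.toNNReal (B * L + A * Cq), LipschitzOnWith.of_dist_le_mul fun x hx y hy => ?_⟩
      have e1 := (hcoord j).dist_le_mul x hx y hy
      have e2 := hCq.dist_le_mul x hx y hy
      rw [dist_eq_norm] at e1 e2
      calc dist (q x * a x j) (q y * a y j) = ‖q x * (a x j - a y j) + a y j * (q x - q y)‖ := by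
            rw [dist_eq_norm]; congr 1; ring
        _ ≤ ‖q x‖ * ‖a x j - a y j‖ + ‖a y j‖ * ‖q x - q y‖ := by
            rw [← norm_mul, ← norm_mul]; exact norm_add_le _ _
        _ ≤ B * (L * dist x y) + A * (Cq * dist x y) :=
            add_le_add (mul_le_mul (hB x hx) e1 (norm_nonneg _) ((norm_nonneg _).trans (hB x hx)))
              (mul_le_mul (hA y hy) e2 (norm_nonneg _) ((norm_nonneg _).trans (hA y hy)))
        _ = (B * L + A * Cq) * dist x y := by ring
        _ ≤ _ := mul_le_mul_of_nonneg_right (Real.le_coe_toNNReal _) dist_nonneg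
    obtain ⟨C, hC⟩ := hlip
    exact ⟨C, hC.extend_real⟩
  choose C f hf hfeq using hext
  have h1 : ∀ j, ∫ x in K.closedInterior, fderiv ℝ (f j) x (EuclideanSpace.single j 1) =
      ∑ i, ∫ x in facet K i, (normal K i) j * (q x * a x j) ∂(surf d) := by
    intro j
    rw [integral_fderiv_cell K (hf j)]
    refine Finset.sum_congr rfl fun i _ => ?_
    rw [integral_const_mul]
    congr 1
    · simp [EuclideanSpace.inner_single_right]
    · exact setIntegral_congr_fun (isClosed_facet K i).measurableSet
        fun x hx => (hfeq j (facet_subset K i hx)).symm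
  have hfint : ∀ j, IntegrableOn (fun x => fderiv ℝ (f j) x (EuclideanSpace.single j 1))
      K.closedInterior := fun j =>
    IntegrableOn.of_bound K.isCompact_closedInterior.measure_lt_top
      (measurable_fderiv_apply_const ℝ (f j) _).aestronglyMeasurable
      (C j * ‖(EuclideanSpace.single j 1 : E d)‖)
      (Filter.Eventually.of_forall fun x => (ContinuousLinearMap.le_opNorm _ _).trans
        (mul_le_mul_of_nonneg_right (norm_fderiv_le_of_lipschitz ℝ (hf j)) (norm_nonneg _)))
  have hdiff : ∀ᵐ x ∂(volume.restrict Ω), DifferentiableAt ℝ a x :=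
    ae_differentiableAt_of_lipschitzOnWith hT.isOpen (hL.mono subset_closure)
  have h2 : ∫ x in K.closedInterior, fderiv ℝ q x (a x) =
      ∫ x in K.closedInterior, ∑ j, fderiv ℝ (f j) x (EuclideanSpace.single j 1) := by
    refine integral_congr_ae ?_
    filter_upwards [ae_mem_interior K, hT.ae_mem_of_mem_cell hK hdiff,
      hT.ae_mem_of_mem_cell hK ha.div_free] with x hxi hxd hxdiv
    have hfj : ∀ j, fderiv ℝ (f j) x (EuclideanSpace.single j 1) =
        q x * (fderiv ℝ a x (EuclideanSpace.single j 1)) j +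
          a x j * fderiv ℝ q x (EuclideanSpace.single j 1) := by
      intro j
      have hev : f j =ᶠ[nhds x] fun x => q x * a x j := by
        filter_upwards [isOpen_interior.mem_nhds hxi] with y hy
        exact (hfeq j (_root_.interior_subset hy)).symm
      have haj : HasFDerivAt (fun x => a x j)
          ((EuclideanSpace.proj j : E d →L[ℝ] ℝ).comp (fderiv ℝ a x)) x :=
        (EuclideanSpace.proj j : E d →L[ℝ] ℝ).hasFDerivAt.comp x hxd.hasFDerivAt
      rw [hev.fderiv_eq, ((hqd x).hasFDerivAt.fun_mul haj).fderiv]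
      simp
    simp only [hfj, Finset.sum_add_distrib, ← Finset.mul_sum]
    rw [divergence] at hxdiv
    rw [hxdiv, mul_zero, zero_add]
    have hax : a x = ∑ j, a x j • (EuclideanSpace.single j 1 : E d) := by
      ext m
      simp [Finset.sum_apply, Pi.single_apply]
    conv_lhs => rw [hax, map_sum]
    simp
  rw [h2, integral_finsetSum _ fun j _ => hfint j, Finset.sum_congr rfl fun j _ => h1 j,
    Finset.sum_comm]
  refine Finset.sum_congr rfl fun i _ => ?_
  rw [← integral_finsetSum]
  · refine integral_congr_ae (Filter.Eventually.of_forall fun x => ?_)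
    simp only [aDotN, PiLp.inner_apply, Finset.sum_mul]
    refine Finset.sum_congr rfl fun j _ => ?_
    simp
    ring
  · intro j _
    have hcF : ContinuousOn (fun x => (normal K i) j * (q x * a x j)) (facet K i) :=
      continuousOn_const.mul (hq.continuous.continuousOn.mul
        ((hcoord j).continuousOn.mono (facet_subset K i)))
    exact hcF.integrableOn_of_subset_isCompact (isCompact_facet K i)
      (isClosed_facet K i).measurableSet Set.Subset.rfl (surf_facet_lt_top K i).ne

end Advection

/-! ### The Cauchy-Schwarz inequality with a signed weight -/

section WeightedIntegrals

/-- The Cauchy-Schwarz inequality with a signed weight `b`, enlarging the domain of integration on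
the right-hand side. -/
lemma abs_setIntegral_mul_le {α : Type*} [MeasurableSpace α] {ν : Measure α} {S S' : Set α}
    (hS : S ⊆ S') {b f g : α → ℝ}
    (hf : IntegrableOn (fun x => |b x| * f x ^ 2) S' ν)
    (hg : IntegrableOn (fun x => |b x| * g x ^ 2) S' ν) :
    |∫ x in S, b x * f x * g x ∂ν| ≤
      √(∫ x in S', |b x| * f x ^ 2 ∂ν) * √(∫ x in S', |b x| * g x ^ 2 ∂ν) := by
  set A := ∫ x in S', |b x| * f x ^ 2 ∂ν
  set B := ∫ x in S', |b x| * g x ^ 2 ∂ν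
  set I := ∫ x in S, b x * f x * g x ∂ν
  have hA : 0 ≤ A := integral_nonneg fun _ => by positivity
  have hB : 0 ≤ B := integral_nonneg fun _ => by positivity
  -- Young's inequality with every weight `t` bounds the discriminant of a quadratic polynomial.
  have hquad : ∀ t : ℝ, 0 ≤ A * (t * t) + (-(2 * |I|)) * t + B := by
    intro t
    rcases le_or_gt t 0 with ht | ht
    · have := mul_nonneg (abs_nonneg I) (neg_nonneg.2 ht)
      have := mul_nonneg hA (mul_self_nonneg t)
      nlinarith
    have hint : IntegrableOn (fun x => t * (|b x| * f x ^ 2) / 2 + |b x| * g x ^ 2 / (2 * t)) S' ν :=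
      ((hf.const_mul t).div_const 2).add (hg.div_const (2 * t))
    have h1 : |I| ≤ ∫ x in S', (t * (|b x| * f x ^ 2) / 2 + |b x| * g x ^ 2 / (2 * t)) ∂ν := by
      refine le_trans (?_ : ‖I‖ ≤ ∫ x in S, (t * (|b x| * f x ^ 2) / 2 +
          |b x| * g x ^ 2 / (2 * t)) ∂ν) (setIntegral_mono_set hint
          (Filter.Eventually.of_forall fun x => by positivity) hS.eventuallyLE)
      refine norm_integral_le_of_norm_le (hint.mono_set hS)
        (Filter.Eventually.of_forall fun x => ?_)
      rw [norm_mul, norm_mul, Real.norm_eq_abs, Real.norm_eq_abs, Real.norm_eq_abs,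
        ← sq_abs (f x), ← sq_abs (g x)]
      have h2 : |f x| * |g x| ≤ t * |f x| ^ 2 / 2 + |g x| ^ 2 / (2 * t) := by
        have h3 : t * |f x| ^ 2 / 2 + |g x| ^ 2 / (2 * t) - |f x| * |g x| =
            (t * |f x| - |g x|) ^ 2 / (2 * t) := by
          field_simp
          ring
        have h4 : 0 ≤ (t * |f x| - |g x|) ^ 2 / (2 * t) := by positivity
        linarith
      calc |b x| * |f x| * |g x| = |b x| * (|f x| * |g x|) := by ring
        _ ≤ |b x| * (t * |f x| ^ 2 / 2 + |g x| ^ 2 / (2 * t)) := by gcongr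
        _ = _ := by ring
    rw [integral_add ((hf.const_mul t).div_const 2) (hg.div_const (2 * t)), integral_div,
      integral_div, integral_const_mul] at h1
    have h5 : t * A / 2 + B / (2 * t) = (t * t * A + B) / (2 * t) := by field_simp
    change |I| ≤ t * A / 2 + B / (2 * t) at h1
    rw [h5, le_div_iff₀ (by positivity)] at h1
    nlinarith
  have hd := discrim_le_zero hquad
  rw [discrim] at hd
  rw [← Real.sqrt_mul hA]
  refine Real.le_sqrt_of_sq_le ?_
  nlinarith [sq_abs I]

end WeightedIntegrals

/-! ### Contributions of a single cell to the form and to the norm -/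

section LocalForms

variable {d : ℕ}

lemma real_inner_gradient (f : E d → ℝ) (x y : E d) : inner ℝ y (gradient f x) = fderiv ℝ f x y := by
  rw [real_inner_comm, inner_gradient_left]

/-- The derivative at boundary points of the cell depends on values outside the cell, but these
points form a null set. -/
lemma ae_fderiv_eq_of_eqOn {K : Cell d} {p p' : E d → ℝ}
    (h : ∀ x ∈ K.closedInterior, p x = p' x) :
    ∀ᵐ x ∂(volume.restrict K.closedInterior), fderiv ℝ p x = fderiv ℝ p' x := by
  filter_upwards [ae_mem_interior K] with x hx
  refine Filter.EventuallyEq.fderiv_eq ?_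
  filter_upwards [isOpen_interior.mem_nhds hx] with y hy
  exact h y (_root_.interior_subset hy)

variable [NeZero d] {Ω : Set (E d)} {T : Finset (Cell d)} {a : E d → E d} {μ : ℝ}

/-- The contribution of the cell `K` to the advective form, for the cell functions `p`, `q` and
the interface functions `u`, `s`. -/
noncomputable def localForm (μ : ℝ) (a : E d → E d) (Ω : Set (E d)) (K : Cell d)
    (p u q s : E d → ℝ) : ℝ :=
  (∫ x in K.closedInterior, μ * p x * q x) - (∫ x in K.closedInterior, p x * fderiv ℝ q x (a x))
    - (∑ i, ∫ x in outflow a K i, aDotN a K i x * p x * (s x - q x) ∂(surf d))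
    - (∑ i, ∫ x in inflow a K i, aDotN a K i x * u x * (s x - q x) ∂(surf d))
    + ∑ i, ∫ x in outflow a K i ∩ frontier Ω, aDotN a K i x * u x * s x ∂(surf d)

/-- The contribution of the cell `K` to the square of the stability norm. -/
noncomputable def localEnergy (μ : ℝ) (a : E d → E d) (Ω : Set (E d)) (K : Cell d)
    (p u : E d → ℝ) : ℝ :=
  μ * (∫ x in K.closedInterior, p x ^ 2)
    + cellSize K * (∫ x in K.closedInterior, (fderiv ℝ p x (a x)) ^ 2)
    + (∑ i, ∫ x in facet K i, |aDotN a K i x| * (u x - p x) ^ 2 ∂(surf d))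
    + ∑ i, ∫ x in facet K i ∩ frontier Ω, |aDotN a K i x| * u x ^ 2 ∂(surf d)

lemma integral_sq_nonneg {α : Type*} [MeasurableSpace α] (ν : Measure α) (b f : α → ℝ) :
    0 ≤ ∫ x, |b x| * f x ^ 2 ∂ν :=
  integral_nonneg fun _ => by positivity

lemma localEnergy_nonneg (hμ : 0 ≤ μ) (K : Cell d) (p u : E d → ℝ) :
    0 ≤ localEnergy μ a Ω K p u := by
  have h1 : 0 ≤ ∫ x in K.closedInterior, p x ^ 2 := integral_nonneg fun _ => sq_nonneg _
  have h2 : 0 ≤ ∫ x in K.closedInterior, (fderiv ℝ p x (a x)) ^ 2 :=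
    integral_nonneg fun _ => sq_nonneg _
  have h3 := (cellSize_pos K).le
  have h4 : 0 ≤ ∑ i, ∫ x in facet K i, |aDotN a K i x| * (u x - p x) ^ 2 ∂(surf d) :=
    Finset.sum_nonneg fun i _ => integral_sq_nonneg _ _ _
  have h5 : 0 ≤ ∑ i, ∫ x in facet K i ∩ frontier Ω, |aDotN a K i x| * u x ^ 2 ∂(surf d) :=
    Finset.sum_nonneg fun i _ => integral_sq_nonneg _ _ _
  unfold localEnergy
  positivity

lemma BA_eq_sum_localForm (w v : Pair d) :
    BA μ a Ω T w v = ∑ K ∈ T, localForm μ a Ω K (w.1 K) w.2 (v.1 K) v.2 := by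
  simp only [BA, localForm, real_inner_gradient, Finset.sum_add_distrib, Finset.sum_sub_distrib]

lemma normA_eq_sqrt (v : Pair d) :
    normA μ a Ω T v = √(∑ K ∈ T, localEnergy μ a Ω K (v.1 K) v.2) := by
  simp only [normA, localEnergy, real_inner_gradient, Finset.sum_add_distrib, Finset.mul_sum]

lemma continuousOn_aDotN {K : Cell d} (ha : ContinuousOn a K.closedInterior) (i : Fin (d + 1)) :
    ContinuousOn (aDotN a K i) (facet K i) :=
  (ha.mono (facet_subset K i)).inner continuousOn_const

lemma outflow_subset (a : E d → E d) (K : Cell d) (i : Fin (d + 1)) :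
    outflow a K i ⊆ facet K i := fun _ hx => hx.1

lemma inflow_subset (a : E d → E d) (K : Cell d) (i : Fin (d + 1)) :
    inflow a K i ⊆ facet K i := fun _ hx => hx.1

lemma measurableSet_outflow {K : Cell d} (ha : ContinuousOn a K.closedInterior)
    (i : Fin (d + 1)) : MeasurableSet (outflow a K i) :=
  ((continuousOn_aDotN ha i).preimage_isClosed_of_isClosed (isClosed_facet K i)
    isClosed_Ici).measurableSet

lemma inflow_eq_sdiff (a : E d → E d) (K : Cell d) (i : Fin (d + 1)) :
    inflow a K i = facet K i \ outflow a K i := by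
  ext x
  simp only [inflow, outflow, Set.mem_ofPred, Set.mem_sdiff, not_and, not_le]
  exact ⟨fun h => ⟨h.1, fun _ => h.2⟩, fun h => ⟨h.1, h.2 h.1⟩⟩

lemma measurableSet_inflow {K : Cell d} (ha : ContinuousOn a K.closedInterior)
    (i : Fin (d + 1)) : MeasurableSet (inflow a K i) := by
  rw [inflow_eq_sdiff]
  exact (isClosed_facet K i).measurableSet.diff (measurableSet_outflow ha i)

lemma integral_facet_eq_add {K : Cell d} (ha : ContinuousOn a K.closedInterior)
    (i : Fin (d + 1)) {φ : E d → ℝ} (hφ : IntegrableOn φ (facet K i) (surf d)) :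
    ∫ x in facet K i, φ x ∂(surf d) =
      (∫ x in outflow a K i, φ x ∂(surf d)) + ∫ x in inflow a K i, φ x ∂(surf d) := by
  rw [← integral_inter_add_sdiff (measurableSet_outflow ha i) hφ,
    Set.inter_eq_right.2 (outflow_subset a K i), inflow_eq_sdiff]

lemma integral_facet_inter_eq_add {K : Cell d} (ha : ContinuousOn a K.closedInterior)
    (i : Fin (d + 1)) {φ : E d → ℝ} {S : Set (E d)}
    (hφ : IntegrableOn φ (facet K i ∩ S) (surf d)) :
    ∫ x in facet K i ∩ S, φ x ∂(surf d) =
      (∫ x in outflow a K i ∩ S, φ x ∂(surf d)) + ∫ x in inflow a K i ∩ S, φ x ∂(surf d) := by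
  rw [← integral_inter_add_sdiff (measurableSet_outflow ha i) hφ, inflow_eq_sdiff]
  congr 3
  · rw [Set.inter_right_comm, Set.inter_eq_right.2 (outflow_subset a K i)]
  · rw [Set.inter_comm, Set.inter_sdiff_assoc, Set.inter_comm]

lemma localForm_congr {K : Cell d} (ha : ContinuousOn a K.closedInterior) {p p' q q' : E d → ℝ}
    (hp : ∀ x ∈ K.closedInterior, p x = p' x) (hq : ∀ x ∈ K.closedInterior, q x = q' x)
    (u s : E d → ℝ) : localForm μ a Ω K p u q s = localForm μ a Ω K p' u q' s := by
  have hKm := K.isClosed_closedInterior.measurableSet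
  unfold localForm
  congr 1
  congr 1
  · congr 1
    · congr 1
      · exact setIntegral_congr_fun hKm fun x hx => by simp only [hp x hx, hq x hx]
      · refine integral_congr_ae ?_
        filter_upwards [ae_fderiv_eq_of_eqOn hq, ae_restrict_mem hKm] with x h1 h2
        rw [h1, hp x h2]
    · refine Finset.sum_congr rfl fun i _ =>
        setIntegral_congr_fun (measurableSet_outflow ha i) fun x hx => ?_
      have := facet_subset K i hx.1
      simp only [hp x this, hq x this]
  · refine Finset.sum_congr rfl fun i _ =>
      setIntegral_congr_fun (measurableSet_inflow ha i) fun x hx => ?_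
    have := facet_subset K i hx.1
    simp only [hq x this]

lemma localEnergy_congr {K : Cell d} {p p' : E d → ℝ}
    (hp : ∀ x ∈ K.closedInterior, p x = p' x) (u : E d → ℝ) :
    localEnergy μ a Ω K p u = localEnergy μ a Ω K p' u := by
  have hKm := K.isClosed_closedInterior.measurableSet
  unfold localEnergy
  congr 2
  · congr 1
    · congr 1
      exact setIntegral_congr_fun hKm fun x hx => by simp only [hp x hx]
    · congr 1
      refine integral_congr_ae ?_
      filter_upwards [ae_fderiv_eq_of_eqOn hp] with x h1
      rw [h1]
  · refine Finset.sum_congr rfl fun i _ =>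
      setIntegral_congr_fun (isClosed_facet K i).measurableSet fun x hx => ?_
    simp only [hp x (facet_subset K i hx)]

end LocalForms

/-! ### Coercivity -/

section Coercivity

variable {d : ℕ}

lemma continuousOn_fderiv_apply {k : ℕ} {a : E d → E d} {K : Cell d}
    (ha : ContinuousOn a K.closedInterior)
    {p : E d → ℝ} (hp : IsPoly k p) :
    ContinuousOn (fun x => fderiv ℝ p x (a x)) K.closedInterior :=
  hp.continuous_fderiv.continuousOn.clm_apply ha

variable [NeZero d] {Ω : Set (E d)} {T : Finset (Cell d)} {a : E d → E d} {μ : ℝ}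

lemma memLp_facet_of_continuousOn {K : Cell d} {i : Fin (d + 1)} {f : E d → ℝ}
    (hf : ContinuousOn f (facet K i)) : MemLp f 2 ((surf d).restrict (facet K i)) := by
  obtain ⟨B, hB⟩ := (isCompact_facet K i).exists_bound_of_continuousOn hf
  refine MemLp.of_bound (hf.aestronglyMeasurable (isClosed_facet K i).measurableSet) B ?_
  filter_upwards [ae_restrict_mem (isClosed_facet K i).measurableSet] with x hx
  exact hB x hx

lemma integrableOn_facet_mul {K : Cell d} {i : Fin (d + 1)} {b f g : E d → ℝ}
    (hb : ContinuousOn b (facet K i)) (hf : MemLp f 2 ((surf d).restrict (facet K i)))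
    (hg : MemLp g 2 ((surf d).restrict (facet K i))) :
    IntegrableOn (fun x => b x * f x * g x) (facet K i) (surf d) := by
  obtain ⟨B, hB⟩ := (isCompact_facet K i).exists_bound_of_continuousOn hb
  have h := (hf.integrable_mul hg).bdd_mul (c := B)
    (hb.aestronglyMeasurable (isClosed_facet K i).measurableSet) (by
      filter_upwards [ae_restrict_mem (isClosed_facet K i).measurableSet] with x hx
      exact hB x hx)
  refine h.congr (Filter.Eventually.of_forall fun x => ?_)
  simp only [Pi.mul_apply, mul_assoc]

lemma integrableOn_facet_mul_sq {K : Cell d} {i : Fin (d + 1)} {b f : E d → ℝ}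
    (hb : ContinuousOn b (facet K i)) (hf : MemLp f 2 ((surf d).restrict (facet K i))) :
    IntegrableOn (fun x => b x * f x ^ 2) (facet K i) (surf d) :=
  (integrableOn_facet_mul hb hf hf).congr (Filter.Eventually.of_forall fun x => by
    simp only [sq, mul_assoc])

/-- The facet terms of the advective form, tested with the same functions. -/
lemma integral_facet_upwind {K : Cell d} (ha : ContinuousOn a K.closedInterior)
    (i : Fin (d + 1)) {p u : E d → ℝ} (hp : MemLp p 2 ((surf d).restrict (facet K i)))
    (hu : MemLp u 2 ((surf d).restrict (facet K i))) :
    (∫ x in outflow a K i, aDotN a K i x * p x * (u x - p x) ∂(surf d)) +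
      (∫ x in inflow a K i, aDotN a K i x * u x * (u x - p x) ∂(surf d)) =
    (1 / 2) * (∫ x in facet K i, aDotN a K i x * u x ^ 2 ∂(surf d)) -
      (1 / 2) * (∫ x in facet K i, aDotN a K i x * p x ^ 2 ∂(surf d)) -
      (1 / 2) * ∫ x in facet K i, |aDotN a K i x| * (u x - p x) ^ 2 ∂(surf d) := by
  have hb := continuousOn_aDotN ha i
  have h1 := (integrableOn_facet_mul_sq hb hu).const_mul (1 / 2)
  have h2 := (integrableOn_facet_mul_sq hb hp).const_mul (1 / 2)
  have h3 := (integrableOn_facet_mul_sq hb.abs (hu.sub hp)).const_mul (1 / 2)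
  have h3' : IntegrableOn (fun x => (1 / 2) * (|aDotN a K i x| * (u x - p x) ^ 2)) (facet K i)
    (surf d) := h3
  have h12 : IntegrableOn (fun x => (1 / 2) * (aDotN a K i x * u x ^ 2) -
      (1 / 2) * (aDotN a K i x * p x ^ 2)) (facet K i) (surf d) := h1.sub h2
  have h123 : IntegrableOn (fun x => (1 / 2) * (aDotN a K i x * u x ^ 2) -
      (1 / 2) * (aDotN a K i x * p x ^ 2) - (1 / 2) * (|aDotN a K i x| * (u x - p x) ^ 2))
      (facet K i) (surf d) := h12.sub h3'
  rw [← integral_const_mul, ← integral_const_mul, ← integral_const_mul, ← integral_sub h1 h2,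
    ← integral_sub h12 h3', integral_facet_eq_add ha i h123]
  congr 1
  · refine setIntegral_congr_fun (measurableSet_outflow ha i) fun x hx => ?_
    rw [abs_of_nonneg hx.2]
    ring
  · refine setIntegral_congr_fun (measurableSet_inflow ha i) fun x hx => ?_
    rw [abs_of_neg hx.2]
    ring

/-- Integration by parts for a product of polynomials. -/
lemma IsAdvection.integral_mul_fderiv {k : ℕ} (ha : IsAdvection Ω a)
    (hT : IsTriangulation Ω T) {K : Cell d} (hK : K ∈ T) {p q : E d → ℝ} (hp : IsPoly k p)
    (hq : IsPoly k q) :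
    (∫ x in K.closedInterior, p x * fderiv ℝ q x (a x)) =
      (∑ i, ∫ x in facet K i, aDotN a K i x * (p x * q x) ∂(surf d)) -
        ∫ x in K.closedInterior, q x * fderiv ℝ p x (a x) := by
  have hac := ha.continuousOn_cell hT hK
  have h := ha.integral_fderiv_apply_cell hT hK (q := fun x => p x * q x)
    ((hp.contDiff.mul hq.contDiff).of_le le_top)
  rw [← h, eq_sub_iff_add_eq, ← integral_add]
  · refine integral_congr_ae (Filter.Eventually.of_forall fun x => ?_)
    simp only
    rw [((hp.differentiable x).hasFDerivAt.fun_mul (hq.differentiable x).hasFDerivAt).fderiv]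
    simp
  · exact (hp.continuous.continuousOn.mul (continuousOn_fderiv_apply hac hq)).integrableOn_compact
      K.isCompact_closedInterior
  · exact (hq.continuous.continuousOn.mul (continuousOn_fderiv_apply hac hp)).integrableOn_compact
      K.isCompact_closedInterior

lemma localForm_self {k : ℕ} (ha : IsAdvection Ω a) (hT : IsTriangulation Ω T) {K : Cell d}
    (hK : K ∈ T) {p u : E d → ℝ} (hp : IsPoly k p)
    (hu : ∀ i, MemLp u 2 ((surf d).restrict (facet K i))) :
    localForm μ a Ω K p u p u =
      μ * (∫ x in K.closedInterior, p x ^ 2)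
      + (1 / 2) * (∑ i, ∫ x in facet K i, |aDotN a K i x| * (u x - p x) ^ 2 ∂(surf d))
      - (1 / 2) * (∑ i, ∫ x in facet K i, aDotN a K i x * u x ^ 2 ∂(surf d))
      + ∑ i, ∫ x in outflow a K i ∩ frontier Ω, aDotN a K i x * u x * u x ∂(surf d) := by
  have hac := ha.continuousOn_cell hT hK
  have hpm : ∀ i, MemLp p 2 ((surf d).restrict (facet K i)) := fun i =>
    memLp_facet_of_continuousOn hp.continuous.continuousOn
  have h1 := ha.integral_mul_fderiv hT hK hp hp
  have h2 := Finset.sum_congr rfl fun i (_ : i ∈ Finset.univ) =>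
    integral_facet_upwind hac i (hpm i) (hu i)
  rw [Finset.sum_add_distrib, Finset.sum_sub_distrib, Finset.sum_sub_distrib, ← Finset.mul_sum,
    ← Finset.mul_sum, ← Finset.mul_sum] at h2
  have h3 : ∫ x in K.closedInterior, μ * p x * p x = μ * ∫ x in K.closedInterior, p x ^ 2 := by
    rw [← integral_const_mul]
    simp only [sq, mul_assoc]
  simp only [← sq] at h1
  rw [localForm, h3]
  linarith

/-- Coercivity: the form tested with its own argument controls the reaction and the jump terms.
The interface terms cancel across interior facets. -/
lemma sum_localForm_self {k : ℕ} (ha : IsAdvection Ω a) (hT : IsTriangulation Ω T)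
    {P : Cell d → E d → ℝ} {u : E d → ℝ} (hP : ∀ K ∈ T, IsPoly k (P K))
    (hu : ∀ K ∈ T, ∀ i, MemLp u 2 ((surf d).restrict (facet K i))) :
    ∑ K ∈ T, localForm μ a Ω K (P K) u (P K) u =
      ∑ K ∈ T, (μ * (∫ x in K.closedInterior, P K x ^ 2)
      + (1 / 2) * (∑ i, ∫ x in facet K i, |aDotN a K i x| * (u x - P K x) ^ 2 ∂(surf d))
      + (1 / 2) * ∑ i, ∫ x in facet K i ∩ frontier Ω, |aDotN a K i x| * u x ^ 2 ∂(surf d)) := by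
  have hint : ∀ K ∈ T, ∀ i, IntegrableOn (fun x => aDotN a K i x * u x ^ 2) (facet K i)
      (surf d) := fun K hK i =>
    integrableOn_facet_mul_sq (continuousOn_aDotN (ha.continuousOn_cell hT hK) i) (hu K hK i)
  have hinner : ∀ (K : Cell d) (i : Fin (d + 1)) (x : E d),
      inner ℝ (u x ^ 2 • a x) (normal K i) = aDotN a K i x * u x ^ 2 := by
    intro K i x
    rw [inner_smul_left, conj_trivial, mul_comm, aDotN]
  have hflux := hT.sum_flux_eq (fun x => u x ^ 2 • a x) (by simpa only [hinner] using hint)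
  simp only [hinner] at hflux
  -- On the outflow part of the boundary the boundary term of the form exceeds half of the flux by
  -- the other half; on the inflow part the flux is negative.
  have hb : ∀ K ∈ T, ∀ i,
      - ((1 / 2) * ∫ x in facet K i ∩ frontier Ω, aDotN a K i x * u x ^ 2 ∂(surf d)) +
        (∫ x in outflow a K i ∩ frontier Ω, aDotN a K i x * u x * u x ∂(surf d)) =
      (1 / 2) * ∫ x in facet K i ∩ frontier Ω, |aDotN a K i x| * u x ^ 2 ∂(surf d) := by
    intro K hK i
    have hac := ha.continuousOn_cell hT hK
    have hfm : MeasurableSet (frontier Ω) := isClosed_frontier.measurableSet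
    rw [integral_facet_inter_eq_add hac i ((hint K hK i).mono_set Set.inter_subset_left),
      integral_facet_inter_eq_add hac i ((integrableOn_facet_mul_sq
        (continuousOn_aDotN hac i).abs (hu K hK i)).mono_set Set.inter_subset_left)]
    have e1 : ∫ x in outflow a K i ∩ frontier Ω, |aDotN a K i x| * u x ^ 2 ∂(surf d) =
        ∫ x in outflow a K i ∩ frontier Ω, aDotN a K i x * u x ^ 2 ∂(surf d) :=
      setIntegral_congr_fun ((measurableSet_outflow hac i).inter hfm) fun x hx => by
        simp only [abs_of_nonneg hx.1.2]
    have e2 : ∫ x in inflow a K i ∩ frontier Ω, |aDotN a K i x| * u x ^ 2 ∂(surf d) =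
        - ∫ x in inflow a K i ∩ frontier Ω, aDotN a K i x * u x ^ 2 ∂(surf d) := by
      rw [← integral_neg]
      exact setIntegral_congr_fun ((measurableSet_inflow hac i).inter hfm) fun x hx => by
        simp only [abs_of_neg hx.1.2, neg_mul]
    have e3 : ∀ x, aDotN a K i x * u x * u x = aDotN a K i x * u x ^ 2 := fun x => by ring
    simp only [e1, e2, e3]
    ring
  have hbsum := Finset.sum_congr rfl fun K hK => Finset.sum_congr rfl fun i (_ : i ∈ Finset.univ) =>
    hb K hK i
  simp only [Finset.sum_add_distrib, Finset.sum_neg_distrib, ← Finset.mul_sum] at hbsum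
  rw [Finset.sum_congr rfl fun K hK => localForm_self ha hT hK (hP K hK) (hu K hK)]
  simp only [Finset.sum_add_distrib, Finset.sum_sub_distrib, ← Finset.mul_sum]
  linarith

end Coercivity

/-! ### Boundedness in the second argument -/

section Boundedness

variable {d : ℕ} [NeZero d] {Ω : Set (E d)} {T : Finset (Cell d)} {a : E d → E d} {μ : ℝ}

lemma sqrt_le_sqrt_inv_mul_sqrt {x c N : ℝ} (hc : 0 < c) (h : c * x ≤ N) :
    √x ≤ √c⁻¹ * √N := by
  rw [← Real.sqrt_mul (inv_nonneg.2 hc.le)]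
  refine Real.sqrt_le_sqrt ?_
  rw [← div_eq_inv_mul, le_div_iff₀ hc]
  linarith

/-- For fixed first argument the form is a bounded functional of the second argument. -/
lemma exists_localForm_le {k : ℕ} (ha : IsAdvection Ω a) (hT : IsTriangulation Ω T) (hμ : 0 < μ)
    {K : Cell d} (hK : K ∈ T) {p u : E d → ℝ} (hp : IsPoly k p)
    (hu : ∀ i, MemLp u 2 ((surf d).restrict (facet K i))) :
    ∃ C : ℝ, 0 ≤ C ∧ ∀ q s : E d → ℝ, IsPoly k q →
      (∀ i, MemLp s 2 ((surf d).restrict (facet K i))) →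
      |localForm μ a Ω K p u q s| ≤ C * √(localEnergy μ a Ω K q s) := by
  have hac := ha.continuousOn_cell hT hK
  have hh := cellSize_pos K
  have hpm : ∀ i, MemLp p 2 ((surf d).restrict (facet K i)) := fun i =>
    memLp_facet_of_continuousOn hp.continuous.continuousOn
  have hKint : ∀ f : E d → ℝ, ContinuousOn f K.closedInterior →
      IntegrableOn f K.closedInterior := fun f hf =>
    hf.integrableOn_compact K.isCompact_closedInterior
  have hint : ∀ (f : E d → ℝ) i, MemLp f 2 ((surf d).restrict (facet K i)) →
      IntegrableOn (fun x => |aDotN a K i x| * f x ^ 2) (facet K i) (surf d) := fun f i hf =>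
    integrableOn_facet_mul_sq (continuousOn_aDotN hac i).abs hf
  refine ⟨√(∫ x in K.closedInterior, |μ| * p x ^ 2) * 1 +
    √(∫ x in K.closedInterior, |(1 : ℝ)| * p x ^ 2) * √(cellSize K)⁻¹ +
    (∑ i, √(∫ x in facet K i, |aDotN a K i x| * p x ^ 2 ∂(surf d))) +
    (∑ i, √(∫ x in facet K i, |aDotN a K i x| * u x ^ 2 ∂(surf d))) +
    ∑ i, √(∫ x in facet K i ∩ frontier Ω, |aDotN a K i x| * u x ^ 2 ∂(surf d)),
    by positivity, fun q s hq hs => ?_⟩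
  have hqm : ∀ i, MemLp q 2 ((surf d).restrict (facet K i)) := fun i =>
    memLp_facet_of_continuousOn hq.continuous.continuousOn
  have hJ : ∀ i, 0 ≤ ∫ x in facet K i, |aDotN a K i x| * (s x - q x) ^ 2 ∂(surf d) := fun i =>
    integral_sq_nonneg _ _ _
  have hG : ∀ i, 0 ≤ ∫ x in facet K i ∩ frontier Ω, |aDotN a K i x| * s x ^ 2 ∂(surf d) :=
    fun i => integral_sq_nonneg _ _ _
  have hV : 0 ≤ ∫ x in K.closedInterior, q x ^ 2 := integral_nonneg fun _ => sq_nonneg _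
  have hS : 0 ≤ ∫ x in K.closedInterior, (fderiv ℝ q x (a x)) ^ 2 :=
    integral_nonneg fun _ => sq_nonneg _
  have hJs := Finset.sum_nonneg fun i (_ : i ∈ Finset.univ) => hJ i
  have hGs := Finset.sum_nonneg fun i (_ : i ∈ Finset.univ) => hG i
  have hμV := mul_nonneg hμ.le hV
  have hhS := mul_nonneg hh.le hS
  set N := localEnergy μ a Ω K q s with hN
  rw [localEnergy] at hN
  have hJN : ∀ i, √(∫ x in facet K i, |aDotN a K i x| * (s x - q x) ^ 2 ∂(surf d)) ≤ √N := by
    intro i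
    refine Real.sqrt_le_sqrt ?_
    have := Finset.single_le_sum (fun j _ => hJ j) (Finset.mem_univ i)
    linarith
  have hGN : ∀ i, √(∫ x in facet K i ∩ frontier Ω, |aDotN a K i x| * s x ^ 2 ∂(surf d)) ≤ √N := by
    intro i
    refine Real.sqrt_le_sqrt ?_
    have := Finset.single_le_sum (fun j _ => hG j) (Finset.mem_univ i)
    linarith
  have t1 : |∫ x in K.closedInterior, μ * p x * q x| ≤
      √(∫ x in K.closedInterior, |μ| * p x ^ 2) * 1 * √N := by
    refine (abs_setIntegral_mul_le Set.Subset.rfl (b := fun _ => μ)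
      (hKint _ (continuousOn_const.mul (hp.continuous.pow 2).continuousOn))
      (hKint _ (continuousOn_const.mul (hq.continuous.pow 2).continuousOn))).trans ?_
    rw [mul_one]
    refine mul_le_mul_of_nonneg_left (Real.sqrt_le_sqrt ?_) (Real.sqrt_nonneg _)
    rw [integral_const_mul, abs_of_pos hμ]
    linarith
  have t2 : |∫ x in K.closedInterior, p x * fderiv ℝ q x (a x)| ≤
      √(∫ x in K.closedInterior, |(1 : ℝ)| * p x ^ 2) * √(cellSize K)⁻¹ * √N := by
    have h := abs_setIntegral_mul_le (ν := volume) (Set.Subset.refl K.closedInterior)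
      (b := fun _ => (1 : ℝ)) (f := p) (g := fun x => fderiv ℝ q x (a x))
      (hKint _ (continuousOn_const.mul (hp.continuous.pow 2).continuousOn))
      (hKint _ (continuousOn_const.mul ((continuousOn_fderiv_apply hac hq).pow 2)))
    simp only [one_mul] at h
    refine h.trans ?_
    rw [mul_assoc]
    simp only [abs_one, one_mul]
    refine mul_le_mul_of_nonneg_left (sqrt_le_sqrt_inv_mul_sqrt hh ?_) (Real.sqrt_nonneg _)
    linarith
  have t3 : |∑ i, ∫ x in outflow a K i, aDotN a K i x * p x * (s x - q x) ∂(surf d)| ≤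
      (∑ i, √(∫ x in facet K i, |aDotN a K i x| * p x ^ 2 ∂(surf d))) * √N := by
    rw [Finset.sum_mul]
    refine (Finset.abs_sum_le_sum_abs _ _).trans (Finset.sum_le_sum fun i _ => ?_)
    exact (abs_setIntegral_mul_le (outflow_subset a K i) (hint p i (hpm i))
      (hint _ i ((hs i).sub (hqm i)))).trans
      (mul_le_mul_of_nonneg_left (hJN i) (Real.sqrt_nonneg _))
  have t4 : |∑ i, ∫ x in inflow a K i, aDotN a K i x * u x * (s x - q x) ∂(surf d)| ≤
      (∑ i, √(∫ x in facet K i, |aDotN a K i x| * u x ^ 2 ∂(surf d))) * √N := by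
    rw [Finset.sum_mul]
    refine (Finset.abs_sum_le_sum_abs _ _).trans (Finset.sum_le_sum fun i _ => ?_)
    exact (abs_setIntegral_mul_le (inflow_subset a K i) (hint u i (hu i))
      (hint _ i ((hs i).sub (hqm i)))).trans
      (mul_le_mul_of_nonneg_left (hJN i) (Real.sqrt_nonneg _))
  have t5 : |∑ i, ∫ x in outflow a K i ∩ frontier Ω, aDotN a K i x * u x * s x ∂(surf d)| ≤
      (∑ i, √(∫ x in facet K i ∩ frontier Ω, |aDotN a K i x| * u x ^ 2 ∂(surf d))) * √N := by
    rw [Finset.sum_mul]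
    refine (Finset.abs_sum_le_sum_abs _ _).trans (Finset.sum_le_sum fun i _ => ?_)
    exact (abs_setIntegral_mul_le (Set.inter_subset_inter_left _ (outflow_subset a K i))
      ((hint u i (hu i)).mono_set Set.inter_subset_left)
      ((hint s i (hs i)).mono_set Set.inter_subset_left)).trans
      (mul_le_mul_of_nonneg_left (hGN i) (Real.sqrt_nonneg _))
  rw [localForm, add_mul, add_mul, add_mul, add_mul]
  rw [abs_le] at *
  constructor <;> linarith [t1.1, t1.2, t2.1, t2.2, t3.1, t3.2, t4.1, t4.2, t5.1, t5.2]

end Boundedness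

/-! ### The streamline test function -/

section StreamlineTest

lemma fderiv_add_const_mul {d k : ℕ} {q z : E d → ℝ} (hq : IsPoly k q) (hz : IsPoly k z) (δ : ℝ)
    (x v : E d) : fderiv ℝ (fun x => q x + δ * z x) x v = fderiv ℝ q x v + δ * fderiv ℝ z x v := by
  rw [((hq.differentiable x).hasFDerivAt.fun_add
    ((hz.differentiable x).hasFDerivAt.const_mul δ)).fderiv]
  simp

lemma integral_eq_add_const_mul {α : Type*} [MeasurableSpace α] {ν : Measure α} {f g h : α → ℝ}
    (hf : Integrable f ν) (hg : Integrable g ν) (δ : ℝ) (hh : ∀ x, h x = f x + δ * g x) :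
    ∫ x, h x ∂ν = ∫ x, f x ∂ν + δ * ∫ x, g x ∂ν := by
  simp only [hh]
  rw [integral_add hf (hg.const_mul δ), integral_const_mul]

lemma integral_le_add_mul {α : Type*} [MeasurableSpace α] {ν : Measure α} {f g h : α → ℝ}
    (hf : Integrable f ν) (hg : Integrable g ν) (b c : ℝ) (h0 : ∀ x, 0 ≤ h x)
    (hh : ∀ᵐ x ∂ν, h x ≤ b * f x + c * g x) :
    ∫ x, h x ∂ν ≤ b * ∫ x, f x ∂ν + c * ∫ x, g x ∂ν := by
  rw [← integral_const_mul, ← integral_const_mul,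
    ← integral_add (hf.const_mul b) (hg.const_mul c)]
  exact integral_mono_of_nonneg (Filter.Eventually.of_forall h0)
    ((hf.const_mul b).add (hg.const_mul c)) hh

variable {d : ℕ} [NeZero d] {Ω : Set (E d)} {T : Finset (Cell d)} {a : E d → E d} {μ : ℝ}

/-- With vanishing interface test function, integration by parts turns the form into the strong
residual and an upwind term on the inflow boundary. -/
lemma localForm_zero_interface {k : ℕ} (ha : IsAdvection Ω a) (hT : IsTriangulation Ω T)
    {K : Cell d} (hK : K ∈ T) {p z u : E d → ℝ} (hp : IsPoly k p) (hz : IsPoly k z)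
    (hu : ∀ i, MemLp u 2 ((surf d).restrict (facet K i))) :
    localForm μ a Ω K p u z (fun _ => 0) =
      (∫ x in K.closedInterior, μ * p x * z x)
      + (∫ x in K.closedInterior, z x * fderiv ℝ p x (a x))
      + ∑ i, ∫ x in inflow a K i, aDotN a K i x * (u x - p x) * z x ∂(surf d) := by
  have hac := ha.continuousOn_cell hT hK
  have hpm : ∀ i, MemLp p 2 ((surf d).restrict (facet K i)) := fun i =>
    memLp_facet_of_continuousOn hp.continuous.continuousOn
  have hzm : ∀ i, MemLp z 2 ((surf d).restrict (facet K i)) := fun i =>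
    memLp_facet_of_continuousOn hz.continuous.continuousOn
  have h1 := ha.integral_mul_fderiv hT hK hp hz
  have h2 : ∀ i, (∫ x in facet K i, aDotN a K i x * (p x * z x) ∂(surf d)) =
      - (∫ x in outflow a K i, aDotN a K i x * p x * (0 - z x) ∂(surf d)) -
        (∫ x in inflow a K i, aDotN a K i x * u x * (0 - z x) ∂(surf d)) -
        ∫ x in inflow a K i, aDotN a K i x * (u x - p x) * z x ∂(surf d) := by
    intro i
    have hb := continuousOn_aDotN hac i
    have e1 : IntegrableOn (fun x => aDotN a K i x * (p x * z x)) (facet K i) (surf d) :=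
      (integrableOn_facet_mul hb (hpm i) (hzm i)).congr
        (Filter.Eventually.of_forall fun x => by ring)
    have e2 : IntegrableOn (fun x => aDotN a K i x * u x * (0 - z x)) (inflow a K i) (surf d) := by
      have h : IntegrableOn (fun x => aDotN a K i x * u x * (0 - z x)) (facet K i) (surf d) :=
        (integrableOn_facet_mul hb (hu i) (hzm i)).neg.congr
          (Filter.Eventually.of_forall fun x => by simp)
      exact h.mono_set (inflow_subset a K i)
    have e3 : IntegrableOn (fun x => aDotN a K i x * (u x - p x) * z x) (inflow a K i) (surf d) :=
      (integrableOn_facet_mul hb ((hu i).sub (hpm i)) (hzm i)).mono_set (inflow_subset a K i)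
    rw [integral_facet_eq_add hac i e1, ← integral_neg, sub_sub, ← integral_add e2 e3,
      sub_eq_add_neg, ← integral_neg]
    congr 1
    · exact integral_congr_ae (Filter.Eventually.of_forall fun x => by ring)
    · exact integral_congr_ae (Filter.Eventually.of_forall fun x => by ring)
  rw [localForm, h1, Finset.sum_congr rfl fun i _ => h2 i]
  simp only [Finset.sum_sub_distrib, Finset.sum_neg_distrib, mul_zero, integral_zero,
    Finset.sum_const_zero]
  ring

lemma localForm_add_const_mul {k : ℕ} {K : Cell d} (hac : ContinuousOn a K.closedInterior)
    {p q z u s : E d → ℝ} (hp : IsPoly k p) (hq : IsPoly k q) (hz : IsPoly k z)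
    (hu : ∀ i, MemLp u 2 ((surf d).restrict (facet K i)))
    (hs : ∀ i, MemLp s 2 ((surf d).restrict (facet K i))) (δ : ℝ) :
    localForm μ a Ω K p u (fun x => q x + δ * z x) s =
      localForm μ a Ω K p u q s + δ * localForm μ a Ω K p u z (fun _ => 0) := by
  have hm : ∀ {f : E d → ℝ}, IsPoly k f → ∀ i, MemLp f 2 ((surf d).restrict (facet K i)) :=
    fun hf i => memLp_facet_of_continuousOn hf.continuous.continuousOn
  have h0 : ∀ i, MemLp (fun _ => (0 : ℝ)) 2 ((surf d).restrict (facet K i)) := fun i =>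
    memLp_facet_of_continuousOn continuousOn_const
  have hKint : ∀ f : E d → ℝ, ContinuousOn f K.closedInterior →
      IntegrableOn f K.closedInterior := fun f hf =>
    hf.integrableOn_compact K.isCompact_closedInterior
  have e1 : ∫ x in K.closedInterior, μ * p x * (q x + δ * z x) =
      (∫ x in K.closedInterior, μ * p x * q x) + δ * ∫ x in K.closedInterior, μ * p x * z x :=
    integral_eq_add_const_mul
      (hKint _ ((continuous_const.mul hp.continuous).mul hq.continuous).continuousOn)
      (hKint _ ((continuous_const.mul hp.continuous).mul hz.continuous).continuousOn) δ
      fun x => by simp only [Pi.mul_apply]; ring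
  have e2 : ∫ x in K.closedInterior, p x * fderiv ℝ (fun x => q x + δ * z x) x (a x) =
      (∫ x in K.closedInterior, p x * fderiv ℝ q x (a x)) +
        δ * ∫ x in K.closedInterior, p x * fderiv ℝ z x (a x) :=
    integral_eq_add_const_mul
      (hKint _ (hp.continuous.continuousOn.mul (continuousOn_fderiv_apply hac hq)))
      (hKint _ (hp.continuous.continuousOn.mul (continuousOn_fderiv_apply hac hz))) δ
      fun x => by rw [fderiv_add_const_mul hq hz]; simp only [Pi.mul_apply]; ring
  have e3 : ∀ (f : E d → ℝ) (i : Fin (d + 1)) (S : Set (E d)), S ⊆ facet K i →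
      MemLp f 2 ((surf d).restrict (facet K i)) →
      ∫ x in S, aDotN a K i x * f x * (s x - (q x + δ * z x)) ∂(surf d) =
      (∫ x in S, aDotN a K i x * f x * (s x - q x) ∂(surf d)) +
        δ * ∫ x in S, aDotN a K i x * f x * (0 - z x) ∂(surf d) := fun f i S hS hf =>
    integral_eq_add_const_mul
      ((integrableOn_facet_mul (continuousOn_aDotN hac i) hf
        ((hs i).sub (hm hq i))).mono_set hS)
      ((integrableOn_facet_mul (continuousOn_aDotN hac i) hf
        ((h0 i).sub (hm hz i))).mono_set hS) δ
      fun x => by simp only [Pi.sub_apply]; ring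
  simp only [localForm, e1, e2, fun i => e3 p i _ (outflow_subset a K i) (hm hp i),
    fun i => e3 u i _ (inflow_subset a K i) (hu i), Finset.sum_add_distrib, ← Finset.mul_sum,
    mul_zero, integral_zero, Finset.sum_const_zero]
  ring

lemma abs_aDotN_le_one {K : Cell d} (ha : ∀ x ∈ K.closedInterior, ‖a x‖ ≤ 1) (i : Fin (d + 1))
    {x : E d} (hx : x ∈ facet K i) : |aDotN a K i x| ≤ 1 := by
  refine (abs_real_inner_le_norm _ _).trans ?_
  rw [norm_normal, mul_one]
  exact ha x (facet_subset K i hx)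

lemma localEnergy_add_const_mul_le {k : ℕ} {K : Cell d} (hac : ContinuousOn a K.closedInterior)
    (hμ : 0 ≤ μ) {q z u : E d → ℝ} (hq : IsPoly k q) (hz : IsPoly k z)
    (hu : ∀ i, MemLp u 2 ((surf d).restrict (facet K i))) (δ : ℝ) :
    localEnergy μ a Ω K (fun x => q x + δ * z x) u ≤
      2 * localEnergy μ a Ω K q u + 2 * δ ^ 2 * localEnergy μ a Ω K z (fun _ => 0) := by
  have hKint : ∀ f : E d → ℝ, ContinuousOn f K.closedInterior →
      IntegrableOn f K.closedInterior := fun f hf =>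
    hf.integrableOn_compact K.isCompact_closedInterior
  have hm : ∀ {f : E d → ℝ}, IsPoly k f → ∀ i, MemLp f 2 ((surf d).restrict (facet K i)) :=
    fun hf i => memLp_facet_of_continuousOn hf.continuous.continuousOn
  have h0 : ∀ i, MemLp (fun _ => (0 : ℝ)) 2 ((surf d).restrict (facet K i)) := fun i =>
    memLp_facet_of_continuousOn continuousOn_const
  have hsq : ∀ x y : ℝ, (x + δ * y) ^ 2 ≤ 2 * x ^ 2 + 2 * δ ^ 2 * y ^ 2 := fun x y => by
    nlinarith [sq_nonneg (x - δ * y)]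
  have e1 : ∫ x in K.closedInterior, (q x + δ * z x) ^ 2 ≤
      2 * (∫ x in K.closedInterior, q x ^ 2) + 2 * δ ^ 2 * ∫ x in K.closedInterior, z x ^ 2 :=
    integral_le_add_mul (hKint _ (hq.continuous.pow 2).continuousOn)
      (hKint _ (hz.continuous.pow 2).continuousOn) _ _ (fun x => sq_nonneg _)
      (Filter.Eventually.of_forall fun x => hsq _ _)
  have e2 : ∫ x in K.closedInterior, (fderiv ℝ (fun x => q x + δ * z x) x (a x)) ^ 2 ≤
      2 * (∫ x in K.closedInterior, (fderiv ℝ q x (a x)) ^ 2) +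
        2 * δ ^ 2 * ∫ x in K.closedInterior, (fderiv ℝ z x (a x)) ^ 2 :=
    integral_le_add_mul (hKint _ ((continuousOn_fderiv_apply hac hq).pow 2))
      (hKint _ ((continuousOn_fderiv_apply hac hz).pow 2)) _ _ (fun x => sq_nonneg _)
      (Filter.Eventually.of_forall fun x => by rw [fderiv_add_const_mul hq hz]; exact hsq _ _)
  have e3 : ∀ i, ∫ x in facet K i, |aDotN a K i x| * (u x - (q x + δ * z x)) ^ 2 ∂(surf d) ≤
      2 * (∫ x in facet K i, |aDotN a K i x| * (u x - q x) ^ 2 ∂(surf d)) +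
        2 * δ ^ 2 * ∫ x in facet K i, |aDotN a K i x| * (0 - z x) ^ 2 ∂(surf d) := fun i =>
    integral_le_add_mul
      (integrableOn_facet_mul_sq (continuousOn_aDotN hac i).abs ((hu i).sub (hm hq i)))
      (integrableOn_facet_mul_sq (continuousOn_aDotN hac i).abs ((h0 i).sub (hm hz i))) _ _
      (fun x => by positivity)
      (Filter.Eventually.of_forall fun x => by
        have h1 := mul_le_mul_of_nonneg_left (hsq (u x - q x) (0 - z x))
          (abs_nonneg (aDotN a K i x))
        have h2 : u x - (q x + δ * z x) = u x - q x + δ * (0 - z x) := by ring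
        rw [h2]
        simp only [Pi.sub_apply]
        linarith)
  have e3s := Finset.sum_le_sum fun i (_ : i ∈ Finset.univ) => e3 i
  rw [Finset.sum_add_distrib, ← Finset.mul_sum, ← Finset.mul_sum] at e3s
  have e4 : 0 ≤ ∑ i, ∫ x in facet K i ∩ frontier Ω, |aDotN a K i x| * u x ^ 2 ∂(surf d) :=
    Finset.sum_nonneg fun i _ => integral_sq_nonneg _ _ _
  have e1' := mul_le_mul_of_nonneg_left e1 hμ
  have e2' := mul_le_mul_of_nonneg_left e2 (cellSize_pos K).le
  simp only [localEnergy, ne_eq, OfNat.ofNat_ne_zero, not_false_eq_true, zero_pow, mul_zero,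
    integral_zero, Finset.sum_const_zero, add_zero]
  linarith

/-- The test function `z = h_K (a(x₀) · ∇p)`, with the advective field frozen at a vertex `x₀` of
the cell, is a polynomial that recovers the streamline derivative and is itself controlled. The
error of freezing the field is of order `M h_K ‖∇p‖`, hence controlled by the `L²` norm of `p`
through the inverse inequality. -/
lemma exists_streamline_test (d k : ℕ) [NeZero d] (σ : ℝ) (M : ℝ≥0) {μ : ℝ} (hμ : 0 < μ) :
    ∃ C₁ C₂ : ℝ, 0 < C₁ ∧ 0 < C₂ ∧ ∀ (Ω : Set (E d)) (T : Finset (Cell d)) (a : E d → E d),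
      IsTriangulation Ω T → IsAdvection Ω a → seminormW1inf Ω a ≤ (M : ℝ≥0∞) →
      ∀ K ∈ T, IsShapeRegular σ K → cellSize K ≤ 1 → ∀ p : E d → ℝ, IsPoly k p →
      ∃ z : E d → ℝ, IsPoly k z ∧
        localEnergy μ a Ω K z (fun _ => 0) ≤
          C₂ * (cellSize K * (∫ x in K.closedInterior, (fderiv ℝ p x (a x)) ^ 2) +
            ∫ x in K.closedInterior, p x ^ 2) ∧
        ∀ u : E d → ℝ, (∀ i, MemLp u 2 ((surf d).restrict (facet K i))) →
          (1 / 2) * (cellSize K * ∫ x in K.closedInterior, (fderiv ℝ p x (a x)) ^ 2) -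
            C₁ * ((∫ x in K.closedInterior, p x ^ 2) +
              ∑ i, ∫ x in facet K i, |aDotN a K i x| * (u x - p x) ^ 2 ∂(surf d)) ≤
          localForm μ a Ω K p u z (fun _ => 0) := by
  obtain ⟨C, hC, hinv⟩ := exists_inverse_trace_const d k σ
  refine ⟨5 / 4 * M ^ 2 * C + μ / 2 * (1 + C) + 2 * (d + 1) * C,
    μ * C + (d + 2) * C * (2 + 2 * M ^ 2 * C), by positivity, by positivity, ?_⟩
  intro Ω T a hT ha hM K hK hσ hh1 p hp
  have hac := ha.continuousOn_cell hT hK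
  have hh := cellSize_pos K
  set h := cellSize K
  set b := a (K.points 0)
  have hx0 : K.points 0 ∈ K.closedInterior := K.point_mem_closedInterior 0
  have ha1 : ∀ x ∈ K.closedInterior, ‖a x‖ ≤ 1 := fun x hx =>
    ha.norm_le_one hT.isOpen x (hT.closedInterior_subset hK hx)
  have hz : IsPoly k (fun x => h * fderiv ℝ p x b) := (hp.fderiv_apply b).const_mul h
  have hKint : ∀ f : E d → ℝ, ContinuousOn f K.closedInterior →
      IntegrableOn f K.closedInterior := fun f hf =>
    hf.integrableOn_compact K.isCompact_closedInterior
  have hKm := K.isClosed_closedInterior.measurableSet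
  obtain ⟨hD, -⟩ := hinv K hσ p hp
  obtain ⟨hDz, hFz⟩ := hinv K hσ _ hz
  set V := ∫ x in K.closedInterior, p x ^ 2
  set S := ∫ x in K.closedInterior, (fderiv ℝ p x (a x)) ^ 2
  set D := ∫ x in K.closedInterior, ‖fderiv ℝ p x‖ ^ 2
  set R := ∫ x in K.closedInterior, (fderiv ℝ p x (a x) - fderiv ℝ p x b) ^ 2
  set Z := ∫ x in K.closedInterior, (fderiv ℝ p x b) ^ 2
  have hpD : ContinuousOn (fun x => ‖fderiv ℝ p x‖ ^ 2) K.closedInterior :=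
    (hp.continuous_fderiv.norm.pow 2).continuousOn
  have hps := continuousOn_fderiv_apply hac hp
  have hpb : ContinuousOn (fun x => fderiv ℝ p x b) K.closedInterior :=
    continuousOn_fderiv_apply continuousOn_const hp
  have hiV : IntegrableOn (fun x => p x ^ 2) K.closedInterior :=
    hKint _ (hp.continuous.pow 2).continuousOn
  have hiz : IntegrableOn (fun x => (h * fderiv ℝ p x b) ^ 2) K.closedInterior :=
    hKint _ (hz.continuous.pow 2).continuousOn
  have hiD := hKint _ hpD
  have hiS : IntegrableOn (fun x => (fderiv ℝ p x (a x)) ^ 2) K.closedInterior :=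
    hKint _ (hps.pow 2)
  have hiR : IntegrableOn (fun x => (fderiv ℝ p x (a x) - fderiv ℝ p x b) ^ 2)
    K.closedInterior := hKint _ ((hps.sub hpb).pow 2)
  have hV0 : 0 ≤ V := integral_nonneg fun _ => sq_nonneg _
  have hS0 : 0 ≤ S := integral_nonneg fun _ => sq_nonneg _
  have hR0 : 0 ≤ R := integral_nonneg fun _ => sq_nonneg _
  -- `R` is the error of freezing the field at the vertex.
  have hRD : R ≤ (M * h) ^ 2 * D := by
    have h1 : R ≤ (M * h) ^ 2 * D + 0 * D := by
      refine integral_le_add_mul hiD hiD _ _ (fun x => sq_nonneg _) ?_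
      filter_upwards [ae_restrict_mem hKm] with x hx
      have h2 : ‖a x - b‖ ≤ M * h := by
        rw [← dist_eq_norm]
        exact ((ha.lipschitzOnWith_cell hT hM hK).dist_le_mul x hx _ hx0).trans
          (mul_le_mul_of_nonneg_left (dist_le_cellSize K hx hx0) M.2)
      have h3 : ‖fderiv ℝ p x (a x - b)‖ ≤ ‖fderiv ℝ p x‖ * (M * h) :=
        ((fderiv ℝ p x).le_opNorm _).trans (mul_le_mul_of_nonneg_left h2 (norm_nonneg _))
      rw [← map_sub, ← sq_abs, ← Real.norm_eq_abs]
      have h4 := pow_le_pow_left₀ (norm_nonneg _) h3 2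
      linarith
    linarith
  have hapD : ∀ (q : E d → ℝ) (c : E d → E d), IsPoly k q → ContinuousOn c K.closedInterior →
      (∀ x ∈ K.closedInterior, ‖c x‖ ≤ 1) →
      ∫ x in K.closedInterior, (fderiv ℝ q x (c x)) ^ 2 ≤
        ∫ x in K.closedInterior, ‖fderiv ℝ q x‖ ^ 2 := by
    intro q c hq hcc hc
    refine setIntegral_mono_on (hKint _ ((continuousOn_fderiv_apply hcc hq).pow 2))
      (hKint _ (hq.continuous_fderiv.norm.pow 2).continuousOn) hKm fun x hx => ?_
    rw [← sq_abs, ← Real.norm_eq_abs]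
    refine pow_le_pow_left₀ (norm_nonneg _) (((fderiv ℝ q x).le_opNorm _).trans ?_) 2
    exact mul_le_of_le_one_right (norm_nonneg _) (hc x hx)
  have hZD : Z ≤ D := hapD p (fun _ => b) hp continuousOn_const fun _ _ => ha1 _ hx0
  have hZS : Z ≤ 2 * S + 2 * R :=
    integral_le_add_mul hiS hiR _ _ (fun x => sq_nonneg _) (Filter.Eventually.of_forall fun x => by
      nlinarith [sq_nonneg (2 * fderiv ℝ p x (a x) - fderiv ℝ p x b)])
  have hz2 : ∫ x in K.closedInterior, (h * fderiv ℝ p x b) ^ 2 = h ^ 2 * Z := by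
    rw [← integral_const_mul]
    simp only [mul_pow]
  rw [hz2] at hDz hFz
  set Dz := ∫ x in K.closedInterior, ‖fderiv ℝ (fun x => h * fderiv ℝ p x b) x‖ ^ 2
  have hDz' : Dz ≤ C * Z := by
    refine le_of_mul_le_mul_left ?_ (pow_pos hh 2)
    linarith
  have hFz' : ∀ i, ∫ x in facet K i, (h * fderiv ℝ p x b) ^ 2 ∂(surf d) ≤ C * (h * Z) := by
    intro i
    refine le_of_mul_le_mul_left ?_ hh
    have := hFz i
    nlinarith
  have hRV : R ≤ M ^ 2 * (C * V) := by
    have := mul_le_mul_of_nonneg_left hD (sq_nonneg (M : ℝ))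
    nlinarith
  have hhR : h * R ≤ M ^ 2 * (C * V) := (mul_le_of_le_one_left hR0 hh1).trans hRV
  have hhZ : h * Z ≤ 2 * (h * S) + 2 * (M ^ 2 * (C * V)) := by
    have := mul_le_mul_of_nonneg_left hZS hh.le
    linarith
  have hh2Z : h ^ 2 * Z ≤ C * V :=
    (mul_le_mul_of_nonneg_left hZD (sq_nonneg h)).trans hD
  have hFint : ∀ i, IntegrableOn (fun x => (h * fderiv ℝ p x b) ^ 2) (facet K i) (surf d) :=
    fun i => (memLp_facet_of_continuousOn hz.continuous.continuousOn).integrable_sq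
  refine ⟨fun x => h * fderiv ℝ p x b, hz, ?_, fun u hu => ?_⟩
  · have e2 := (hapD _ a hz hac ha1).trans hDz'
    have e3 : ∀ i, ∫ x in facet K i, |aDotN a K i x| * (0 - h * fderiv ℝ p x b) ^ 2 ∂(surf d) ≤
        C * (h * Z) := by
      intro i
      refine le_trans ?_ (hFz' i)
      refine integral_mono_of_nonneg (Filter.Eventually.of_forall fun x => by positivity)
        (hFint i) ?_
      filter_upwards [ae_restrict_mem (isClosed_facet K i).measurableSet] with x hx
      rw [zero_sub, neg_sq]
      exact mul_le_of_le_one_left (sq_nonneg _) (abs_aDotN_le_one ha1 i hx)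
    have e3s := Finset.sum_le_sum fun i (_ : i ∈ Finset.univ) => e3 i
    rw [Finset.sum_const, Finset.card_univ, Fintype.card_fin, nsmul_eq_mul] at e3s
    push_cast at e3s
    simp only [localEnergy, ne_eq, OfNat.ofNat_ne_zero, not_false_eq_true, zero_pow, mul_zero,
      integral_zero, Finset.sum_const_zero, add_zero]
    rw [hz2]
    have e1 := mul_le_mul_of_nonneg_left hh2Z hμ.le
    have e2' := mul_le_mul_of_nonneg_left e2 hh.le
    have e4 : ((d : ℝ) + 2) * C * (h * Z) ≤
        (d + 2) * C * (2 * (h * S) + 2 * (M ^ 2 * (C * V))) := by gcongr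
    have e5 : 0 ≤ μ * C * (h * S) := by positivity
    have e6 : 0 ≤ (d + 2) * C * (2 * V) := by positivity
    have e7 : 0 ≤ (d + 2) * C * (2 * M ^ 2 * C) * (h * S) := by positivity
    linarith
  · have hJ0 : ∀ i, 0 ≤ ∫ x in facet K i, |aDotN a K i x| * (u x - p x) ^ 2 ∂(surf d) :=
      fun i => integral_sq_nonneg _ _ _
    have hpm : ∀ i, MemLp p 2 ((surf d).restrict (facet K i)) := fun i =>
      memLp_facet_of_continuousOn hp.continuous.continuousOn
    rw [localForm_zero_interface ha hT hK hp hz hu]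
    have f1 : -(μ / 2 * (V + h ^ 2 * Z)) ≤
        ∫ x in K.closedInterior, μ * p x * (h * fderiv ℝ p x b) := by
      have e1 : ∫ x in K.closedInterior, (μ / 2) * (p x + h * fderiv ℝ p x b) ^ 2 =
          μ / 2 * (V + h ^ 2 * Z) +
            ∫ x in K.closedInterior, μ * p x * (h * fderiv ℝ p x b) := by
        rw [← hz2, show V = ∫ x in K.closedInterior, p x ^ 2 from rfl, ← integral_add hiV hiz,
          ← integral_const_mul, ← integral_add]
        · exact integral_congr_ae (Filter.Eventually.of_forall fun x => by ring)
        · exact (hiV.add hiz).const_mul _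
        · exact hKint _ ((continuous_const.mul hp.continuous).mul hz.continuous).continuousOn
      have e2 : 0 ≤ ∫ x in K.closedInterior, (μ / 2) * (p x + h * fderiv ℝ p x b) ^ 2 :=
        integral_nonneg fun x => by positivity
      linarith
    have f2 : h * (3 / 4 * S - R) ≤
        ∫ x in K.closedInterior, h * fderiv ℝ p x b * fderiv ℝ p x (a x) := by
      have e1 : h * (3 / 4 * S - R) = ∫ x in K.closedInterior, h * (3 / 4 *
          (fderiv ℝ p x (a x)) ^ 2 - (fderiv ℝ p x (a x) - fderiv ℝ p x b) ^ 2) := by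
        rw [integral_const_mul, integral_sub (hiS.const_mul _) hiR, integral_const_mul]
      rw [e1]
      refine integral_mono (((hiS.const_mul _).sub hiR).const_mul h)
        (hKint _ (hz.continuous.continuousOn.mul hps)) fun x => ?_
      simp only
      rw [mul_assoc]
      refine mul_le_mul_of_nonneg_left ?_ hh.le
      nlinarith [sq_nonneg (1 / 2 * fderiv ℝ p x (a x) -
        (fderiv ℝ p x (a x) - fderiv ℝ p x b))]
    have f3 : ∀ i, -(2 * (d + 1) * C *
        (∫ x in facet K i, |aDotN a K i x| * (u x - p x) ^ 2 ∂(surf d)) +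
          1 / (8 * (d + 1) * C) * (C * (h * Z))) ≤
        ∫ x in inflow a K i, aDotN a K i x * (u x - p x) * (h * fderiv ℝ p x b) ∂(surf d) := by
      intro i
      set J := ∫ x in facet K i, |aDotN a K i x| * (u x - p x) ^ 2 ∂(surf d)
      set F := ∫ x in facet K i, |aDotN a K i x| * (h * fderiv ℝ p x b) ^ 2 ∂(surf d)
      have hcs := abs_setIntegral_mul_le (inflow_subset a K i)
        (f := fun x => u x - p x) (g := fun x => h * fderiv ℝ p x b)
        (integrableOn_facet_mul_sq (continuousOn_aDotN hac i).abs ((hu i).sub (hpm i)))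
        (integrableOn_facet_mul_sq (continuousOn_aDotN hac i).abs
          (memLp_facet_of_continuousOn hz.continuous.continuousOn))
      have hF : F ≤ C * (h * Z) := by
        refine le_trans (integral_mono_of_nonneg
          (Filter.Eventually.of_forall fun x => by positivity) (hFint i) ?_) (hFz' i)
        filter_upwards [ae_restrict_mem (isClosed_facet K i).measurableSet] with x hx
        exact mul_le_of_le_one_left (sq_nonneg _) (abs_aDotN_le_one ha1 i hx)
      have hF0 : 0 ≤ F := integral_sq_nonneg _ _ _
      -- Young's inequality with a weight that lets the facet terms of `z` be absorbed.
      have hy : √J * √F ≤ 2 * (d + 1) * C * J + 1 / (8 * (d + 1) * C) * F := by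
        have hc : (0 : ℝ) < 2 * (d + 1) * C := by positivity
        have h8 : (8 * (d + 1) * C : ℝ) = 4 * (2 * (d + 1) * C) := by ring
        rw [h8]
        set c : ℝ := 2 * (d + 1) * C
        have e1 : 0 ≤ (2 * c * √J - √F) ^ 2 / (4 * c) := by positivity
        have e2 : (2 * c * √J - √F) ^ 2 / (4 * c) =
            c * √J ^ 2 + 1 / (4 * c) * √F ^ 2 - √J * √F := by
          field_simp
          ring
        rw [e2, Real.sq_sqrt (hJ0 i), Real.sq_sqrt hF0] at e1
        linarith
      have hF' : 1 / (8 * (d + 1) * C) * F ≤ 1 / (8 * (d + 1) * C) * (C * (h * Z)) :=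
        mul_le_mul_of_nonneg_left hF (by positivity)
      have := (abs_le.1 (hcs.trans hy)).1
      linarith
    have f3s := Finset.sum_le_sum fun i (_ : i ∈ Finset.univ) => f3 i
    rw [Finset.sum_neg_distrib, Finset.sum_add_distrib, ← Finset.mul_sum, Finset.sum_const,
      Finset.card_univ, Fintype.card_fin, nsmul_eq_mul] at f3s
    push_cast at f3s
    have f4 : ((d : ℝ) + 1) * (1 / (8 * (d + 1) * C) * (C * (h * Z))) = h * Z / 8 := by
      field_simp
    rw [f4] at f3s
    have hJs := Finset.sum_nonneg fun i (_ : i ∈ Finset.univ) => hJ0 i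
    set Js := ∑ i, ∫ x in facet K i, |aDotN a K i x| * (u x - p x) ^ 2 ∂(surf d)
    have g1 := mul_le_mul_of_nonneg_left hh2Z (by positivity : 0 ≤ μ / 2)
    have g2 : 0 ≤ (5 / 4 * M ^ 2 * C + μ / 2 * (1 + C)) * Js := by positivity
    have g3 : 0 ≤ 2 * (d + 1) * C * V := by positivity
    linarith

end StreamlineTest

/-! ### The inf-sup condition -/

section InfSup

variable {d : ℕ} [NeZero d] {Ω : Set (E d)} {T : Finset (Cell d)} {a : E d → E d} {μ : ℝ}

lemma memLp_facet_of_mem_starSpace {k : ℕ} {l : ℝ} {w : Pair d} (hw : w ∈ starSpace k l T)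
    {K : Cell d} (hK : K ∈ T) (i : Fin (d + 1)) :
    MemLp w.2 2 ((surf d).restrict (facet K i)) :=
  hw.2.1.1.mono_measure (Measure.restrict_mono (facet_subset_skeleton hK i) le_rfl)

/-- The form is a bounded functional of its second argument, with respect to the stability norm;
the bound may depend on the first argument and on the mesh. -/
lemma exists_abs_BA_le {k : ℕ} {l : ℝ} (ha : IsAdvection Ω a) (hT : IsTriangulation Ω T)
    (hμ : 0 < μ) {v : Pair d} (hv : v ∈ starSpace k l T) :
    ∃ C : ℝ, ∀ w ∈ starSpace k l T, |BA μ a Ω T v w| ≤ C * normA μ a Ω T w := by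
  have hloc : ∀ K ∈ T, ∃ C : ℝ, 0 ≤ C ∧ ∀ w ∈ starSpace k l T,
      |localForm μ a Ω K (v.1 K) v.2 (w.1 K) w.2| ≤
        C * √(localEnergy μ a Ω K (w.1 K) w.2) := by
    intro K hK
    have hac := ha.continuousOn_cell hT hK
    obtain ⟨p, hp, hvp⟩ := hv.1 K hK
    obtain ⟨C, hC, h⟩ := exists_localForm_le (μ := μ) ha hT hμ hK hp
      (memLp_facet_of_mem_starSpace hv hK)
    refine ⟨C, hC, fun w hw => ?_⟩
    obtain ⟨q, hq, hwq⟩ := hw.1 K hK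
    rw [localForm_congr hac hvp hwq, localEnergy_congr hwq]
    exact h q w.2 hq (memLp_facet_of_mem_starSpace hw hK)
  choose! C hC h using hloc
  refine ⟨∑ K ∈ T, C K, fun w hw => ?_⟩
  rw [BA_eq_sum_localForm, normA_eq_sqrt, Finset.sum_mul]
  refine (Finset.abs_sum_le_sum_abs _ _).trans (Finset.sum_le_sum fun K hK => ?_)
  refine (h K hK w hw).trans (mul_le_mul_of_nonneg_left (Real.sqrt_le_sqrt ?_) (hC K hK))
  exact Finset.single_le_sum (f := fun K => localEnergy μ a Ω K (w.1 K) w.2)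
    (fun K _ => localEnergy_nonneg hμ.le K _ _) hK

lemma bddAbove_quotients {k : ℕ} {l : ℝ} (ha : IsAdvection Ω a) (hT : IsTriangulation Ω T)
    (hμ : 0 < μ) {v : Pair d} (hv : v ∈ starSpace k l T) :
    BddAbove (quotients k l μ a Ω T v) := by
  obtain ⟨C, hC⟩ := exists_abs_BA_le ha hT hμ hv
  refine ⟨C, ?_⟩
  rintro r ⟨w, hw, hw0, rfl⟩
  have hw1 : 0 < normA μ a Ω T w := lt_of_le_of_ne (Real.sqrt_nonneg _) (Ne.symm hw0)
  rw [div_le_iff₀ hw1]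
  exact (le_abs_self _).trans (hC w hw)

lemma starSpace_neg {k : ℕ} {l : ℝ} {w : Pair d} (hw : w ∈ starSpace k l T) :
    ((fun K x => -w.1 K x, fun x => -w.2 x) : Pair d) ∈ starSpace k l T := by
  have hneg : ∀ {p : E d → ℝ}, IsPoly k p → IsPoly k fun x => -p x := fun hp => by
    simpa using hp.const_mul (-1)
  obtain ⟨h1, ⟨h2, h3, h4⟩, h5⟩ := hw
  refine ⟨fun K hK => ?_, ⟨h2.neg, fun hl0 hl1 => ?_, fun hl => ?_⟩, fun K hK i => ?_⟩
  · obtain ⟨p, hp, hwp⟩ := h1 K hK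
    exact ⟨fun x => -p x, hneg hp, fun x hx => by simp only [hwp x hx]⟩
  · have hfun : (fun p : E d × E d =>
        (-w.2 p.1 - -w.2 p.2) / dist p.1 p.2 ^ (((d : ℝ) - 1) / 2 + l)) =
        -fun p : E d × E d => (w.2 p.1 - w.2 p.2) / dist p.1 p.2 ^ (((d : ℝ) - 1) / 2 + l) := by
      funext p
      simp only [Pi.neg_apply]
      ring
    rw [hfun]
    exact (h3 hl0 hl1).neg
  · obtain ⟨g, hg, h⟩ := h4 hl
    refine ⟨g, hg, ?_⟩
    filter_upwards [h] with p hp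
    rwa [neg_sub_neg, abs_sub_comm]
  · obtain ⟨p, hp, hwp⟩ := h5 K hK i
    refine ⟨fun x => -p x, hneg hp, ?_⟩
    filter_upwards [hwp] with x hx
    simp only [hx]

lemma BA_neg_right (v w : Pair d) :
    BA μ a Ω T v (fun K x => -w.1 K x, fun x => -w.2 x) = -BA μ a Ω T v w := by
  have hsub : ∀ x y : ℝ, -x - -y = -(x - y) := fun x y => by ring
  simp only [BA, real_inner_gradient, fderiv_fun_neg, neg_apply, mul_neg, hsub, integral_neg,
    Finset.sum_neg_distrib]
  ring

lemma normA_neg (w : Pair d) :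
    normA μ a Ω T (fun K x => -w.1 K x, fun x => -w.2 x) = normA μ a Ω T w := by
  have hsub : ∀ x y : ℝ, -x - -y = -(x - y) := fun x y => by ring
  simp only [normA, real_inner_gradient, fderiv_fun_neg, neg_apply, hsub, neg_sq]

/-- Replacing a test function by its negative changes the sign of the quotient, so the supremum
cannot be negative (over the empty set, the supremum is `0` by convention). -/
lemma sSup_quotients_nonneg {k : ℕ} {l : ℝ} {v : Pair d}
    (hbdd : BddAbove (quotients k l μ a Ω T v)) : 0 ≤ sSup (quotients k l μ a Ω T v) := by
  rcases (quotients k l μ a Ω T v).eq_empty_or_nonempty with he | ⟨r, w, hw, hw0, hr⟩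
  · rw [he, Real.sSup_empty]
  · have h1 : r ≤ sSup (quotients k l μ a Ω T v) := le_csSup hbdd ⟨w, hw, hw0, hr⟩
    have h2 : -r ≤ sSup (quotients k l μ a Ω T v) :=
      le_csSup hbdd ⟨_, starSpace_neg hw, by rwa [normA_neg], by
        rw [BA_neg_right, normA_neg, neg_div, hr]⟩
    linarith

/-- For every discrete function `v` there is a test function, namely `v` plus a small multiple of
its streamline derivative, that realizes the inf-sup condition. -/
lemma exists_test_function (d k : ℕ) [NeZero d] (σ : ℝ) (M : ℝ≥0) {μ : ℝ} (hμ : 0 < μ) :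
    ∃ c D : ℝ, 0 < c ∧ 0 < D ∧ ∀ (Ω : Set (E d)) (T : Finset (Cell d)) (a : E d → E d) (l : ℝ),
      IsTriangulation Ω T → (∀ K ∈ T, IsShapeRegular σ K ∧ cellSize K ≤ 1) →
      IsAdvection Ω a → seminormW1inf Ω a ≤ (M : ℝ≥0∞) → ∀ v ∈ starSpace k l T,
      ∃ w ∈ starSpace k l T, c * normA μ a Ω T v ^ 2 ≤ BA μ a Ω T v w ∧
        normA μ a Ω T w ≤ D * normA μ a Ω T v := by
  obtain ⟨C₁, C₂, hC₁, hC₂, htest⟩ := exists_streamline_test d k σ M hμ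
  -- `δ C₁` is so small that the negative terms are absorbed by half of the coercivity bounds
  -- `μ ‖p‖²` and `J / 2`.
  set δ : ℝ := min (μ / 2) (1 / 4) / C₁
  have hδ : 0 < δ := by positivity
  have hδC : δ * C₁ = min (μ / 2) (1 / 4) := div_mul_cancel₀ _ hC₁.ne'
  have hδ1 : δ * C₁ ≤ μ / 2 := hδC.trans_le (min_le_left _ _)
  have hδ2 : δ * C₁ ≤ 1 / 4 := hδC.trans_le (min_le_right _ _)
  have hD : 0 < 2 + 2 * δ ^ 2 * (C₂ * (1 + 1 / μ)) := by positivity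
  refine ⟨min (1 / 4) (δ / 2), √(2 + 2 * δ ^ 2 * (C₂ * (1 + 1 / μ))), by positivity,
    Real.sqrt_pos.2 hD, ?_⟩
  intro Ω T a l hT hreg ha hM v hv
  choose! P hP hvP using hv.1
  have hu := fun K (hK : K ∈ T) => memLp_facet_of_mem_starSpace hv hK
  choose! z hz hzE hzB using fun K (hK : K ∈ T) =>
    htest Ω T a hT ha hM K hK (hreg K hK).1 (hreg K hK).2 (P K) (hP K hK)
  have hE : ∀ K ∈ T, localEnergy μ a Ω K (v.1 K) v.2 = localEnergy μ a Ω K (P K) v.2 :=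
    fun K hK => localEnergy_congr (hvP K hK) v.2
  have hN : normA μ a Ω T v ^ 2 = ∑ K ∈ T, localEnergy μ a Ω K (P K) v.2 := by
    rw [normA_eq_sqrt, Real.sq_sqrt (Finset.sum_nonneg fun K _ => localEnergy_nonneg hμ.le K _ _)]
    exact Finset.sum_congr rfl hE
  refine ⟨(fun K x => P K x + δ * z K x, v.2),
    ⟨fun K hK => ⟨_, (hP K hK).add ((hz K hK).const_mul δ), fun _ _ => rfl⟩, hv.2⟩, ?_, ?_⟩
  · have hB : BA μ a Ω T v (fun K x => P K x + δ * z K x, v.2) =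
        (∑ K ∈ T, localForm μ a Ω K (P K) v.2 (P K) v.2) +
          ∑ K ∈ T, δ * localForm μ a Ω K (P K) v.2 (z K) (fun _ => 0) := by
      rw [BA_eq_sum_localForm, ← Finset.sum_add_distrib]
      refine Finset.sum_congr rfl fun K hK => ?_
      have hac := ha.continuousOn_cell hT hK
      rw [localForm_congr hac (hvP K hK) (fun _ _ => rfl)]
      exact localForm_add_const_mul hac (hP K hK) (hP K hK) (hz K hK) (hu K hK) (hu K hK) δ
    rw [hB, sum_localForm_self ha hT hP hu, hN, ← Finset.sum_add_distrib, Finset.mul_sum]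
    refine Finset.sum_le_sum fun K hK => ?_
    have h1 := mul_le_mul_of_nonneg_left (hzB K hK v.2 (hu K hK)) hδ.le
    have hV : 0 ≤ ∫ x in K.closedInterior, P K x ^ 2 := integral_nonneg fun _ => sq_nonneg _
    have hS : 0 ≤ cellSize K * ∫ x in K.closedInterior, (fderiv ℝ (P K) x (a x)) ^ 2 :=
      mul_nonneg (cellSize_pos K).le (integral_nonneg fun _ => sq_nonneg _)
    have hJ : 0 ≤ ∑ i, ∫ x in facet K i, |aDotN a K i x| * (v.2 x - P K x) ^ 2 ∂(surf d) :=
      Finset.sum_nonneg fun i _ => integral_sq_nonneg _ _ _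
    have hG : 0 ≤ ∑ i, ∫ x in facet K i ∩ frontier Ω, |aDotN a K i x| * v.2 x ^ 2 ∂(surf d) :=
      Finset.sum_nonneg fun i _ => integral_sq_nonneg _ _ _
    rw [localEnergy]
    set V := ∫ x in K.closedInterior, P K x ^ 2
    set S := cellSize K * ∫ x in K.closedInterior, (fderiv ℝ (P K) x (a x)) ^ 2
    set J := ∑ i, ∫ x in facet K i, |aDotN a K i x| * (v.2 x - P K x) ^ 2 ∂(surf d)
    set G := ∑ i, ∫ x in facet K i ∩ frontier Ω, |aDotN a K i x| * v.2 x ^ 2 ∂(surf d)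
    have hc1 := min_le_left (1 / 4) (δ / 2)
    have hc2 := min_le_right (1 / 4) (δ / 2)
    set c := min (1 / 4) (δ / 2)
    have g1 := mul_le_mul_of_nonneg_right hδ1 hV
    have g2 := mul_le_mul_of_nonneg_right hδ2 hJ
    have g3 := mul_le_mul_of_nonneg_right hc1 (mul_nonneg hμ.le hV)
    have g4 := mul_le_mul_of_nonneg_right hc2 hS
    have g5 := mul_le_mul_of_nonneg_right hc1 hJ
    have g6 := mul_le_mul_of_nonneg_right hc1 hG
    have g7 := mul_nonneg hμ.le hV
    linarith
  · rw [normA_eq_sqrt, normA_eq_sqrt, ← Real.sqrt_mul hD.le, Finset.mul_sum]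
    refine Real.sqrt_le_sqrt (Finset.sum_le_sum fun K hK => ?_)
    have hac := ha.continuousOn_cell hT hK
    rw [hE K hK]
    refine (localEnergy_add_const_mul_le hac hμ.le (hP K hK) (hz K hK) (hu K hK) δ).trans ?_
    rw [add_mul, mul_assoc (2 * δ ^ 2)]
    refine add_le_add_right (mul_le_mul_of_nonneg_left ((hzE K hK).trans ?_) (by positivity)) _
    rw [mul_assoc]
    refine mul_le_mul_of_nonneg_left ?_ hC₂.le
    have hV : 0 ≤ ∫ x in K.closedInterior, P K x ^ 2 := integral_nonneg fun _ => sq_nonneg _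
    have hS : 0 ≤ cellSize K * ∫ x in K.closedInterior, (fderiv ℝ (P K) x (a x)) ^ 2 :=
      mul_nonneg (cellSize_pos K).le (integral_nonneg fun _ => sq_nonneg _)
    have hJ : 0 ≤ ∑ i, ∫ x in facet K i, |aDotN a K i x| * (v.2 x - P K x) ^ 2 ∂(surf d) :=
      Finset.sum_nonneg fun i _ => integral_sq_nonneg _ _ _
    have hG : 0 ≤ ∑ i, ∫ x in facet K i ∩ frontier Ω, |aDotN a K i x| * v.2 x ^ 2 ∂(surf d) :=
      Finset.sum_nonneg fun i _ => integral_sq_nonneg _ _ _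
    have hμV := mul_nonneg hμ.le hV
    have h1 : cellSize K * (∫ x in K.closedInterior, (fderiv ℝ (P K) x (a x)) ^ 2) ≤
        localEnergy μ a Ω K (P K) v.2 := by
      rw [localEnergy]
      linarith
    have h2 : (∫ x in K.closedInterior, P K x ^ 2) ≤
        1 / μ * localEnergy μ a Ω K (P K) v.2 := by
      rw [one_div, ← div_eq_inv_mul, le_div_iff₀ hμ, localEnergy]
      linarith
    linarith

end InfSup
end InterfaceStab

theorem mainTheorem1 (d k : ℕ) [NeZero d] (hd : d ≤ 3) (μ : ℝ) (hμ : 0 < μ)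
    (σ : ℝ) (M : ℝ≥0) :
    ∃ β : ℝ, 0 < β ∧
      ∀ (Ω : Set (InterfaceStab.E d)) (T : Finset (InterfaceStab.Cell d))
        (a : InterfaceStab.E d → InterfaceStab.E d) (l : ℝ),
        InterfaceStab.IsTriangulation Ω T →
        (∀ K ∈ T, InterfaceStab.IsShapeRegular σ K ∧ InterfaceStab.cellSize K ≤ 1) →
        InterfaceStab.IsAdvection Ω a →
        InterfaceStab.seminormW1inf Ω a ≤ (M : ℝ≥0∞) →
        0 ≤ l → l ≤ 1 →
        ∀ v ∈ InterfaceStab.starSpace k l T,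
          BddAbove (InterfaceStab.quotients k l μ a Ω T v) ∧
          β * InterfaceStab.normA μ a Ω T v ≤
            sSup (InterfaceStab.quotients k l μ a Ω T v) := by
  obtain ⟨c, D, hc, hD, h⟩ := InterfaceStab.exists_test_function d k σ M hμ
  refine ⟨c / D, div_pos hc hD, fun Ω T a l hT hreg ha hM _ _ v hv => ?_⟩
  have hbdd := InterfaceStab.bddAbove_quotients ha hT hμ hv
  refine ⟨hbdd, ?_⟩
  have hv0 : 0 ≤ InterfaceStab.normA μ a Ω T v := Real.sqrt_nonneg _
  rcases hv0.eq_or_lt with hv0 | hv0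
  · rw [← hv0, mul_zero]
    exact InterfaceStab.sSup_quotients_nonneg hbdd
  obtain ⟨w, hw, hB, hwv⟩ := h Ω T a l hT hreg ha hM v hv
  have hpos : 0 < c * InterfaceStab.normA μ a Ω T v ^ 2 := by positivity
  -- The form is bounded by the norm of `w`, which therefore cannot vanish.
  have hw0 : InterfaceStab.normA μ a Ω T w ≠ 0 := by
    intro h0
    obtain ⟨C, hC⟩ := InterfaceStab.exists_abs_BA_le ha hT hμ hv
    have h1 := (le_abs_self _).trans (hC w hw)
    rw [h0, mul_zero] at h1
    linarith
  have hw1 : 0 < InterfaceStab.normA μ a Ω T w :=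
    lt_of_le_of_ne (Real.sqrt_nonneg _) (Ne.symm hw0)
  refine le_trans ?_ (le_csSup hbdd ⟨w, hw, hw0, rfl⟩)
  rw [le_div_iff₀ hw1]
  calc c / D * InterfaceStab.normA μ a Ω T v * InterfaceStab.normA μ a Ω T w
      ≤ c / D * InterfaceStab.normA μ a Ω T v * (D * InterfaceStab.normA μ a Ω T v) := by gcongr
    _ = c * InterfaceStab.normA μ a Ω T v ^ 2 := by field_simp
    _ ≤ _ := hB
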